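/- **Notation.** Let $N\ge 1$ and $\Gamma=\Gamma(N)\subset SL_2(\mathbb Z)$ the principal congruence subgroup. Let $\mathcal M=\bigoplus_{m\ge 0}\mathcal M_m$ be the modular tower, where $\mathcal M_m$ is the union over all $N'\ge 1$ of the spaces of (holomorphic) modular forms of weight $m$ for $\Gamma(N')$. A holomorphic $f:\mathbb H\to\mathbb C$ is quasimodular of level $N'$, weight $k\ge 0$ and depth $s\ge 0$ if there are functions $f_0,\dots,f_s$, with $f_s\neq 0$, holomorphic on $\mathbb H$ and at the cusps (i.e. $(cz+d)^{-(k-2j)}f_j(\gamma z)$ is bounded as $\operatorname{Im} z\to\infty$ for every $\gamma=\begin{pmatrix}a&b\\c&d\end{pmatrix}\in SL_2(\mathbb Z)$), such that $(cz+d)^{-k}f(\gamma z)=\sum_{j=0}^s f_j(z)\left(\frac{c}{cz+d}\right)^j$ for all $\gamma=\begin{pmatrix}a&b\\c&d\end{pmatrix}\in\Gamma(N')$; the zero function is quasimodular of every level and weight, of depth $0$. Let $\mathcal{QM}$ be the space of finite sums of quasimodular forms of arbitrary levels, weights and depths. With $G_2(z)=-\frac1{24}+\sum_{n\ge1}\sigma_1(n)e^{2\pi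 i nz}$, every $f\in\mathcal{QM}$ is uniquely a polynomial $f=\sum_i a_i(f)G_2^i$ with $a_i(f)\in\mathcal M$. For $\alpha=\begin{pmatrix}a&b\\c&d\end{pmatrix}\in GL_2^+(\mathbb Q)$ and $g$ of weight $m$ put $(g|\alpha)(z)=\det(\alpha)^{m/2}(cz+d)^{-m}g\left(\frac{az+b}{cz+d}\right)$, extended linearly to $\mathcal M$, and for $f\in\mathcal{QM}$ put $f\|\alpha=\sum_i(a_i(f)|\alpha)\,G_2^i$. Let $\Delta(z)=(2\pi)^{12}q\prod_{n\ge1}(1-q^n)^{24}$, $q=e^{2\pi iz}$. For $g\in\mathcal M_m$ put $$Y(g)=\tfrac m2\,g,\qquad X(g)=\frac1{2\pi i}g'-\frac1{12\pi i}\frac{\Delta'}{\Delta}\,Y(g),$$ extend $X$ and $Y$ linearly to $\mathcal M$ and then to $\mathcal{QM}$ by $X(f)=\sum_iX(a_i(f))G_2^i$, $Y(f)=\sum_iY(a_i(f))G_2^i$, and put $\mu_\alpha=\frac1{12\pi i}\frac{d}{dz}\log\frac{\Delta|\alpha}{\Delta}$. Let $\mathcal Q(\Gamma)$ be the complex vector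 space of functions $F:\Gamma\backslash GL_2^+(\mathbb Q)\to\mathcal{QM}$, $\Gamma\alpha\mapsto F_\alpha$, of finite support with $F_{\alpha\gamma}=F_\alpha\|\gamma$ for all $\gamma\in\Gamma$. It carries the associative products $$(F\ast G)_\alpha=\sum_{\beta\in\Gamma\backslash GL_2^+(\mathbb Q)}F_\beta\cdot(G_{\alpha\beta^{-1}}\|\beta),\qquad (F\ast^rG)_\alpha=\sum_{\beta\in\Gamma\backslash SL_2(\mathbb Z)}F_\beta\cdot(G_{\alpha\beta^{-1}}\|\beta),$$ of which $\ast$ has a unit element. Let $\mathcal H_1$ be the Hopf algebra that, as an algebra, is the universal enveloping algebra of the complex Lie algebra with generators $X,Y,\delta_n$ ($n\ge1$) and relations $[Y,X]=X$, $[X,\delta_n]=\delta_{n+1}$, $[Y,\delta_n]=n\delta_n$, $[\delta_k,\delta_l]=0$, with coproduct determined by $\Delta(X)=X\otimes1+1\otimes X+\delta_1\otimes Y$, $\Delta(Y)=Y\otimes1+1\otimes Y$, $\Delta(\delta_1)=\delta_1\otimes1+1\otimes\delta_1$, counit $\varepsilon$ vanishing on $X,Y,\delta_1$, and antipode $S(X)=-X+\delta_1Y$,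 $S(Y)=-Y$, $S(\delta_1)=-\delta_1$. Let $\mathfrak h_1$ be the universal enveloping algebra, with its usual Hopf algebra structure, of the complex Lie algebra with generators $X,Y$ and the relation $[Y,X]=X$. **Theorem.** Let $N\ge1$ and $\Gamma=\Gamma(N)$. (a) The formulas $$X(F)_\alpha=X(F_\alpha),\qquad Y(F)_\alpha=Y(F_\alpha),\qquad \delta_n(F)_\alpha=X^{n-1}(\mu_\alpha)\cdot F_\alpha\quad(n\ge1)$$ make $\mathcal Q(\Gamma)$ an $\mathcal H_1$-module, and this is a Hopf action on the algebra $(\mathcal Q(\Gamma),\ast)$: for all $h\in\mathcal H_1$ and $F^1,F^2\in\mathcal Q(\Gamma)$, $$h(F^1\ast F^2)=\sum h_{(1)}(F^1)\ast h_{(2)}(F^2),\qquad \Delta(h)=\sum h_{(1)}\otimes h_{(2)},$$ and $h(1)=\varepsilon(h)\,1$ for the unit $1$ of $(\mathcal Q(\Gamma),\ast)$. (b) The formulas $X(F)_\alpha=X(F_\alpha)$, $Y(F)_\alpha=Y(F_\alpha)$ make $\mathcal Q(\Gamma)$ an $\mathfrak h_1$-module, and this is a Hopf action on $\mathcal Q^r(\Gamma)=(\mathcal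 Q(\Gamma),\ast^r)$: for all $h\in\mathfrak h_1$ and $F^1,F^2\in\mathcal Q(\Gamma)$, $h(F^1\ast^rF^2)=\sum h_{(1)}(F^1)\ast^rh_{(2)}(F^2)$. In particular $X$ and $Y$ act by derivations. -/

import Mathlib

open scoped TensorProduct DirectSum MatrixGroups Manifold ModularForm UpperHalfPlane

noncomputable section

namespace QMHecke

attribute [local instance 100] LieRing.ofAssociativeRing

/-! ### Lie algebras given by generators and relations -/

/-- The complex Lie algebra presented by the generators `G` and the relations `r = 0`, `r ∈ R`. -/
abbrev PresentedLie {G : Type} (R : Set (FreeLieAlgebra ℂ G)) : Type :=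
  FreeLieAlgebra ℂ G ⧸ LieSubmodule.lieSpan ℂ (FreeLieAlgebra ℂ G) R

/-- The class of a generator. -/
def PresentedLie.of {G : Type} (R : Set (FreeLieAlgebra ℂ G)) (g : G) : PresentedLie R :=
  LieSubmodule.Quotient.mk (FreeLieAlgebra.of ℂ g)

/-- The class of an element of the free Lie algebra. -/
def PresentedLie.mk {G : Type} (R : Set (FreeLieAlgebra ℂ G)) :
    FreeLieAlgebra ℂ G →ₗ⁅ℂ⁆ PresentedLie R :=
  { (LieSubmodule.lieSpan ℂ (FreeLieAlgebra ℂ G) R).toSubmodule.mkQ with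
    map_lie' := fun {x y} => LieSubmodule.Quotient.mk_bracket
      (I := LieSubmodule.lieSpan ℂ (FreeLieAlgebra ℂ G) R) x y }

theorem PresentedLie.mk_eq_zero {G : Type} {R : Set (FreeLieAlgebra ℂ G)}
    {r : FreeLieAlgebra ℂ G} (hr : r ∈ R) : PresentedLie.mk R r = 0 :=
  (Submodule.Quotient.mk_eq_zero (LieSubmodule.lieSpan ℂ (FreeLieAlgebra ℂ G) R).toSubmodule).2
    (LieSubmodule.subset_lieSpan hr)

/-- The universal property of a presentation. -/
def PresentedLie.lift {G : Type} (R : Set (FreeLieAlgebra ℂ G)) {L : Type} [LieRing L]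
    [LieAlgebra ℂ L] (f : G → L) (hf : ∀ r ∈ R, FreeLieAlgebra.lift ℂ f r = 0) :
    PresentedLie R →ₗ⁅ℂ⁆ L :=
  { (LieSubmodule.lieSpan ℂ (FreeLieAlgebra ℂ G) R).toSubmodule.liftQ
      (FreeLieAlgebra.lift ℂ f : FreeLieAlgebra ℂ G →ₗ[ℂ] L) (by
        have h : LieSubmodule.lieSpan ℂ (FreeLieAlgebra ℂ G) R
            ≤ (FreeLieAlgebra.lift ℂ f).ker :=
          LieSubmodule.lieSpan_le.2 (fun r hr => (LieHom.mem_ker).2 (hf r hr))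
        intro x hx
        exact (LieHom.mem_ker).1 (h hx)) with
    map_lie' := fun {x y} => by
      obtain ⟨a, rfl⟩ := Submodule.mkQ_surjective _ x
      obtain ⟨b, rfl⟩ := Submodule.mkQ_surjective _ y
      exact LieHom.map_lie (FreeLieAlgebra.lift ℂ f) a b }

theorem PresentedLie.lift_of {G : Type} (R : Set (FreeLieAlgebra ℂ G)) {L : Type} [LieRing L]
    [LieAlgebra ℂ L] (f : G → L) (hf : ∀ r ∈ R, FreeLieAlgebra.lift ℂ f r = 0) (g : G) :
    PresentedLie.lift R f hf (PresentedLie.of R g) = f g :=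
  FreeLieAlgebra.lift_of_apply f g

theorem PresentedLie.hom_ext {G : Type} {R : Set (FreeLieAlgebra ℂ G)} {L : Type} [LieRing L]
    [LieAlgebra ℂ L] {f g : PresentedLie R →ₗ⁅ℂ⁆ L}
    (h : ∀ x, f (PresentedLie.of R x) = g (PresentedLie.of R x)) : f = g := by
  have h1 : f.comp (PresentedLie.mk R) = g.comp (PresentedLie.mk R) :=
    FreeLieAlgebra.hom_ext h
  ext x
  obtain ⟨a, rfl⟩ := Submodule.mkQ_surjective _ x
  exact LieHom.congr_fun h1 a

/-- The universal enveloping algebra of a presented Lie algebra. -/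
abbrev PresentedU {G : Type} (R : Set (FreeLieAlgebra ℂ G)) : Type :=
  UniversalEnvelopingAlgebra ℂ (PresentedLie R)

/-- A generator of the Lie algebra as an element of the enveloping algebra. -/
def PresentedU.of {G : Type} (R : Set (FreeLieAlgebra ℂ G)) (g : G) : PresentedU R :=
  UniversalEnvelopingAlgebra.ι ℂ (PresentedLie.of R g)

/-- The algebra map from the enveloping algebra defined by the images of the generators. -/
def PresentedU.lift {G : Type} (R : Set (FreeLieAlgebra ℂ G)) {A : Type} [Ring A] [Algebra ℂ A]
    (f : G → A) (hf : ∀ r ∈ R, FreeLieAlgebra.lift ℂ f r = 0) : PresentedU R →ₐ[ℂ] A :=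
  UniversalEnvelopingAlgebra.lift ℂ (PresentedLie.lift R f hf)

theorem PresentedU.lift_of {G : Type} (R : Set (FreeLieAlgebra ℂ G)) {A : Type} [Ring A]
    [Algebra ℂ A] (f : G → A) (hf : ∀ r ∈ R, FreeLieAlgebra.lift ℂ f r = 0) (g : G) :
    PresentedU.lift R f hf (PresentedU.of R g) = f g := by
  unfold PresentedU.lift PresentedU.of
  rw [UniversalEnvelopingAlgebra.lift_ι_apply, PresentedLie.lift_of]

theorem PresentedU.hom_ext {G : Type} {R : Set (FreeLieAlgebra ℂ G)} {A : Type} [Ring A]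
    [Algebra ℂ A] {f g : PresentedU R →ₐ[ℂ] A}
    (h : ∀ x, f (PresentedU.of R x) = g (PresentedU.of R x)) : f = g := by
  apply UniversalEnvelopingAlgebra.hom_ext
  exact PresentedLie.hom_ext h

/-- The generators satisfy the relations in the enveloping algebra. -/
theorem PresentedU.rel {G : Type} {R : Set (FreeLieAlgebra ℂ G)} {r : FreeLieAlgebra ℂ G}
    (hr : r ∈ R) : FreeLieAlgebra.lift ℂ (PresentedU.of R) r = 0 := by
  have h : FreeLieAlgebra.lift ℂ (PresentedU.of R)
      = (UniversalEnvelopingAlgebra.ι ℂ).comp (PresentedLie.mk R) := by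
    apply FreeLieAlgebra.hom_ext
    intro x
    rw [FreeLieAlgebra.lift_of_apply]
    rfl
  rw [h, LieHom.comp_apply, PresentedLie.mk_eq_zero hr, map_zero]

/-- A bialgebra whose underlying algebra is generated by elements satisfying the antipode
identities for an algebra map `S : H → Hᵐᵒᵖ` is a Hopf algebra: the set of elements satisfying
the antipode identities is a subalgebra. -/
theorem antipode_aux {H : Type} [Ring H] [Bialgebra ℂ H] (S : H →ₐ[ℂ] Hᵐᵒᵖ) (s : Set H)
    (hs : Algebra.adjoin ℂ s = ⊤) (T : H →ₗ[ℂ] H) (hT : ∀ a, T a = (S a).unop)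
    (h : ∀ a ∈ s, LinearMap.mul' ℂ H (T.rTensor H (Coalgebra.comul a))
        = algebraMap ℂ H (Coalgebra.counit a) ∧
      LinearMap.mul' ℂ H (T.lTensor H (Coalgebra.comul a))
        = algebraMap ℂ H (Coalgebra.counit a)) (a : H) :
    LinearMap.mul' ℂ H (T.rTensor H (Coalgebra.comul a))
        = algebraMap ℂ H (Coalgebra.counit a) ∧
      LinearMap.mul' ℂ H (T.lTensor H (Coalgebra.comul a))
        = algebraMap ℂ H (Coalgebra.counit a) := by
  have hTm : ∀ x y, T (x * y) = T y * T x := by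
    intro x y; simp [hT]
  have hT1 : T 1 = 1 := by simp [hT]
  have ha : a ∈ Algebra.adjoin ℂ s := hs ▸ Algebra.mem_top
  induction ha using Algebra.adjoin_induction with
  | mem x hx => exact h x hx
  | algebraMap r =>
    rw [Algebra.algebraMap_eq_smul_one]
    simp [Algebra.TensorProduct.one_def, hT1, Algebra.algebraMap_eq_smul_one]
  | add x y hx hy h1 h2 =>
    simp only [map_add, h1.1, h1.2, h2.1, h2.2, and_self]
  | mul x y hx hy h1 h2 =>
    have key1 : ∀ (u v : H ⊗[ℂ] H) (c : ℂ),
        LinearMap.mul' ℂ H (T.rTensor H u) = algebraMap ℂ H c →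
        LinearMap.mul' ℂ H (T.rTensor H (u * v))
          = algebraMap ℂ H c * LinearMap.mul' ℂ H (T.rTensor H v) := by
      intro u v c hu
      induction v using TensorProduct.induction_on with
      | zero => simp
      | add v w hv hw => simp only [mul_add, map_add, hv, hw]
      | tmul p q =>
        have : ∀ u : H ⊗[ℂ] H, LinearMap.mul' ℂ H (T.rTensor H (u * (p ⊗ₜ q)))
            = T p * LinearMap.mul' ℂ H (T.rTensor H u) * q := by
          intro u
          induction u using TensorProduct.induction_on with
          | zero => simp
          | add v w hv hw => simp only [add_mul, mul_add, map_add, hv, hw]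
          | tmul a b => simp [hTm, mul_assoc]
        rw [this, hu]
        simp only [LinearMap.rTensor_tmul, LinearMap.mul'_apply]
        rw [← Algebra.commutes, mul_assoc]
    have key2 : ∀ (u v : H ⊗[ℂ] H) (c : ℂ),
        LinearMap.mul' ℂ H (T.lTensor H v) = algebraMap ℂ H c →
        LinearMap.mul' ℂ H (T.lTensor H (u * v))
          = LinearMap.mul' ℂ H (T.lTensor H u) * algebraMap ℂ H c := by
      intro u v c hv
      induction u using TensorProduct.induction_on with
      | zero => simp
      | add v w hv hw => simp only [add_mul, map_add, hv, hw]
      | tmul p q =>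
        have : ∀ v : H ⊗[ℂ] H, LinearMap.mul' ℂ H (T.lTensor H ((p ⊗ₜ q) * v))
            = p * LinearMap.mul' ℂ H (T.lTensor H v) * T q := by
          intro u
          induction u using TensorProduct.induction_on with
          | zero => simp
          | add v w hv hw => simp only [add_mul, mul_add, map_add, hv, hw]
          | tmul a b => simp [hTm, mul_assoc]
        rw [this, hv]
        simp only [LinearMap.lTensor_tmul, LinearMap.mul'_apply]
        rw [mul_assoc, mul_assoc, Algebra.commutes]
    constructor
    · rw [Bialgebra.comul_mul, key1 _ _ _ h1.1, h2.1, Bialgebra.counit_mul, map_mul]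
    · rw [Bialgebra.comul_mul, key2 _ _ _ h2.2, h1.2, Bialgebra.counit_mul, map_mul]

/-! ### The Hopf algebra of codimension one foliations -/

/-- The generators `X`, `Y`, `δ_n` (`n ≥ 1`). -/
inductive Gen : Type
  | X : Gen
  | Y : Gen
  | δ : ℕ+ → Gen

/-- The relations `[Y, X] = X`, `[X, δ_n] = δ_{n+1}`, `[Y, δ_n] = n δ_n`, `[δ_k, δ_l] = 0`. -/
inductive relL1 : Set (FreeLieAlgebra ℂ Gen)
  | YX : relL1 (⁅FreeLieAlgebra.of ℂ Gen.Y, FreeLieAlgebra.of ℂ Gen.X⁆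
      - FreeLieAlgebra.of ℂ Gen.X)
  | Xδ (n : ℕ+) : relL1 (⁅FreeLieAlgebra.of ℂ Gen.X, FreeLieAlgebra.of ℂ (Gen.δ n)⁆
      - FreeLieAlgebra.of ℂ (Gen.δ (n + 1)))
  | Yδ (n : ℕ+) : relL1 (⁅FreeLieAlgebra.of ℂ Gen.Y, FreeLieAlgebra.of ℂ (Gen.δ n)⁆
      - (n : ℂ) • FreeLieAlgebra.of ℂ (Gen.δ n))
  | δδ (k l : ℕ+) : relL1 ⁅FreeLieAlgebra.of ℂ (Gen.δ k), FreeLieAlgebra.of ℂ (Gen.δ l)⁆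

/-- The algebra underlying the Connes–Moscovici Hopf algebra `ℋ₁`: the universal enveloping
algebra of the Lie algebra with generators `X`, `Y`, `δ_n`. Its coproduct (below) is not the
one of an enveloping algebra. -/
def H1 : Type := PresentedU relL1

instance : Ring H1 := inferInstanceAs (Ring (PresentedU relL1))
instance : Algebra ℂ H1 := inferInstanceAs (Algebra ℂ (PresentedU relL1))

namespace H1

/-- The element `X` of `ℋ₁`. -/
def X : H1 := PresentedU.of relL1 Gen.X
/-- The element `Y` of `ℋ₁`. -/
def Y : H1 := PresentedU.of relL1 Gen.Y
/-- The element `δ_n` of `ℋ₁`, `n ≥ 1`. -/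
def δ (n : ℕ+) : H1 := PresentedU.of relL1 (Gen.δ n)

theorem YX : Y * X - X * Y = X := by
  have h := PresentedU.rel relL1.YX
  simp only [map_sub, LieHom.map_lie, FreeLieAlgebra.lift_of_apply, sub_eq_zero] at h
  exact h

theorem Xδ (n : ℕ+) : X * δ n - δ n * X = δ (n + 1) := by
  have h := PresentedU.rel (relL1.Xδ n)
  simp only [map_sub, LieHom.map_lie, FreeLieAlgebra.lift_of_apply, sub_eq_zero] at h
  exact h

theorem Yδ (n : ℕ+) : Y * δ n - δ n * Y = (n : ℂ) • δ n := by
  have h := PresentedU.rel (relL1.Yδ n)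
  simp only [map_sub, LieHom.map_lie, map_smul, FreeLieAlgebra.lift_of_apply,
    sub_eq_zero] at h
  exact h

theorem δδ (k l : ℕ+) : Commute (δ k) (δ l) := by
  have h := PresentedU.rel (relL1.δδ k l)
  simp only [LieHom.map_lie, FreeLieAlgebra.lift_of_apply] at h
  exact sub_eq_zero.1 h

/-- Bracketing with `x` preserves the subalgebra generated by `s` if it does so on `s`. -/
theorem bracket_mem_adjoin {A : Type} [Ring A] [Algebra ℂ A] {s : Set A} {x : A}
    (h : ∀ a ∈ s, x * a - a * x ∈ Algebra.adjoin ℂ s) {b : A} (hb : b ∈ Algebra.adjoin ℂ s) :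
    x * b - b * x ∈ Algebra.adjoin ℂ s := by
  induction hb using Algebra.adjoin_induction with
  | mem a ha => exact h a ha
  | algebraMap r => rw [Algebra.commutes r x, sub_self]; exact zero_mem _
  | add a b ha hb h1 h2 =>
    have : x * (a + b) - (a + b) * x = (x * a - a * x) + (x * b - b * x) := by noncomm_ring
    rw [this]; exact add_mem h1 h2
  | mul a b ha hb h1 h2 =>
    have : x * (a * b) - (a * b) * x = (x * a - a * x) * b + a * (x * b - b * x) := by
      noncomm_ring
    rw [this]; exact add_mem (mul_mem h1 hb) (mul_mem ha h2)

/-- The elements `d`, `[x, d]`, `[x, [x, d]]`, …. -/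
def iter {A : Type} [Ring A] (x d : A) (n : ℕ+) : A := (fun a => x * a - a * x)^[(n : ℕ) - 1] d

theorem iter_one {A : Type} [Ring A] (x d : A) : iter x d 1 = d := rfl

theorem iter_succ {A : Type} [Ring A] (x d : A) (n : ℕ+) :
    iter x d (n + 1) = x * iter x d n - iter x d n * x := by
  have h : ((n + 1 : ℕ+) : ℕ) - 1 = ((n : ℕ) - 1) + 1 := by
    have := n.pos
    simp only [PNat.add_coe, PNat.one_coe]
    omega
  unfold iter
  rw [h, Function.iterate_succ_apply']

/-- The images of the generators determined by those of `X`, `Y`, `δ_1`. -/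
def genMap {A : Type} [Ring A] (x y d : A) : Gen → A
  | Gen.X => x
  | Gen.Y => y
  | Gen.δ n => iter x d n

theorem genMap_rel {A : Type} [Ring A] [Algebra ℂ A] (x y d : A) (s : Set A)
    (hyx : y * x - x * y = x) (hyd : y * d - d * y = d) (hd : d ∈ Algebra.adjoin ℂ s)
    (hs : ∀ a ∈ s, ∀ b ∈ s, Commute a b)
    (hx : ∀ a ∈ s, x * a - a * x ∈ Algebra.adjoin ℂ s) :
    ∀ r ∈ relL1, FreeLieAlgebra.lift ℂ (genMap x y d) r = 0 := by
  have hmem : ∀ n, iter x d n ∈ Algebra.adjoin ℂ s := by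
    intro n
    induction n using PNat.recOn with
    | one => exact hd
    | succ n ih => rw [iter_succ]; exact bracket_mem_adjoin hx ih
  have hcomm : ∀ a ∈ Algebra.adjoin ℂ s, ∀ b ∈ Algebra.adjoin ℂ s, Commute a b := by
    intro a ha b hb
    apply Algebra.commute_of_mem_adjoin_of_forall_mem_commute hb
    intro c hc
    apply Commute.symm
    apply Algebra.commute_of_mem_adjoin_of_forall_mem_commute ha
    intro e he
    exact hs c hc e he
  intro r hr
  cases hr with
  | YX =>
    simp only [map_sub, LieHom.map_lie, FreeLieAlgebra.lift_of_apply, sub_eq_zero]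
    exact hyx
  | Xδ n =>
    simp only [map_sub, LieHom.map_lie, FreeLieAlgebra.lift_of_apply, sub_eq_zero]
    exact (iter_succ x d n).symm
  | Yδ n =>
    simp only [map_sub, LieHom.map_lie, map_smul, FreeLieAlgebra.lift_of_apply,
      sub_eq_zero]
    change y * iter x d n - iter x d n * y = (n : ℂ) • iter x d n
    induction n using PNat.recOn with
    | one => rw [iter_one, hyd]; simp
    | succ n ih =>
      rw [iter_succ]
      have e1 : y * (x * iter x d n - iter x d n * x) - (x * iter x d n - iter x d n * x) * y
          = ((y * x - x * y) * iter x d n - iter x d n * (y * x - x * y))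
            + (x * (y * iter x d n - iter x d n * y)
              - (y * iter x d n - iter x d n * y) * x) := by noncomm_ring
      rw [e1, hyx, ih]
      push_cast
      rw [mul_smul_comm, smul_mul_assoc, ← smul_sub, add_smul, one_smul, add_comm]
  | δδ k l =>
    simp only [LieHom.map_lie, FreeLieAlgebra.lift_of_apply]
    exact sub_eq_zero.2 (hcomm _ (hmem k) _ (hmem l))

/-- The algebra map from `ℋ₁` with prescribed values on `X`, `Y`, `δ_1`. -/
def lift {A : Type} [Ring A] [Algebra ℂ A] (x y d : A)
    (h : ∀ r ∈ relL1, FreeLieAlgebra.lift ℂ (genMap x y d) r = 0) : H1 →ₐ[ℂ] A :=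
  PresentedU.lift relL1 (genMap x y d) h

section
variable {A : Type} [Ring A] [Algebra ℂ A] (x y d : A)
  (h : ∀ r ∈ relL1, FreeLieAlgebra.lift ℂ (genMap x y d) r = 0)

theorem lift_X : lift x y d h X = x := PresentedU.lift_of relL1 (genMap x y d) h Gen.X
theorem lift_Y : lift x y d h Y = y := PresentedU.lift_of relL1 (genMap x y d) h Gen.Y
theorem lift_δ : lift x y d h (δ 1) = d := PresentedU.lift_of relL1 (genMap x y d) h (Gen.δ 1)

end

theorem hom_ext {A : Type} [Ring A] [Algebra ℂ A] {f g : H1 →ₐ[ℂ] A} (hX : f X = g X)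
    (hY : f Y = g Y) (hδ : f (δ 1) = g (δ 1)) : f = g := by
  apply PresentedU.hom_ext (R := relL1)
  intro z
  cases z with
  | X => exact hX
  | Y => exact hY
  | δ n =>
    change f (δ n) = g (δ n)
    induction n using PNat.recOn with
    | one => exact hδ
    | succ n ih => rw [← Xδ]; simp only [map_sub, map_mul, hX, ih]

theorem adjoin_eq_top : Algebra.adjoin ℂ ({X, Y, δ 1} : Set H1) = ⊤ := by
  have mX : X ∈ Algebra.adjoin ℂ ({X, Y, δ 1} : Set H1) := Algebra.subset_adjoin (by simp)
  have mY : Y ∈ Algebra.adjoin ℂ ({X, Y, δ 1} : Set H1) := Algebra.subset_adjoin (by simp)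
  have mδ : ∀ n, δ n ∈ Algebra.adjoin ℂ ({X, Y, δ 1} : Set H1) := by
    intro n
    induction n using PNat.recOn with
    | one => exact Algebra.subset_adjoin (by simp)
    | succ n ih => rw [← Xδ]; exact sub_mem (mul_mem mX ih) (mul_mem ih mX)
  rw [eq_top_iff]
  rintro a -
  let W := Algebra.adjoin ℂ ({X, Y, δ 1} : Set H1)
  have hr := genMap_rel (A := W) ⟨X, mX⟩ ⟨Y, mY⟩ ⟨δ 1, mδ 1⟩ (Set.range fun n => ⟨δ n, mδ n⟩)
    (Subtype.ext YX) (Subtype.ext (by simpa using Yδ 1))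
    (Algebra.subset_adjoin ⟨1, rfl⟩)
    (by
      rintro _ ⟨k, rfl⟩ _ ⟨l, rfl⟩
      exact Subtype.ext (δδ k l))
    (by
      rintro _ ⟨k, rfl⟩
      exact Algebra.subset_adjoin ⟨k + 1, Subtype.ext (Xδ k).symm⟩)
  have he : W.val.comp (lift _ _ _ hr) = AlgHom.id ℂ H1 := by
    apply hom_ext
    · simp [lift_X]
    · simp [lift_Y]
    · simp [lift_δ]
  have := DFunLike.congr_fun he a
  rw [AlgHom.id_apply] at this
  rw [← this]
  exact (lift _ _ _ hr a).2

theorem comul_rel : ∀ r ∈ relL1, FreeLieAlgebra.lift ℂ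
    (genMap (X ⊗ₜ[ℂ] (1 : H1) + (1 : H1) ⊗ₜ[ℂ] X + δ 1 ⊗ₜ[ℂ] Y)
      (Y ⊗ₜ[ℂ] (1 : H1) + (1 : H1) ⊗ₜ[ℂ] Y)
      (δ 1 ⊗ₜ[ℂ] (1 : H1) + (1 : H1) ⊗ₜ[ℂ] δ 1)) r = 0 := by
  have hY1 : Y * δ 1 = δ 1 * Y + δ 1 := by
    have := Yδ 1
    simp only [PNat.one_coe, Nat.cast_one, one_smul] at this
    exact (sub_eq_iff_eq_add'.1 this)
  have hYX : Y * X = X * Y + X := sub_eq_iff_eq_add'.1 YX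
  apply genMap_rel _ _ _ ((Set.range fun n => δ n ⊗ₜ[ℂ] (1 : H1)) ∪
    (Set.range fun n => (1 : H1) ⊗ₜ[ℂ] δ n))
  · simp only [add_mul, mul_add, Algebra.TensorProduct.tmul_mul_tmul, one_mul, mul_one, hYX, hY1,
      TensorProduct.add_tmul, TensorProduct.tmul_add]
    abel
  · simp only [add_mul, mul_add, Algebra.TensorProduct.tmul_mul_tmul, one_mul, mul_one, hY1,
      TensorProduct.add_tmul, TensorProduct.tmul_add]
    abel
  · exact add_mem (Algebra.subset_adjoin (Or.inl ⟨1, rfl⟩))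
      (Algebra.subset_adjoin (Or.inr ⟨1, rfl⟩))
  · rintro _ (⟨k, rfl⟩ | ⟨k, rfl⟩) _ (⟨l, rfl⟩ | ⟨l, rfl⟩) <;>
      simp [commute_iff_eq, Algebra.TensorProduct.tmul_mul_tmul, (δδ k l).eq]
  · rintro _ (⟨k, rfl⟩ | ⟨k, rfl⟩)
    · have : (X ⊗ₜ[ℂ] (1 : H1) + (1 : H1) ⊗ₜ[ℂ] X + δ 1 ⊗ₜ[ℂ] Y) * (δ k ⊗ₜ[ℂ] (1 : H1))
          - (δ k ⊗ₜ[ℂ] (1 : H1)) * (X ⊗ₜ[ℂ] (1 : H1) + (1 : H1) ⊗ₜ[ℂ] X + δ 1 ⊗ₜ[ℂ] Y)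
          = δ (k + 1) ⊗ₜ[ℂ] (1 : H1) := by
        rw [← Xδ]
        simp only [add_mul, mul_add, Algebra.TensorProduct.tmul_mul_tmul, one_mul, mul_one,
          TensorProduct.sub_tmul, (δδ 1 k).eq]
        abel
      simp only [this]
      exact Algebra.subset_adjoin (Or.inl ⟨k + 1, rfl⟩)
    · have : (X ⊗ₜ[ℂ] (1 : H1) + (1 : H1) ⊗ₜ[ℂ] X + δ 1 ⊗ₜ[ℂ] Y) * ((1 : H1) ⊗ₜ[ℂ] δ k)
          - ((1 : H1) ⊗ₜ[ℂ] δ k) * (X ⊗ₜ[ℂ] (1 : H1) + (1 : H1) ⊗ₜ[ℂ] X + δ 1 ⊗ₜ[ℂ] Y)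
          = (1 : H1) ⊗ₜ[ℂ] δ (k + 1)
            + (k : ℂ) • ((δ 1 ⊗ₜ[ℂ] (1 : H1)) * ((1 : H1) ⊗ₜ[ℂ] δ k)) := by
        rw [Algebra.TensorProduct.tmul_mul_tmul, one_mul, mul_one, ← TensorProduct.tmul_smul,
          ← Xδ, ← Yδ]
        simp only [add_mul, mul_add, Algebra.TensorProduct.tmul_mul_tmul, one_mul, mul_one,
          TensorProduct.tmul_sub]
        abel
      simp only [this]
      refine add_mem (Algebra.subset_adjoin (Or.inr ⟨k + 1, rfl⟩)) (Subalgebra.smul_mem _ ?_ _)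
      exact mul_mem (Algebra.subset_adjoin (Or.inl ⟨1, rfl⟩))
        (Algebra.subset_adjoin (Or.inr ⟨k, rfl⟩))

/-- The coproduct of `ℋ₁`: the algebra map with `Δ X = X ⊗ 1 + 1 ⊗ X + δ_1 ⊗ Y`,
`Δ Y = Y ⊗ 1 + 1 ⊗ Y`, `Δ δ_1 = δ_1 ⊗ 1 + 1 ⊗ δ_1`. -/
def comulHom : H1 →ₐ[ℂ] H1 ⊗[ℂ] H1 :=
  lift (X ⊗ₜ[ℂ] (1 : H1) + (1 : H1) ⊗ₜ[ℂ] X + δ 1 ⊗ₜ[ℂ] Y)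
    (Y ⊗ₜ[ℂ] (1 : H1) + (1 : H1) ⊗ₜ[ℂ] Y)
    (δ 1 ⊗ₜ[ℂ] (1 : H1) + (1 : H1) ⊗ₜ[ℂ] δ 1) comul_rel

theorem counit_rel :
    ∀ r ∈ relL1, FreeLieAlgebra.lift ℂ (genMap (0 : ℂ) (0 : ℂ) (0 : ℂ)) r = 0 :=
  genMap_rel 0 0 0 ∅ (by simp) (by simp) (zero_mem _) (by simp) (by simp)

/-- The counit of `ℋ₁`, which vanishes on `X`, `Y`, `δ_1`. -/
def counitHom : H1 →ₐ[ℂ] ℂ := lift 0 0 0 counit_rel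

theorem antipode_rel : ∀ r ∈ relL1, FreeLieAlgebra.lift ℂ
    (genMap (MulOpposite.op (-X + δ 1 * Y)) (MulOpposite.op (-Y)) (MulOpposite.op (-δ 1))) r
      = 0 := by
  have hY1 : Y * δ 1 = δ 1 * Y + δ 1 := by
    have := Yδ 1
    simp only [PNat.one_coe, Nat.cast_one, one_smul] at this
    exact (sub_eq_iff_eq_add'.1 this)
  have hYX : Y * X = X * Y + X := sub_eq_iff_eq_add'.1 YX
  apply genMap_rel _ _ _ (Set.range fun n => MulOpposite.op (δ n))
  · rw [← MulOpposite.op_mul, ← MulOpposite.op_mul, ← MulOpposite.op_sub]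
    congr 1
    simp only [add_mul, mul_add, neg_mul, mul_neg, neg_neg, ← mul_assoc, hYX, hY1]
    abel
  · rw [← MulOpposite.op_mul, ← MulOpposite.op_mul, ← MulOpposite.op_sub]
    congr 1
    simp only [neg_mul, mul_neg, neg_neg, hY1]
    abel
  · rw [MulOpposite.op_neg]
    exact neg_mem (Algebra.subset_adjoin ⟨1, rfl⟩)
  · rintro _ ⟨k, rfl⟩ _ ⟨l, rfl⟩
    exact MulOpposite.unop_injective (δδ k l).eq.symm
  · rintro _ ⟨k, rfl⟩
    have hk : δ k * Y = Y * δ k - (k : ℂ) • δ k := by rw [← Yδ k]; abel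
    have : MulOpposite.op (-X + δ 1 * Y) * MulOpposite.op (δ k)
        - MulOpposite.op (δ k) * MulOpposite.op (-X + δ 1 * Y)
        = MulOpposite.op (δ (k + 1))
          + (-(k : ℂ)) • (MulOpposite.op (δ k) * MulOpposite.op (δ 1)) := by
      rw [← MulOpposite.op_mul, ← MulOpposite.op_mul, ← MulOpposite.op_mul,
        ← MulOpposite.op_sub, ← MulOpposite.op_smul, ← MulOpposite.op_add]
      congr 1
      rw [mul_add, add_mul, ← mul_assoc, (δδ k 1).eq, mul_assoc, hk, ← Xδ k, mul_sub,
        mul_smul_comm, neg_smul, mul_assoc]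
      simp only [neg_mul, mul_neg]
      abel
    simp only [this]
    refine add_mem (Algebra.subset_adjoin ⟨k + 1, rfl⟩) (Subalgebra.smul_mem _ ?_ _)
    exact mul_mem (Algebra.subset_adjoin ⟨k, rfl⟩) (Algebra.subset_adjoin ⟨1, rfl⟩)

/-- The antipode of `ℋ₁`: the algebra anti-homomorphism with `S X = -X + δ_1 Y`, `S Y = -Y`,
`S δ_1 = -δ_1`. -/
def antipodeHom : H1 →ₐ[ℂ] H1ᵐᵒᵖ :=
  lift (MulOpposite.op (-X + δ 1 * Y)) (MulOpposite.op (-Y)) (MulOpposite.op (-δ 1)) antipode_rel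

theorem comulHom_X : comulHom X = X ⊗ₜ[ℂ] (1 : H1) + (1 : H1) ⊗ₜ[ℂ] X + δ 1 ⊗ₜ[ℂ] Y :=
  lift_X _ _ _ _
theorem comulHom_Y : comulHom Y = Y ⊗ₜ[ℂ] (1 : H1) + (1 : H1) ⊗ₜ[ℂ] Y := lift_Y _ _ _ _
theorem comulHom_δ : comulHom (δ 1) = δ 1 ⊗ₜ[ℂ] (1 : H1) + (1 : H1) ⊗ₜ[ℂ] δ 1 := lift_δ _ _ _ _
theorem counitHom_X : counitHom X = 0 := lift_X _ _ _ _
theorem counitHom_Y : counitHom Y = 0 := lift_Y _ _ _ _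
theorem counitHom_δ : counitHom (δ 1) = 0 := lift_δ _ _ _ _
theorem antipodeHom_X : antipodeHom X = MulOpposite.op (-X + δ 1 * Y) := lift_X _ _ _ _
theorem antipodeHom_Y : antipodeHom Y = MulOpposite.op (-Y) := lift_Y _ _ _ _
theorem antipodeHom_δ : antipodeHom (δ 1) = MulOpposite.op (-δ 1) := lift_δ _ _ _ _

instance : Bialgebra ℂ H1 :=
  Bialgebra.ofAlgHom comulHom counitHom
    (by
      apply hom_ext <;>
      · simp [comulHom_X, comulHom_Y, comulHom_δ, TensorProduct.add_tmul, TensorProduct.tmul_add,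
          Algebra.TensorProduct.one_def]
        try abel)
    (by
      apply hom_ext <;>
        simp [comulHom_X, comulHom_Y, comulHom_δ, counitHom_X, counitHom_Y, counitHom_δ])
    (by
      apply hom_ext <;>
        simp [comulHom_X, comulHom_Y, comulHom_δ, counitHom_X, counitHom_Y, counitHom_δ])

theorem comul_eq (a : H1) : Coalgebra.comul (R := ℂ) a = comulHom a := rfl
theorem counit_eq (a : H1) : Coalgebra.counit (R := ℂ) a = counitHom a := rfl

/-- The antipode as a linear map. -/
def antipodeLin : H1 →ₗ[ℂ] H1 :=
  (MulOpposite.opLinearEquiv ℂ).symm.toLinearMap ∘ₗ antipodeHom.toLinearMap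

theorem antipodeLin_apply (a : H1) : antipodeLin a = (antipodeHom a).unop := rfl

theorem antipode_spec (a : H1) :
    LinearMap.mul' ℂ H1 (antipodeLin.rTensor H1 (Coalgebra.comul a))
        = algebraMap ℂ H1 (Coalgebra.counit a) ∧
      LinearMap.mul' ℂ H1 (antipodeLin.lTensor H1 (Coalgebra.comul a))
        = algebraMap ℂ H1 (Coalgebra.counit a) := by
  refine antipode_aux antipodeHom {X, Y, δ 1} adjoin_eq_top antipodeLin antipodeLin_apply ?_ a
  rintro _ (rfl | rfl | rfl) <;>
    simp [comul_eq, counit_eq, comulHom_X, comulHom_Y, comulHom_δ, counitHom_X, counitHom_Y,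
      counitHom_δ, antipodeLin_apply, antipodeHom_X, antipodeHom_Y, antipodeHom_δ]

/-- The Connes–Moscovici Hopf algebra `ℋ₁`. -/
instance : HopfAlgebra ℂ H1 where
  antipode := antipodeLin
  mul_antipode_rTensor_comul := LinearMap.ext fun a => (antipode_spec a).1
  mul_antipode_lTensor_comul := LinearMap.ext fun a => (antipode_spec a).2

end H1

/-! ### The Hopf algebra `𝔥₁ = U(𝔩₁)` -/

/-- The generators `X`, `Y` of `𝔩₁`. -/
inductive SmallGen : Type
  | X : SmallGen
  | Y : SmallGen

/-- The relation `[Y, X] = X`. -/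
inductive relSmall : Set (FreeLieAlgebra ℂ SmallGen)
  | YX : relSmall (⁅FreeLieAlgebra.of ℂ SmallGen.Y, FreeLieAlgebra.of ℂ SmallGen.X⁆
      - FreeLieAlgebra.of ℂ SmallGen.X)

/-- The algebra underlying the Hopf algebra `𝔥₁`: the universal enveloping algebra of the Lie
algebra `𝔩₁` with generators `X`, `Y` and the relation `[Y, X] = X`. -/
def SmallH1 : Type := PresentedU relSmall

instance : Ring SmallH1 := inferInstanceAs (Ring (PresentedU relSmall))
instance : Algebra ℂ SmallH1 := inferInstanceAs (Algebra ℂ (PresentedU relSmall))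

namespace SmallH1

/-- The element `X` of `𝔥₁`. -/
def X : SmallH1 := PresentedU.of relSmall SmallGen.X
/-- The element `Y` of `𝔥₁`. -/
def Y : SmallH1 := PresentedU.of relSmall SmallGen.Y

theorem YX : Y * X - X * Y = X := by
  have h := PresentedU.rel relSmall.YX
  simp only [map_sub, LieHom.map_lie, FreeLieAlgebra.lift_of_apply, sub_eq_zero] at h
  exact h

/-- The images of the generators. -/
def genMap {A : Type} (x y : A) : SmallGen → A
  | SmallGen.X => x
  | SmallGen.Y => y

/-- The algebra map from `𝔥₁` with prescribed values on `X`, `Y`. -/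
def lift {A : Type} [Ring A] [Algebra ℂ A] (x y : A) (h : y * x - x * y = x) :
    SmallH1 →ₐ[ℂ] A :=
  PresentedU.lift relSmall (genMap x y) (by
    intro r hr
    cases hr with
    | YX =>
      simp only [map_sub, LieHom.map_lie, FreeLieAlgebra.lift_of_apply, sub_eq_zero]
      exact h)

section
variable {A : Type} [Ring A] [Algebra ℂ A] (x y : A) (h : y * x - x * y = x)

theorem lift_X : lift x y h X = x := PresentedU.lift_of relSmall (genMap x y) _ SmallGen.X
theorem lift_Y : lift x y h Y = y := PresentedU.lift_of relSmall (genMap x y) _ SmallGen.Y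

end

theorem hom_ext {A : Type} [Ring A] [Algebra ℂ A] {f g : SmallH1 →ₐ[ℂ] A} (hX : f X = g X)
    (hY : f Y = g Y) : f = g := by
  apply PresentedU.hom_ext (R := relSmall)
  intro z
  cases z with
  | X => exact hX
  | Y => exact hY

theorem adjoin_eq_top : Algebra.adjoin ℂ ({X, Y} : Set SmallH1) = ⊤ := by
  have mX : X ∈ Algebra.adjoin ℂ ({X, Y} : Set SmallH1) := Algebra.subset_adjoin (by simp)
  have mY : Y ∈ Algebra.adjoin ℂ ({X, Y} : Set SmallH1) := Algebra.subset_adjoin (by simp)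
  rw [eq_top_iff]
  rintro a -
  let W := Algebra.adjoin ℂ ({X, Y} : Set SmallH1)
  have hr : (⟨Y, mY⟩ : W) * ⟨X, mX⟩ - ⟨X, mX⟩ * ⟨Y, mY⟩ = ⟨X, mX⟩ := Subtype.ext YX
  have he : W.val.comp (lift _ _ hr) = AlgHom.id ℂ SmallH1 := by
    apply hom_ext
    · simp [lift_X]
    · simp [lift_Y]
  have := DFunLike.congr_fun he a
  rw [AlgHom.id_apply] at this
  rw [← this]
  exact (lift _ _ hr a).2

/-- The coproduct of `𝔥₁`, for which `X` and `Y` are primitive. -/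
def comulHom : SmallH1 →ₐ[ℂ] SmallH1 ⊗[ℂ] SmallH1 :=
  lift (X ⊗ₜ[ℂ] (1 : SmallH1) + (1 : SmallH1) ⊗ₜ[ℂ] X)
    (Y ⊗ₜ[ℂ] (1 : SmallH1) + (1 : SmallH1) ⊗ₜ[ℂ] Y) (by
      have hYX : Y * X = X * Y + X := sub_eq_iff_eq_add'.1 YX
      simp only [add_mul, mul_add, Algebra.TensorProduct.tmul_mul_tmul, one_mul, mul_one, hYX,
        TensorProduct.add_tmul, TensorProduct.tmul_add]
      abel)

/-- The counit of `𝔥₁`. -/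
def counitHom : SmallH1 →ₐ[ℂ] ℂ := lift 0 0 (by simp)

/-- The antipode of `𝔥₁`: the algebra anti-homomorphism with `S X = -X`, `S Y = -Y`. -/
def antipodeHom : SmallH1 →ₐ[ℂ] SmallH1ᵐᵒᵖ :=
  lift (MulOpposite.op (-X)) (MulOpposite.op (-Y)) (by
    have hYX : Y * X = X * Y + X := sub_eq_iff_eq_add'.1 YX
    rw [← MulOpposite.op_mul, ← MulOpposite.op_mul, ← MulOpposite.op_sub]
    congr 1
    simp only [neg_mul, mul_neg, neg_neg, hYX]
    abel)

theorem comulHom_X : comulHom X = X ⊗ₜ[ℂ] (1 : SmallH1) + (1 : SmallH1) ⊗ₜ[ℂ] X := lift_X _ _ _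
theorem comulHom_Y : comulHom Y = Y ⊗ₜ[ℂ] (1 : SmallH1) + (1 : SmallH1) ⊗ₜ[ℂ] Y := lift_Y _ _ _
theorem counitHom_X : counitHom X = 0 := lift_X _ _ _
theorem counitHom_Y : counitHom Y = 0 := lift_Y _ _ _
theorem antipodeHom_X : antipodeHom X = MulOpposite.op (-X) := lift_X _ _ _
theorem antipodeHom_Y : antipodeHom Y = MulOpposite.op (-Y) := lift_Y _ _ _

instance : Bialgebra ℂ SmallH1 :=
  Bialgebra.ofAlgHom comulHom counitHom
    (by
      apply hom_ext <;>
      · simp [comulHom_X, comulHom_Y, TensorProduct.add_tmul, TensorProduct.tmul_add,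
          Algebra.TensorProduct.one_def]
        try abel)
    (by apply hom_ext <;> simp [comulHom_X, comulHom_Y, counitHom_X, counitHom_Y])
    (by apply hom_ext <;> simp [comulHom_X, comulHom_Y, counitHom_X, counitHom_Y])

theorem comul_eq (a : SmallH1) : Coalgebra.comul (R := ℂ) a = comulHom a := rfl
theorem counit_eq (a : SmallH1) : Coalgebra.counit (R := ℂ) a = counitHom a := rfl

/-- The antipode as a linear map. -/
def antipodeLin : SmallH1 →ₗ[ℂ] SmallH1 :=
  (MulOpposite.opLinearEquiv ℂ).symm.toLinearMap ∘ₗ antipodeHom.toLinearMap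

theorem antipodeLin_apply (a : SmallH1) : antipodeLin a = (antipodeHom a).unop := rfl

theorem antipode_spec (a : SmallH1) :
    LinearMap.mul' ℂ SmallH1 (antipodeLin.rTensor SmallH1 (Coalgebra.comul a))
        = algebraMap ℂ SmallH1 (Coalgebra.counit a) ∧
      LinearMap.mul' ℂ SmallH1 (antipodeLin.lTensor SmallH1 (Coalgebra.comul a))
        = algebraMap ℂ SmallH1 (Coalgebra.counit a) := by
  refine antipode_aux antipodeHom {X, Y} adjoin_eq_top antipodeLin antipodeLin_apply ?_ a
  rintro _ (rfl | rfl) <;>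
    simp [comul_eq, counit_eq, comulHom_X, comulHom_Y, counitHom_X, counitHom_Y,
      antipodeLin_apply, antipodeHom_X, antipodeHom_Y]

/-- The Hopf algebra `𝔥₁`. -/
instance : HopfAlgebra ℂ SmallH1 where
  antipode := antipodeLin
  mul_antipode_rTensor_comul := LinearMap.ext fun a => (antipode_spec a).1
  mul_antipode_lTensor_comul := LinearMap.ext fun a => (antipode_spec a).2

end SmallH1

/-- The compatibility of an action `ρ` of a Hopf algebra `H` on a vector space `A` with a bilinear
product on `A`: `h(a b) = ∑ h₍₁₎(a) h₍₂₎(b)`, where `Δ h = ∑ h₍₁₎ ⊗ h₍₂₎`. -/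
def IsHopfAction {H A : Type} [Ring H] [HopfAlgebra ℂ H] [AddCommGroup A] [Module ℂ A]
    (mul : A →ₗ[ℂ] A →ₗ[ℂ] A) (ρ : H →ₐ[ℂ] Module.End ℂ A) : Prop :=
  ∀ (h : H) (a b : A), ρ h (mul a b) =
    TensorProduct.lift (mul.compl₁₂ (ρ.toLinearMap.flip a) (ρ.toLinearMap.flip b))
      (Coalgebra.comul (R := ℂ) h)

/-! ### Modular and quasimodular forms -/

/-- Holomorphic modular forms of weight `m` for some `Γ(N)`, `N ≥ 1`. This is the weight `m` part
of the modular tower. -/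
def modTower (m : ℕ) : Submodule ℂ (ℍ → ℂ) :=
  Submodule.span ℂ {f | ∃ N : ℕ, 1 ≤ N ∧
    ∃ g : ModularForm ((CongruenceSubgroup.Gamma N).map (Matrix.SpecialLinearGroup.mapGL ℝ)) m,
      ⇑g = f}

theorem modTower_mdifferentiable {m : ℕ} {f : ℍ → ℂ} (hf : f ∈ modTower m) : MDiff f := by
  induction hf using Submodule.span_induction with
  | mem f hf => obtain ⟨N, -, g, rfl⟩ := hf; exact ModularFormClass.holo g
  | zero => exact mdifferentiable_const
  | add f g _ _ hf hg => exact hf.add hg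
  | smul c f _ hf => exact hf.const_smul c

/-- Quasimodular forms of level `Γ(N)`, weight `k` and depth `s`. The component functions are
holomorphic on `ℍ` and at the cusps. -/
def IsQuasimodular (N k s : ℕ) (f : ℍ → ℂ) : Prop :=
  (f = 0 ∧ s = 0) ∨
  (MDiff f ∧ ∃ F : ℕ → ℍ → ℂ,
    (∀ j ≤ s, MDiff (F j) ∧ ∀ γ : SL(2, ℤ),
      UpperHalfPlane.IsBoundedAtImInfty (F j ∣[(k : ℤ) - 2 * j] γ)) ∧
    F s ≠ 0 ∧
    ∀ γ ∈ CongruenceSubgroup.Gamma N, ∀ z : ℍ,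
      (((γ 1 0 : ℤ) : ℂ) * z + ((γ 1 1 : ℤ) : ℂ)) ^ (-(k : ℤ)) * f (γ • z) =
        ∑ j ∈ Finset.range (s + 1),
          F j z * (((γ 1 0 : ℤ) : ℂ) / (((γ 1 0 : ℤ) : ℂ) * z + ((γ 1 1 : ℤ) : ℂ))) ^ j)

/-- The quasimodular tower `𝒬ℳ`: all finite sums of quasimodular forms of arbitrary levels
`Γ(N)`, `N ≥ 1`, weights and depths, as functions on the upper half plane. (Quasimodular forms of
different weights are linearly independent, so this is the direct sum over all weights of the
unions over all levels and depths.) -/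
def QM : Submodule ℂ (ℍ → ℂ) :=
  Submodule.span ℂ {f | ∃ N k s : ℕ, 1 ≤ N ∧ IsQuasimodular N k s f}

/-- The Eisenstein series `G₂(z) = -B₂/4 + ∑_{n ≥ 1} σ₁(n) e^{2πinz}`. -/
def G2 (z : ℍ) : ℂ :=
  -((bernoulli 2 : ℚ) : ℂ) / (2 * 2) +
    ∑' n : ℕ+, (ArithmeticFunction.sigma 1 (n : ℕ) : ℂ) *
      Complex.exp (2 * Real.pi * Complex.I * n * z)

/-- The derivative `d/dz` of a function on the upper half plane. -/
def ddz (f : ℍ → ℂ) (z : ℍ) : ℂ := deriv (f ∘ UpperHalfPlane.ofComplex) z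

/-- The logarithmic derivative `d/dz (log f) = f' / f`. -/
def dlog (f : ℍ → ℂ) (z : ℍ) : ℂ := ddz f z / f z

/-- `Δ(z) = (2π)¹² q ∏ (1 - qⁿ)²⁴`, `q = e^{2πiz}`. -/
def Delta (z : ℍ) : ℂ :=
  (2 * Real.pi) ^ 12 * (Complex.exp (2 * Real.pi * Complex.I * z) *
    ∏' n : ℕ+, (1 - Complex.exp (2 * Real.pi * Complex.I * z) ^ (n : ℕ)) ^ 24)

/-- The real matrix of an element of `GL₂⁺(ℚ)`. -/
def toGLR (α : Matrix.GLPos (Fin 2) ℚ) : GL (Fin 2) ℝ :=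
  Matrix.GeneralLinearGroup.map (algebraMap ℚ ℝ) (α : GL (Fin 2) ℚ)

/-- The weight `m` action `(f|_m α)(z) = det(α)^{m/2} (cz+d)^{-m} f((az+b)/(cz+d))` of
`GL₂⁺(ℚ)`. -/
def slash (m : ℕ) (α : Matrix.GLPos (Fin 2) ℚ) : (ℍ → ℂ) →ₗ[ℂ] (ℍ → ℂ) where
  toFun f z := ((((toGLR α).det.val : ℝ) ^ ((m : ℝ) / 2) : ℝ) : ℂ) *
    UpperHalfPlane.denom (toGLR α) z ^ (-(m : ℤ)) * f (toGLR α • z)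
  map_add' f g := by ext z; simp only [Pi.add_apply]; ring
  map_smul' c f := by ext z; simp only [Pi.smul_apply, smul_eq_mul, RingHom.id_apply]; ring

/-- The finite families `(a_{m,i})` of modular forms, with `a_{m,i}` of weight `m`, standing for
the polynomials `∑ a_{m,i} G₂^i`. -/
abbrev Coeffs : Type := ⨁ p : ℕ × ℕ, modTower p.1

/-- `(a_{m,i}) ↦ ∑ T_m(a_{m,i}) G₂^i` for a family of maps `T_m` on modular forms. -/
def applyCoeffs (T : ∀ m : ℕ, modTower m →ₗ[ℂ] (ℍ → ℂ)) : Coeffs →ₗ[ℂ] (ℍ → ℂ) :=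
  DirectSum.toModule ℂ (ℕ × ℕ) (ℍ → ℂ)
    (fun p => LinearMap.mulRight ℂ (G2 ^ p.2) ∘ₗ T p.1)

/-- `(a_{m,i}) ↦ ∑ a_{m,i} G₂^i`. By the structure theorem for quasimodular forms this is a
bijection onto `𝒬ℳ`. -/
def expand : Coeffs →ₗ[ℂ] (ℍ → ℂ) := applyCoeffs fun m => (modTower m).subtype

/-- The coefficients `a_{m,i}(f)` of `f = ∑ a_{m,i}(f) G₂^i ∈ 𝒬ℳ` (a linear left inverse
of the injective map `expand`; its values outside `𝒬ℳ` are irrelevant). -/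
def coeffs : (ℍ → ℂ) →ₗ[ℂ] Coeffs :=
  LinearMap.leftInverse (K := ℂ) (V := Coeffs) (V' := ℍ → ℂ) expand

/-- The operation `f‖α = ∑ (a_i(f)|α) G₂^i` on `𝒬ℳ`. -/
def qslash (α : Matrix.GLPos (Fin 2) ℚ) : (ℍ → ℂ) →ₗ[ℂ] (ℍ → ℂ) :=
  applyCoeffs (fun m => slash m α ∘ₗ (modTower m).subtype) ∘ₗ coeffs

/-- `Y(f) = (m/2) f` for a modular form of weight `m`. -/
def modY (m : ℕ) : modTower m →ₗ[ℂ] (ℍ → ℂ) := ((m : ℂ) / 2) • (modTower m).subtype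

/-- The Ramanujan differential operator `X(f) = (1/2πi) f' - (1/12πi) (log Δ)' Y(f)` on modular
forms of weight `m`. -/
def modX (m : ℕ) : modTower m →ₗ[ℂ] (ℍ → ℂ) where
  toFun f z := 1 / (2 * Real.pi * Complex.I) * ddz f z
    - 1 / (12 * Real.pi * Complex.I) * dlog Delta z * modY m f z
  map_add' f g := by
    ext z
    have hf := UpperHalfPlane.mdifferentiableAt_iff.mp (modTower_mdifferentiable f.2 z)
    have hg := UpperHalfPlane.mdifferentiableAt_iff.mp (modTower_mdifferentiable g.2 z)
    have h : ddz ((f : ℍ → ℂ) + (g : ℍ → ℂ)) z = ddz f z + ddz g z := deriv_add hf hg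
    simp only [map_add, Pi.add_apply, Submodule.coe_add, h]
    ring
  map_smul' c f := by
    ext z
    have hf := UpperHalfPlane.mdifferentiableAt_iff.mp (modTower_mdifferentiable f.2 z)
    have h : ddz (c • (f : ℍ → ℂ)) z = c * ddz f z := deriv_const_smul c hf
    simp only [map_smul, Pi.smul_apply, Submodule.coe_smul, h, smul_eq_mul, RingHom.id_apply]
    ring

/-- The operator `X(f) = ∑ X(a_i(f)) G₂^i` on `𝒬ℳ`. -/
def opX : (ℍ → ℂ) →ₗ[ℂ] (ℍ → ℂ) := applyCoeffs modX ∘ₗ coeffs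

/-- The operator `Y(f) = ∑ Y(a_i(f)) G₂^i` on `𝒬ℳ`. -/
def opY : (ℍ → ℂ) →ₗ[ℂ] (ℍ → ℂ) := applyCoeffs modY ∘ₗ coeffs

/-- `μ_α = (1/12πi) d/dz log((Δ|α)/Δ)`. -/
def mu (α : Matrix.GLPos (Fin 2) ℚ) (z : ℍ) : ℂ :=
  1 / (12 * Real.pi * Complex.I) * dlog (fun w => slash 12 α Delta w / Delta w) z

/-! ### Quasimodular Hecke operators -/

/-- The inclusion `SL₂(ℤ) → GL₂⁺(ℚ)`. -/
def inclSL : SL(2, ℤ) →* Matrix.GLPos (Fin 2) ℚ :=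
  Matrix.SpecialLinearGroup.toGLPos.comp (Matrix.SpecialLinearGroup.map (Int.castRingHom ℚ))

/-- `Γ(N)` as a subgroup of `GL₂⁺(ℚ)`. -/
def GammaQ (N : ℕ) : Subgroup (Matrix.GLPos (Fin 2) ℚ) := (CongruenceSubgroup.Gamma N).map inclSL

/-- The set of cosets `Γ(N) \ GL₂⁺(ℚ)`. -/
abbrev Cosets (N : ℕ) : Type := Quotient (QuotientGroup.rightRel (GammaQ N))

/-- The space `𝒬(Γ(N))` of quasimodular Hecke operators of level `Γ(N)`: the functions
`F : Γ(N) \ GL₂⁺(ℚ) → 𝒬ℳ` of finite support with `F_{αγ} = F_α‖γ` for `γ ∈ Γ(N)`. -/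
def QHecke (N : ℕ) : Submodule ℂ (Matrix.GLPos (Fin 2) ℚ → ℍ → ℂ) where
  carrier := {F | (∀ α, F α ∈ QM) ∧ (∀ γ ∈ GammaQ N, ∀ α, F (γ * α) = F α) ∧
    ((fun α => (Quotient.mk _ α : Cosets N)) '' {α | F α ≠ 0}).Finite ∧
    ∀ γ ∈ GammaQ N, ∀ α, F (α * γ) = qslash γ (F α)}
  zero_mem' := by
    refine ⟨fun α => QM.zero_mem, fun _ _ _ => rfl, by simp, fun γ _ α => ?_⟩
    simp only [Pi.zero_apply, map_zero]
  add_mem' := by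
    rintro F G ⟨h1, h2, h3, h4⟩ ⟨k1, k2, k3, k4⟩
    refine ⟨fun α => QM.add_mem (h1 α) (k1 α), fun γ hγ α => ?_, ?_, fun γ hγ α => ?_⟩
    · simp only [Pi.add_apply, h2 γ hγ, k2 γ hγ]
    · apply (h3.union k3).subset
      rw [← Set.image_union]
      apply Set.image_mono
      intro α hα
      by_contra hc
      simp only [Set.mem_union, Set.mem_ofPred_eq, not_or, not_not] at hc
      exact hα (by rw [Pi.add_apply, hc.1, hc.2, add_zero])
    · simp only [Pi.add_apply, h4 γ hγ, k4 γ hγ, map_add]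
  smul_mem' := by
    rintro c F ⟨h1, h2, h3, h4⟩
    refine ⟨fun α => QM.smul_mem c (h1 α), fun γ hγ α => ?_, ?_, fun γ hγ α => ?_⟩
    · simp only [Pi.smul_apply, h2 γ hγ]
    · apply h3.subset
      apply Set.image_mono
      intro α hα hc
      exact hα (by rw [Pi.smul_apply, hc, smul_zero])
    · simp only [Pi.smul_apply, h4 γ hγ, map_smul]

/-- The product `(F ∗ G)_α = ∑_{β ∈ Γ(N) \ GL₂⁺(ℚ)} F_β · (G_{αβ⁻¹}‖β)`. -/
def heckeMul (N : ℕ) (F G : Matrix.GLPos (Fin 2) ℚ → ℍ → ℂ) (α : Matrix.GLPos (Fin 2) ℚ) : ℍ → ℂ :=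
  ∑ᶠ β : Cosets N, F β.out * qslash β.out (G (α * β.out⁻¹))

/-- The product `(F ∗ʳ G)_α = ∑_{β ∈ Γ(N) \ SL₂(ℤ)} F_β · (G_{αβ⁻¹}‖β)`. -/
def heckeMulR (N : ℕ) (F G : Matrix.GLPos (Fin 2) ℚ → ℍ → ℂ) (α : Matrix.GLPos (Fin 2) ℚ) : ℍ → ℂ :=
  ∑ᶠ β : Quotient (QuotientGroup.rightRel (CongruenceSubgroup.Gamma N)),
    F (inclSL β.out) * qslash (inclSL β.out) (G (α * (inclSL β.out)⁻¹))

end QMHecke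

end

noncomputable section

namespace QMHecke

open UpperHalfPlane EisensteinSeries Derivative

/-! ### The slash action of `GL₂⁺(ℚ)` -/

/-! The space 𝒬ℳ is the polynomial ring ℳ[G₂] (`QM_eq_span`, `expand_eq_zero`), and X, Y and ‖α act
on the modular coefficients only, so G₂ behaves as a constant and every identity on 𝒬ℳ reduces to
monomials a·G₂^i. On ℳ, the relation DΔ = E₂Δ, with D = (1/2πi) d/dz, identifies X with the Serre
derivative. Thus X is a derivation raising the weight by 2 and Y is half the weight, whence [Y, X] =
X.

The whole twist comes from one failure of equivariance: X(f‖α) = X(f)‖α + μ_α·(Y(f)‖α)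
(`opX_qslash`). Here μ is a cocycle of weight 2, μ_{αβ} = μ_α‖β + μ_β, which vanishes on SL₂(ℤ)
(`mu_mul`, `mu_inclSL`). Vanishing on SL₂(ℤ) makes X, Y and multiplication by X^n(μ_α) preserve the
Γ-conditions that define 𝒬(Γ). Applying X to a summand F_β·(G_{αβ⁻¹}‖β) leaves the extra term
μ_βF_β·(Y(G_{αβ⁻¹})‖β), a summand of δ₁(F) ∗ Y(G); this is the term δ₁ ⊗ Y of the coproduct
(`heckeX_mul`). The cocycle identity for α = (αβ⁻¹)β says exactly that δ₁ is a derivation of ∗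
(`heckeδ_mul`). For ∗ʳ only β in SL₂(ℤ) occur, so μ_β = 0 and the twist disappears.

The δ_n act by commuting multiplications and are iterated brackets of X with δ₁, so the relations of
ℋ₁ follow from few identities (`hecke_rel`). The Hopf condition is multiplicative in h, so it
suffices to check X, Y and δ₁ (`isHopfAction_of_adjoin`). -/

theorem toGLR_mul (α β : Matrix.GLPos (Fin 2) ℚ) : toGLR (α * β) = toGLR α * toGLR β := by
  simp [toGLR]

theorem toGLR_one : toGLR 1 = 1 := by simp [toGLR]

theorem toGLR_det_pos (α : Matrix.GLPos (Fin 2) ℚ) : 0 < (toGLR α).det.val := by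
  have h : 0 < ((α : GL (Fin 2) ℚ).det : ℚ) := α.2
  have e : (toGLR α).det.val = (((α : GL (Fin 2) ℚ).det : ℚ) : ℝ) := by
    simp [toGLR, Matrix.det_fin_two]
  rw [e]
  exact_mod_cast h

theorem toGLR_inclSL (γ : SL(2, ℤ)) :
    toGLR (inclSL γ) = Matrix.SpecialLinearGroup.mapGL ℝ γ := by
  ext i j
  simp [toGLR, inclSL]

theorem σ_toGLR (α : Matrix.GLPos (Fin 2) ℚ) (z : ℂ) : UpperHalfPlane.σ (toGLR α) z = z := by
  rw [UpperHalfPlane.σ, if_pos (toGLR_det_pos α), ContinuousAlgEquiv.refl_apply]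

theorem denom_toGLR_mul (α β : Matrix.GLPos (Fin 2) ℚ) (z : ℍ) :
    denom (toGLR (α * β)) z = denom (toGLR α) (toGLR β • z : ℍ) * denom (toGLR β) z := by
  rw [toGLR_mul, denom_cocycle_σ, σ_toGLR]

theorem slash_apply (m : ℕ) (α : Matrix.GLPos (Fin 2) ℚ) (f : ℍ → ℂ) (z : ℍ) :
    slash m α f z = ((((toGLR α).det.val : ℝ) ^ ((m : ℝ) / 2) : ℝ) : ℂ) *
      denom (toGLR α) z ^ (-(m : ℤ)) * f (toGLR α • z) := rfl

theorem slash_slash (m : ℕ) (α β : Matrix.GLPos (Fin 2) ℚ) (f : ℍ → ℂ) :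
    slash m β (slash m α f) = slash m (α * β) f := by
  ext z
  have h : (((toGLR (α * β)).det.val : ℝ) ^ ((m : ℝ) / 2) : ℝ)
      = ((toGLR α).det.val : ℝ) ^ ((m : ℝ) / 2) * ((toGLR β).det.val : ℝ) ^ ((m : ℝ) / 2) := by
    rw [toGLR_mul, map_mul, Units.val_mul,
      Real.mul_rpow (toGLR_det_pos α).le (toGLR_det_pos β).le]
  simp only [slash_apply]
  rw [h, denom_toGLR_mul, mul_zpow, toGLR_mul, mul_smul]
  push_cast
  ring

theorem slash_one (m : ℕ) (f : ℍ → ℂ) : slash m 1 f = f := by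
  ext z
  simp [slash_apply, toGLR_one]

theorem slash_mul (m n : ℕ) (α : Matrix.GLPos (Fin 2) ℚ) (f g : ℍ → ℂ) :
    slash (m + n) α (f * g) = slash m α f * slash n α g := by
  ext z
  have h : (((toGLR α).det.val : ℝ) ^ (((m + n : ℕ) : ℝ) / 2) : ℝ)
      = ((toGLR α).det.val : ℝ) ^ ((m : ℝ) / 2) * ((toGLR α).det.val : ℝ) ^ ((n : ℝ) / 2) := by
    rw [← Real.rpow_add (toGLR_det_pos α)]
    push_cast
    ring_nf
  simp only [slash_apply, Pi.mul_apply]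
  rw [h, Nat.cast_add, neg_add, zpow_add₀ (denom_ne_zero _ z)]
  push_cast
  ring

/-- The normalisation by det^{m/2} and Mathlib's by det^{m-1} differ by a constant. Holomorphy,
growth and the derivative formula therefore carry over from Mathlib's slash action. -/
theorem slash_eq_smul (m : ℕ) (α : Matrix.GLPos (Fin 2) ℚ) (f : ℍ → ℂ) :
    slash m α f = (((((toGLR α).det.val : ℝ) ^ ((m : ℝ) / 2) : ℝ) : ℂ) *
      ((toGLR α).det.val : ℂ) ^ (1 - (m : ℤ))) • (f ∣[(m : ℤ)] toGLR α) := by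
  ext z
  have hd : ((toGLR α).det.val : ℂ) ≠ 0 := by exact_mod_cast (toGLR_det_pos α).ne'
  rw [Pi.smul_apply, ModularForm.slash_apply, σ_toGLR, abs_of_pos (toGLR_det_pos α), slash_apply,
    smul_eq_mul]
  have h : ((toGLR α).det.val : ℂ) ^ (1 - (m : ℤ)) * ((toGLR α).det.val : ℂ) ^ ((m : ℤ) - 1)
      = 1 := by
    rw [← zpow_add₀ hd, show (1 - (m : ℤ)) + ((m : ℤ) - 1) = 0 by ring, zpow_zero]
  linear_combination (-((((toGLR α).det.val : ℝ) ^ ((m : ℝ) / 2) : ℝ) : ℂ) *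
    denom (toGLR α) z ^ (-(m : ℤ)) * f (toGLR α • z)) * h

theorem slash_inclSL (m : ℕ) (γ : SL(2, ℤ)) (f : ℍ → ℂ) :
    slash m (inclSL γ) f = f ∣[(m : ℤ)] γ := by
  rw [slash_eq_smul, toGLR_inclSL, ModularForm.SL_slash]
  have : (Matrix.SpecialLinearGroup.mapGL ℝ γ).det.val = 1 := by simp
  rw [this]
  simp
  rfl

theorem slash_mdifferentiable {m : ℕ} {α : Matrix.GLPos (Fin 2) ℚ} {f : ℍ → ℂ} (hf : MDiff f) :
    MDiff (slash m α f) := by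
  rw [slash_eq_smul]
  exact (hf.slash _ _).const_smul _

theorem slash_isBoundedAtImInfty {m : ℕ} {α : Matrix.GLPos (Fin 2) ℚ}
    (hα : (α : GL (Fin 2) ℚ) 1 0 = 0) {f : ℍ → ℂ} (hf : IsBoundedAtImInfty f) :
    IsBoundedAtImInfty (slash m α f) := by
  rw [slash_eq_smul]
  refine Filter.BoundedAtFilter.smul _ (hf.slash m ?_)
  simp [toGLR, hα]

/-- Every element of `GL₂⁺(ℚ)` is the product of an element of `SL₂(ℤ)` and an upper triangular
matrix. -/
theorem exists_inclSL_mul_upper (α : Matrix.GLPos (Fin 2) ℚ) :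
    ∃ (γ : SL(2, ℤ)) (τ : Matrix.GLPos (Fin 2) ℚ),
      α = inclSL γ * τ ∧ (τ : GL (Fin 2) ℚ) 1 0 = 0 := by
  -- SL₂(ℤ) is transitive on ℙ¹(ℚ). If γ∞ = α∞, then γ⁻¹α fixes ∞, which means that its lower left
  -- entry is zero.
  obtain ⟨γ, hγ⟩ := OnePoint.exists_mem_SL2 ℤ ((α : GL (Fin 2) ℚ) • (OnePoint.infty : OnePoint ℚ))
  refine ⟨γ, (inclSL γ)⁻¹ * α, by simp, ?_⟩
  rw [← OnePoint.smul_infty_eq_self_iff]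
  have e : ((inclSL γ : Matrix.GLPos (Fin 2) ℚ) : GL (Fin 2) ℚ)
      = Matrix.SpecialLinearGroup.mapGL ℚ γ := by
    ext i j
    simp [inclSL]
  simp only [Subgroup.coe_mul, Subgroup.coe_inv, mul_smul, e]
  rw [inv_smul_eq_iff, hγ]

/-! ### Modular forms for `Γ(N)` -/

/-- `f` is a modular form of weight `k` for `Γ(N)`. -/
structure IsModular (N : ℕ) (k : ℤ) (f : ℍ → ℂ) : Prop where
  holo : MDiff f
  slash_eq : ∀ γ ∈ CongruenceSubgroup.Gamma N, f ∣[k] γ = f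
  bdd : ∀ γ : SL(2, ℤ), IsBoundedAtImInfty (f ∣[k] γ)

instance isArithmetic_Gamma (N : ℕ) [NeZero N] :
    ((CongruenceSubgroup.Gamma N).map (Matrix.SpecialLinearGroup.mapGL ℝ)).IsArithmetic := by
  infer_instance

/-- Every cusp of Γ(N) is an SL₂(ℤ)-translate of ∞, so boundedness of all f|γ at i∞ gives
boundedness at all cusps. -/
theorem IsModular.exists_modularForm {N : ℕ} (hN : 1 ≤ N) {k : ℤ} {f : ℍ → ℂ}
    (hf : IsModular N k f) :
    ∃ g : ModularForm ((CongruenceSubgroup.Gamma N).map (Matrix.SpecialLinearGroup.mapGL ℝ)) k,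
      ⇑g = f := by
  have : NeZero N := ⟨by omega⟩
  refine ⟨⟨⟨f, ?_⟩, hf.holo, ?_⟩, rfl⟩
  · rintro _ ⟨γ, hγ, rfl⟩
    exact hf.slash_eq γ hγ
  · intro c hc
    rw [Subgroup.IsArithmetic.isCusp_iff_isCusp_SL2Z] at hc
    rw [OnePoint.isBoundedAt_iff_forall_SL2Z hc]
    exact fun γ _ => hf.bdd γ

theorem ModularForm.isModular {N : ℕ} (hN : 1 ≤ N) {k : ℤ}
    (g : ModularForm ((CongruenceSubgroup.Gamma N).map (Matrix.SpecialLinearGroup.mapGL ℝ)) k) :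
    IsModular N k g := by
  have : NeZero N := ⟨by omega⟩
  exact ⟨ModularFormClass.holo g, fun γ hγ => g.slash_action_eq' _ ⟨γ, hγ, rfl⟩,
    fun γ => ModularFormClass.bdd_at_infty_slash g γ⟩

theorem Gamma_le_of_dvd {M N : ℕ} (h : M ∣ N) :
    CongruenceSubgroup.Gamma N ≤ CongruenceSubgroup.Gamma M := by
  intro γ hγ
  rw [CongruenceSubgroup.Gamma_mem] at hγ ⊢
  obtain ⟨h1, h2, h3, h4⟩ := hγ
  have e : ∀ n : ℤ, ((n : ZMod M)) = ZMod.castHom h (ZMod M) (n : ZMod N) := fun n => by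
    rw [map_intCast]
  simp only [e, h1, h2, h3, h4, map_one, map_zero, and_self]

theorem IsModular.of_dvd {M N : ℕ} (h : M ∣ N) {k : ℤ} {f : ℍ → ℂ} (hf : IsModular M k f) :
    IsModular N k f :=
  ⟨hf.holo, fun γ hγ => hf.slash_eq γ (Gamma_le_of_dvd h hγ), hf.bdd⟩

theorem IsModular.zero (N : ℕ) (k : ℤ) : IsModular N k 0 :=
  ⟨mdifferentiable_const, fun _ _ => SlashAction.zero_slash _ _, fun γ => by
    rw [SlashAction.zero_slash]; exact zero_form_isBoundedAtImInfty⟩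

theorem IsModular.add {N : ℕ} {k : ℤ} {f g : ℍ → ℂ} (hf : IsModular N k f)
    (hg : IsModular N k g) : IsModular N k (f + g) :=
  ⟨hf.holo.add hg.holo, fun γ hγ => by
    rw [SlashAction.add_slash, hf.slash_eq γ hγ, hg.slash_eq γ hγ], fun γ => by
    rw [SlashAction.add_slash]; exact (hf.bdd γ).add (hg.bdd γ)⟩

theorem IsModular.smul {N : ℕ} {k : ℤ} {f : ℍ → ℂ} (c : ℂ) (hf : IsModular N k f) :
    IsModular N k (c • f) :=
  ⟨hf.holo.const_smul c, fun γ hγ => by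
    rw [ModularForm.SL_smul_slash, hf.slash_eq γ hγ], fun γ => by
    rw [ModularForm.SL_smul_slash]; exact (hf.bdd γ).smul c⟩

theorem IsModular.mul {N : ℕ} {k l : ℤ} {f g : ℍ → ℂ} (hf : IsModular N k f)
    (hg : IsModular N l g) : IsModular N (k + l) (f * g) :=
  ⟨hf.holo.mul hg.holo, fun γ hγ => by
    rw [ModularForm.mul_slash_SL2, hf.slash_eq γ hγ, hg.slash_eq γ hγ], fun γ => by
    rw [ModularForm.mul_slash_SL2]; exact (hf.bdd γ).mul (hg.bdd γ)⟩

/-- The span in `modTower` adds nothing to the union over levels: forms of levels M and N both have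
level MN. -/
theorem mem_modTower_iff {m : ℕ} {f : ℍ → ℂ} :
    f ∈ modTower m ↔ ∃ N : ℕ, 1 ≤ N ∧ IsModular N m f := by
  constructor
  · intro hf
    induction hf using Submodule.span_induction with
    | mem f hf =>
      obtain ⟨N, hN, g, rfl⟩ := hf
      exact ⟨N, hN, ModularForm.isModular hN g⟩
    | zero => exact ⟨1, le_rfl, IsModular.zero _ _⟩
    | add f g _ _ hf hg =>
      obtain ⟨M, hM, hf⟩ := hf
      obtain ⟨N, hN, hg⟩ := hg
      exact ⟨M * N, Nat.mul_pos hM hN, (hf.of_dvd (dvd_mul_right _ _)).add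
        (hg.of_dvd (dvd_mul_left _ _))⟩
    | smul c f _ hf =>
      obtain ⟨M, hM, hf⟩ := hf
      exact ⟨M, hM, hf.smul c⟩
  · rintro ⟨N, hN, hf⟩
    exact Submodule.subset_span ⟨N, hN, hf.exists_modularForm hN⟩

theorem modTower_mul {m n : ℕ} {f g : ℍ → ℂ} (hf : f ∈ modTower m) (hg : g ∈ modTower n) :
    f * g ∈ modTower (m + n) := by
  rw [mem_modTower_iff] at hf hg ⊢
  obtain ⟨M, hM, hf⟩ := hf
  obtain ⟨N, hN, hg⟩ := hg
  refine ⟨M * N, Nat.mul_pos hM hN, ?_⟩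
  push_cast
  exact (hf.of_dvd (dvd_mul_right _ _)).mul (hg.of_dvd (dvd_mul_left _ _))

theorem one_mem_modTower : (1 : ℍ → ℂ) ∈ modTower 0 := by
  rw [mem_modTower_iff]
  refine ⟨1, le_rfl, mdifferentiable_const, fun γ _ => ?_, fun γ => ?_⟩
  · exact ModularForm.is_invariant_one γ
  · have : (1 : ℍ → ℂ) ∣[((0 : ℕ) : ℤ)] γ = 1 := ModularForm.is_invariant_one γ
    rw [this]
    exact Filter.const_boundedAtFilter _ 1

/-- Needed in the descent on the depth: it kills a top component f_s whose weight k - 2s is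
negative. -/
theorem isModular_eq_zero_of_neg {N : ℕ} (hN : 1 ≤ N) {k : ℤ} (hk : k < 0) {f : ℍ → ℂ}
    (hf : IsModular N k f) : f = 0 := by
  have : NeZero N := ⟨by omega⟩
  obtain ⟨g, rfl⟩ := hf.exists_modularForm hN
  rw [_root_.ModularForm.isZero_of_neg_weight hk g]
  rfl

/-- For every `α ∈ GL₂⁺(ℚ)`, some `Γ(M)` is conjugated into `Γ(N)` by `α`. -/
theorem exists_Gamma_mul_comm (α : Matrix.GLPos (Fin 2) ℚ) {N : ℕ} (hN : 1 ≤ N) :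
    ∃ M, 1 ≤ M ∧ ∀ γ ∈ CongruenceSubgroup.Gamma M, ∃ γ' ∈ CongruenceSubgroup.Gamma N,
      α * inclSL γ = inclSL γ' * α := by
  have : NeZero N := ⟨by omega⟩
  obtain ⟨M, hM, h⟩ := CongruenceSubgroup.exists_Gamma_le_conj (α : GL (Fin 2) ℚ) N
  refine ⟨M, Nat.one_le_iff_ne_zero.2 hM, fun γ hγ => ?_⟩
  obtain ⟨γ', hγ', e⟩ := h γ hγ
  have e' : ∀ γ, ((inclSL γ : Matrix.GLPos (Fin 2) ℚ) : GL (Fin 2) ℚ)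
      = Matrix.SpecialLinearGroup.mapGL ℚ γ := by
    intro γ
    ext i j
    simp [inclSL]
  refine ⟨γ', hγ', Subtype.ext ?_⟩
  rw [Subgroup.coe_mul, Subgroup.coe_mul, e', e', e, inv_mul_cancel_right]

/-- The slash action preserves the modular tower. -/
theorem slash_mem_modTower {m : ℕ} (α : Matrix.GLPos (Fin 2) ℚ) {f : ℍ → ℂ}
    (hf : f ∈ modTower m) : slash m α f ∈ modTower m := by
  rw [mem_modTower_iff] at hf ⊢
  obtain ⟨N, hN, hf⟩ := hf
  obtain ⟨M, hM, hc⟩ := exists_Gamma_mul_comm α hN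
  refine ⟨M, hM, slash_mdifferentiable hf.holo, fun γ hγ => ?_, fun γ => ?_⟩
  · obtain ⟨γ', hγ', e⟩ := hc γ hγ
    rw [← slash_inclSL, slash_slash, e, ← slash_slash, slash_inclSL, hf.slash_eq γ' hγ']
  · obtain ⟨γ', τ, e, hτ⟩ := exists_inclSL_mul_upper (α * inclSL γ)
    rw [← slash_inclSL, slash_slash, e, ← slash_slash, slash_inclSL]
    exact slash_isBoundedAtImInfty hτ (hf.bdd γ')

end QMHecke
end

noncomputable section

namespace QMHecke

open UpperHalfPlane EisensteinSeries Derivative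

/-! ### The weight two Eisenstein series, the discriminant and the cocycle `μ` -/

theorem two_pi_I_ne_zero : (2 * Real.pi * Complex.I : ℂ) ≠ 0 := Complex.two_pi_I_ne_zero

theorem pi_mul_I_ne_zero : (Real.pi : ℂ) * Complex.I ≠ 0 :=
  mul_ne_zero (by exact_mod_cast Real.pi_ne_zero) Complex.I_ne_zero

theorem G2_eq : G2 = (-1 / 24 : ℂ) • E2 := by
  ext z
  rw [Pi.smul_apply, E2_eq_tsum_cexp, G2]
  have h : ∀ n : ℕ+, Complex.exp (2 * Real.pi * Complex.I * n * z)
      = Complex.exp (2 * Real.pi * Complex.I * z) ^ (n : ℕ) := by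
    intro n
    rw [← Complex.exp_nat_mul]
    congr 1
    ring
  simp only [h, bernoulli_two, smul_eq_mul]
  push_cast
  ring

/-- The function `c / (cz + d)` attached to a matrix with bottom row `(c, d)`. -/
def lowerRatio (α : Matrix.GLPos (Fin 2) ℚ) (z : ℍ) : ℂ := ((toGLR α 1 0 : ℝ) : ℂ) / denom (toGLR α) z

theorem lowerRatio_mdifferentiable (α : Matrix.GLPos (Fin 2) ℚ) : MDiff (lowerRatio α) := by
  have : lowerRatio α = (((toGLR α 1 0 : ℝ) : ℂ)) • fun z : ℍ => (denom (toGLR α) z)⁻¹ := by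
    ext z
    simp [lowerRatio, div_eq_mul_inv]
  rw [this]
  exact (mdifferentiable_inv_denom _).const_smul _

/-- c/(cz+d) is the logarithmic derivative of the automorphy factor cz+d. Differentiating the
multiplicative cocycle relation for cz+d gives an additive cocycle of weight 2. -/
theorem lowerRatio_mul (α β : Matrix.GLPos (Fin 2) ℚ) :
    lowerRatio (α * β) = slash 2 β (lowerRatio α) + lowerRatio β := by
  ext z
  have h1 : denom (toGLR β) z ≠ 0 := denom_ne_zero _ z
  have h2 : denom (toGLR α) (toGLR β • z : ℍ) ≠ 0 := denom_ne_zero _ _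
  have h3 : denom (toGLR (α * β)) z ≠ 0 := denom_ne_zero _ z
  have e3 := denom_toGLR_mul α β z
  have hdet : (toGLR β).det.val = toGLR β 0 0 * toGLR β 1 1 - toGLR β 0 1 * toGLR β 1 0 := by
    simp [Matrix.det_fin_two]
  have hc : toGLR (α * β) 1 0 = toGLR α 1 0 * toGLR β 0 0 + toGLR α 1 1 * toGLR β 1 0 := by
    rw [toGLR_mul]
    simp [Matrix.mul_apply, Fin.sum_univ_two]
  have hs : ((toGLR β • z : ℍ) : ℂ) * denom (toGLR β) z = num (toGLR β) z := by
    rw [coe_smul_of_det_pos (toGLR_det_pos β)]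
    field_simp
  have e2 : denom (toGLR α) (toGLR β • z : ℍ)
      = toGLR α 1 0 * ((toGLR β • z : ℍ) : ℂ) + toGLR α 1 1 := rfl
  have e1 : denom (toGLR β) z = toGLR β 1 0 * (z : ℂ) + toGLR β 1 1 := rfl
  have e0 : num (toGLR β) z = toGLR β 0 0 * (z : ℂ) + toGLR β 0 1 := rfl
  have hp : ((toGLR β).det.val : ℝ) ^ (((2 : ℕ) : ℝ) / 2) = (toGLR β).det.val := by norm_num
  rw [Pi.add_apply, slash_apply, hp]
  simp only [lowerRatio]
  rw [e3, hc, hdet]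
  rw [show (-((2 : ℕ) : ℤ)) = -2 by norm_num, zpow_neg]
  rw [show (2 : ℤ) = ((2 : ℕ) : ℤ) by norm_num, zpow_natCast]
  field_simp
  rw [e2]
  push_cast
  rw [e0] at hs
  rw [e1] at hs ⊢
  linear_combination (-(toGLR β 1 0 : ℂ) * toGLR α 1 0) * hs

theorem denom_inclSL (γ : SL(2, ℤ)) (z : ℍ) :
    denom (toGLR (inclSL γ)) z = ((γ 1 0 : ℤ) : ℂ) * z + ((γ 1 1 : ℤ) : ℂ) := by
  rw [toGLR_inclSL]
  simp [denom]

theorem lowerRatio_inclSL (γ : SL(2, ℤ)) (z : ℍ) :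
    lowerRatio (inclSL γ) z
      = ((γ 1 0 : ℤ) : ℂ) / (((γ 1 0 : ℤ) : ℂ) * z + ((γ 1 1 : ℤ) : ℂ)) := by
  rw [lowerRatio, denom_inclSL, toGLR_inclSL]
  simp

theorem E2_slash_inclSL (γ : SL(2, ℤ)) :
    slash 2 (inclSL γ) E2 = E2 + (6 / (Real.pi * Complex.I)) • lowerRatio (inclSL γ) := by
  rw [slash_inclSL]
  have h := E2_slash_action γ
  ext z
  have hz := congrFun h z
  have hd : denom (toGLR (inclSL γ)) z ≠ 0 := denom_ne_zero _ z
  have hI := pi_mul_I_ne_zero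
  have hpi : (Real.pi : ℂ) ≠ 0 := left_ne_zero_of_mul hI
  have e : D2 γ z = 2 * Real.pi * Complex.I * lowerRatio (inclSL γ) z := by
    rw [lowerRatio_inclSL, D2, ModularGroup.denom_apply]
    ring
  rw [show ((2 : ℕ) : ℤ) = 2 by norm_num, hz]
  simp only [Pi.sub_apply, Pi.add_apply, Pi.smul_apply, smul_eq_mul, e, riemannZeta_two]
  field_simp
  linear_combination (-6 * lowerRatio (inclSL γ) z) * Complex.I_sq

/-! ### The discriminant and the Serre derivative -/

theorem Delta_eq : Delta = ((2 * Real.pi) ^ 12 : ℂ) • ModularForm.discriminant := by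
  ext z
  rw [Pi.smul_apply, ModularForm.discriminant_eq_q_prod, Delta, smul_eq_mul,
    tprod_pnat_eq_tprod_succ (f := fun n =>
      (1 - Complex.exp (2 * Real.pi * Complex.I * z) ^ n) ^ 24)]
  simp [Function.Periodic.qParam, ModularForm.eta_q_eq_pow]

theorem Delta_ne_zero (z : ℍ) : Delta z ≠ 0 := by
  rw [Delta_eq, Pi.smul_apply, smul_eq_mul]
  have : (Real.pi : ℂ) ≠ 0 := by exact_mod_cast Real.pi_ne_zero
  exact mul_ne_zero (pow_ne_zero _ (mul_ne_zero two_ne_zero this)) (ModularForm.discriminant_ne_zero z)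

theorem Delta_mdifferentiable : MDiff Delta := by
  rw [Delta_eq]
  exact CuspForm.discriminant.holo'.const_smul _

theorem D_eq_ddz (f : ℍ → ℂ) (z : ℍ) :
    D f z = (2 * Real.pi * Complex.I)⁻¹ * ddz f z := rfl

/-- Up to a constant Δ = η²⁴, and the logarithmic derivative of η is (πi/12)·E₂. -/
theorem D_Delta : D Delta = E2 * Delta := by
  have hdisc : MDiff ModularForm.discriminant := CuspForm.discriminant.holo'
  rw [Delta_eq, normalizedDerivOfComplex_smul _ _ hdisc, mul_smul_comm]
  congr 1
  ext z
  rw [Pi.mul_apply, D_eq_ddz]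
  have hη : DifferentiableAt ℂ ModularForm.eta z :=
    ModularForm.differentiableAt_eta_of_mem_upperHalfPlaneSet z.2
  have h0 : ModularForm.eta z ≠ 0 := ModularForm.eta_ne_zero z.2
  have hl := ModularForm.logDeriv_eta_eq_E2 z
  rw [logDeriv_apply, div_eq_iff h0] at hl
  have he : ModularForm.discriminant ∘ UpperHalfPlane.ofComplex
      =ᶠ[nhds (z : ℂ)] fun w => ModularForm.eta w ^ 24 := by
    filter_upwards [isOpen_upperHalfPlaneSet.mem_nhds z.2] with w hw
    simp [ModularForm.discriminant, ofComplex_apply_of_im_pos hw]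
  have hI := pi_mul_I_ne_zero
  rw [ddz, he.deriv_eq, deriv_fun_pow hη, hl, ModularForm.discriminant]
  push_cast
  field_simp
  ring

theorem dlog_eq (f : ℍ → ℂ) (z : ℍ) : dlog f z = 2 * Real.pi * Complex.I * (D f z / f z) := by
  rw [D_eq_ddz, dlog]
  have := two_pi_I_ne_zero
  field_simp

theorem modX_eq (m : ℕ) (f : modTower m) : modX m f = serreDerivative m (f : ℍ → ℂ) := by
  ext z
  have hI := pi_mul_I_ne_zero
  have hΔ := Delta_ne_zero z
  change 1 / (2 * Real.pi * Complex.I) * ddz f z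
    - 1 / (12 * Real.pi * Complex.I) * dlog Delta z * ((m : ℂ) / 2 * (f : ℍ → ℂ) z) = _
  rw [dlog_eq, D_Delta, serreDerivative_apply, D_eq_ddz, Pi.mul_apply]
  field_simp

/-- The derivative of `f|α`. -/
theorem D_slash (m : ℕ) (α : Matrix.GLPos (Fin 2) ℚ) {f : ℍ → ℂ} (hf : MDiff f) :
    D (slash m α f) = slash (m + 2) α (D f) -
      ((m : ℂ) * (2 * Real.pi * Complex.I)⁻¹) • (lowerRatio α * slash m α f) := by
  have hd := toGLR_det_pos α
  have hdC : ((toGLR α).det.val : ℂ) ≠ 0 := by exact_mod_cast hd.ne'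
  have hdet : (toGLR α).det.val = (toGLR α).val.det :=
    Matrix.GeneralLinearGroup.val_det_apply _
  -- In Mathlib's normalisation the derivative of f|α carries a factor det⁻¹ in front of (Df)|α. The
  -- change of normalising constants between the weights m and m + 2 absorbs it.
  have hk : (((((toGLR α).det.val : ℝ) ^ (((m + 2 : ℕ) : ℝ) / 2) : ℝ) : ℂ) *
      ((toGLR α).det.val : ℂ) ^ (1 - ((m + 2 : ℕ) : ℤ)))
      = (((((toGLR α).det.val : ℝ) ^ ((m : ℝ) / 2) : ℝ) : ℂ) *
      ((toGLR α).det.val : ℂ) ^ (1 - (m : ℤ))) * ((toGLR α).det.val : ℂ)⁻¹ := by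
    rw [show (((m + 2 : ℕ) : ℝ) / 2) = (m : ℝ) / 2 + 1 by push_cast; ring,
      Real.rpow_add_one hd.ne', show (1 - ((m + 2 : ℕ) : ℤ)) = (1 - (m : ℤ)) + (-1) + (-1) by
        push_cast; ring, zpow_add₀ hdC, zpow_add₀ hdC, zpow_neg_one]
    push_cast
    field_simp
  have hD := normalizedDerivOfComplex_slash (k := m) hf (g := toGLR α) (by rw [← hdet]; exact hd)
  rw [slash_eq_smul m, slash_eq_smul (m + 2), hk,
    normalizedDerivOfComplex_smul _ _ (hf.slash _ _), hD]
  ext z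
  simp only [Pi.smul_apply, Pi.sub_apply, Pi.mul_apply, smul_eq_mul, lowerRatio, hdet]
  push_cast
  ring

theorem slash_Delta_ne_zero (α : Matrix.GLPos (Fin 2) ℚ) (z : ℍ) : slash 12 α Delta z ≠ 0 := by
  rw [slash_apply]
  refine mul_ne_zero (mul_ne_zero ?_ (zpow_ne_zero _ (denom_ne_zero _ z))) (Delta_ne_zero _)
  exact_mod_cast (Real.rpow_pos_of_pos (toGLR_det_pos α) _).ne'

theorem D_div {f g : ℍ → ℂ} (hf : MDiff f) (hg : MDiff g) (hf0 : ∀ z, f z ≠ 0)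
    (hg0 : ∀ z, g z ≠ 0) (z : ℍ) :
    D (fun w => f w / g w) z / (f z / g z) = D f z / f z - D g z / g z := by
  have hf' := UpperHalfPlane.mdifferentiableAt_iff.mp (hf z)
  have hg' := UpperHalfPlane.mdifferentiableAt_iff.mp (hg z)
  have e : (fun w => f w / g w) ∘ UpperHalfPlane.ofComplex
      = fun w => (f ∘ UpperHalfPlane.ofComplex) w / (g ∘ UpperHalfPlane.ofComplex) w := rfl
  have h1 := hf0 z
  have h2 := hg0 z
  rw [normalizedDerivOfComplex, e, deriv_fun_div hf' hg' (by simpa using h2)]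
  simp only [normalizedDerivOfComplex, Function.comp_apply, ofComplex_apply]
  field_simp

/-- The cocycle `μ` in terms of the Eisenstein series `E₂`. -/
theorem mu_eq (α : Matrix.GLPos (Fin 2) ℚ) :
    mu α = (1 / 6 : ℂ) • (slash 2 α E2 - (6 / (Real.pi * Complex.I)) • lowerRatio α - E2) := by
  ext z
  have hI := pi_mul_I_ne_zero
  have hs := slash_Delta_ne_zero α z
  have hΔ := Delta_ne_zero z
  rw [mu, dlog_eq, D_div (slash_mdifferentiable Delta_mdifferentiable) Delta_mdifferentiable
    (slash_Delta_ne_zero α) Delta_ne_zero, D_slash 12 α Delta_mdifferentiable, D_Delta,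
    show 12 + 2 = 2 + 12 from rfl, slash_mul]
  simp only [Pi.smul_apply, Pi.sub_apply, Pi.mul_apply, smul_eq_mul]
  field_simp
  push_cast
  ring

/-- By `mu_eq`, μ is a combination of the coboundary E₂|α - E₂ and the cocycle c/(cz+d). -/
theorem mu_mul (α β : Matrix.GLPos (Fin 2) ℚ) : mu (α * β) = slash 2 β (mu α) + mu β := by
  rw [mu_eq, mu_eq, mu_eq, lowerRatio_mul]
  simp only [map_smul, map_sub, slash_slash]
  module

/-- The correction by c/(cz+d) in μ is exactly the anomaly of E₂ under SL₂(ℤ). Equivalently, Δ|γ =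
Δ. -/
theorem mu_inclSL (γ : SL(2, ℤ)) : mu (inclSL γ) = 0 := by
  rw [mu_eq, E2_slash_inclSL]
  simp

/-- `X(f|α) = X(f)|α + μ_α Y(f|α)` on functions of weight `m`. -/
theorem serreDerivative_slash (m : ℕ) (α : Matrix.GLPos (Fin 2) ℚ) {f : ℍ → ℂ} (hf : MDiff f) :
    serreDerivative m (slash m α f) =
      slash (m + 2) α (serreDerivative m f) + ((m : ℂ) / 2) • (mu α * slash m α f) := by
  have hI := pi_mul_I_ne_zero
  have e : serreDerivative m f = D f - ((m : ℂ) / 12) • (f * E2) := by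
    ext z
    simp only [serreDerivative_apply, Pi.sub_apply, Pi.smul_apply, Pi.mul_apply, smul_eq_mul]
    ring
  rw [e, map_sub, map_smul, slash_mul]
  ext z
  rw [serreDerivative_apply, D_slash m α hf, mu_eq]
  simp only [Pi.add_apply, Pi.sub_apply, Pi.smul_apply, Pi.mul_apply, smul_eq_mul]
  field_simp
  ring

/-- `c / (cz + d)` is bounded at `i∞`. -/
theorem lowerRatio_isBoundedAtImInfty (α : Matrix.GLPos (Fin 2) ℚ) :
    IsBoundedAtImInfty (lowerRatio α) := by
  rw [isBoundedAtImInfty_iff]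
  -- For Im z ≥ 1 one has |cz + d| ≥ |c|·Im z ≥ |c|.
  refine ⟨1, 1, fun z hz => ?_⟩
  rw [lowerRatio, norm_div]
  apply div_le_one_of_le₀ _ (norm_nonneg _)
  have h : |(denom (toGLR α) z).im| ≤ ‖denom (toGLR α) z‖ := Complex.abs_im_le_norm _
  have e : (denom (toGLR α) z).im = toGLR α 1 0 * z.im := by
    simp [denom]
  rw [e, abs_mul, abs_of_pos z.im_pos] at h
  rw [Complex.norm_real, Real.norm_eq_abs]
  nlinarith [abs_nonneg (toGLR α 1 0)]

/-- The derivative of a function bounded at `i∞` is bounded at `i∞`. -/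
theorem D_isBoundedAtImInfty {f : ℍ → ℂ} (hf : MDiff f) (hb : IsBoundedAtImInfty f) :
    IsBoundedAtImInfty (D f) := by
  rw [isBoundedAtImInfty_iff] at hb ⊢
  obtain ⟨M, A, h⟩ := hb
  -- Cauchy's estimate on the disc of radius 1 about z. The bound on Im z keeps this disc inside ℍ
  -- and inside the region Im ≥ A where |f| ≤ M.
  refine ⟨‖(2 * Real.pi * Complex.I)⁻¹‖ * (M / 1), max A 0 + 2, fun z hz => ?_⟩
  rw [normalizedDerivOfComplex, norm_mul]
  have him : ∀ w ∈ Metric.closedBall (z : ℂ) 1, max A 0 + 1 ≤ w.im := by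
    intro w hw
    have h1 : |(w - z).im| ≤ 1 := (Complex.abs_im_le_norm _).trans (by
      simpa [dist_eq_norm] using hw)
    have h2 := (abs_le.1 h1).1
    rw [Complex.sub_im] at h2
    have h3 : ((z : ℂ)).im = z.im := rfl
    linarith
  refine mul_le_mul_of_nonneg_left ?_ (norm_nonneg _)
  apply Complex.norm_deriv_le_of_forall_mem_sphere_norm_le one_pos
  · apply DifferentiableOn.diffContOnCl
    rw [closure_ball _ one_ne_zero]
    refine (UpperHalfPlane.mdifferentiable_iff.1 hf).mono fun w hw => ?_
    have := him w hw
    have h0 := le_max_right A 0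
    show 0 < w.im
    linarith
  · intro w hw
    have h1 := him w (Metric.sphere_subset_closedBall hw)
    have h0 := le_max_right A 0
    have hA := le_max_left A 0
    have hpos : 0 < w.im := by linarith
    rw [Function.comp_apply, ofComplex_apply_of_im_pos hpos]
    apply h
    show A ≤ w.im
    linarith

theorem serreDerivative_isBoundedAtImInfty (k : ℂ) {f : ℍ → ℂ} (hf : MDiff f)
    (hb : IsBoundedAtImInfty f) : IsBoundedAtImInfty (serreDerivative k f) := by
  have e : serreDerivative k f = D f + (-k / 12) • (E2 * f) := by
    ext z
    simp only [serreDerivative_apply, Pi.add_apply, Pi.smul_apply, Pi.mul_apply, smul_eq_mul]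
    ring
  rw [e]
  exact (D_isBoundedAtImInfty hf hb).add ((isBoundedAtImInfty_E2.mul hb).smul _)

theorem modX_mem (m : ℕ) (f : modTower m) : modX m f ∈ modTower (m + 2) := by
  rw [modX_eq]
  obtain ⟨N, hN, hf⟩ := mem_modTower_iff.1 f.2
  rw [mem_modTower_iff]
  refine ⟨N, hN, serreDerivative_mdifferentiable _ hf.holo, fun γ hγ => ?_, fun γ => ?_⟩
  · have := serreDerivative_slash_invariant hf.holo (hf.slash_eq γ hγ)
    exact_mod_cast this
  · have := serreDerivative_slash_equivariant (k := m) (γ := γ) hf.holo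
    push_cast at this ⊢
    rw [this]
    exact serreDerivative_isBoundedAtImInfty _ (by
      rw [ModularForm.SL_slash]; exact hf.holo.slash _ _) (hf.bdd γ)

/-! ### Modularity of μ_α -/

theorem mu_mdifferentiable (α : Matrix.GLPos (Fin 2) ℚ) : MDiff (mu α) := by
  rw [mu_eq]
  exact (((slash_mdifferentiable E2_mdifferentiable).sub
    ((lowerRatio_mdifferentiable α).const_smul _)).sub E2_mdifferentiable).const_smul _

/-- Write α = γτ with γ in SL₂(ℤ) and τ upper triangular. The cocycle relation gives μ_α = μ_τ, and
E₂|τ is bounded because τ fixes ∞. -/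
theorem mu_isBoundedAtImInfty (α : Matrix.GLPos (Fin 2) ℚ) : IsBoundedAtImInfty (mu α) := by
  obtain ⟨γ, τ, rfl, hτ⟩ := exists_inclSL_mul_upper α
  rw [mu_mul, mu_inclSL, map_zero, zero_add, mu_eq]
  have h1 := slash_isBoundedAtImInfty (m := 2) hτ isBoundedAtImInfty_E2
  have h2 := lowerRatio_isBoundedAtImInfty τ
  have h3 := ((h1.add ((h2.smul (6 / (Real.pi * Complex.I))).neg)).add
    isBoundedAtImInfty_E2.neg).smul (1 / 6 : ℂ)
  rw [sub_eq_add_neg, sub_eq_add_neg]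
  exact h3

/-- For γ in SL₂(ℤ) the cocycle relation reads μ_{αγ} = μ_α|γ, which settles growth at all cusps. If
moreover αγ = γ'α with γ' in SL₂(ℤ), then μ_{αγ} = μ_α, so μ_α is invariant under γ. Conjugation
into level 1 suffices, because μ vanishes on all of SL₂(ℤ). -/
theorem mu_mem_modTower (α : Matrix.GLPos (Fin 2) ℚ) : mu α ∈ modTower 2 := by
  rw [mem_modTower_iff]
  obtain ⟨M, hM, hc⟩ := exists_Gamma_mul_comm α le_rfl
  refine ⟨M, hM, mu_mdifferentiable α, fun γ hγ => ?_, fun γ => ?_⟩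
  · obtain ⟨γ', -, e⟩ := hc γ hγ
    have h := mu_mul α (inclSL γ)
    rw [e, mu_mul, mu_inclSL, mu_inclSL, map_zero, zero_add, add_zero, slash_inclSL] at h
    exact h.symm
  · have h := mu_mul α (inclSL γ)
    rw [mu_inclSL, add_zero, slash_inclSL] at h
    rw [← h]
    exact mu_isBoundedAtImInfty _

end QMHecke
end

noncomputable section

namespace QMHecke

open UpperHalfPlane EisensteinSeries Derivative

/-! ### The structure theorem for quasimodular forms -/

/-- The constant `κ` in `(cz+d)⁻² G₂(γz) = G₂(z) + κ c / (cz+d)`. -/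
def kappa : ℂ := -1 / (4 * (Real.pi * Complex.I))

theorem kappa_ne_zero : kappa ≠ 0 :=
  div_ne_zero (by norm_num) (mul_ne_zero (by norm_num) pi_mul_I_ne_zero)

theorem G2_slash (γ : SL(2, ℤ)) : G2 ∣[(2 : ℤ)] γ = G2 + kappa • lowerRatio (inclSL γ) := by
  have h := E2_slash_inclSL γ
  rw [slash_inclSL] at h
  rw [G2_eq, ModularForm.SL_smul_slash]
  have h' : E2 ∣[(2 : ℤ)] γ = E2 + (6 / (Real.pi * Complex.I)) • lowerRatio (inclSL γ) := h
  rw [h', smul_add, smul_smul, kappa]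
  congr 2
  have := pi_mul_I_ne_zero
  field_simp
  norm_num

theorem G2_mdifferentiable : MDiff G2 := by
  rw [G2_eq]
  exact E2_mdifferentiable.const_smul _

theorem G2_isBoundedAtImInfty : IsBoundedAtImInfty G2 := by
  rw [G2_eq]
  exact isBoundedAtImInfty_E2.smul _

theorem mul_pow_slash (a g : ℍ → ℂ) (k l : ℤ) (i : ℕ) (γ : SL(2, ℤ)) :
    (a * g ^ i) ∣[k + l * i] γ = (a ∣[k] γ) * (g ∣[l] γ) ^ i := by
  induction i with
  | zero => simp
  | succ i ih =>
    rw [pow_succ, ← mul_assoc, show k + l * ((i + 1 : ℕ) : ℤ) = (k + l * i) + l by push_cast; ring,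
      ModularForm.mul_slash_SL2, ih, pow_succ, mul_assoc]

/-- The automorphy factor `cz + d`. -/
def autJ (γ : SL(2, ℤ)) (z : ℍ) : ℂ := ((γ 1 0 : ℤ) : ℂ) * z + ((γ 1 1 : ℤ) : ℂ)

theorem autJ_eq (γ : SL(2, ℤ)) (z : ℍ) : autJ γ z = denom (toGLR (inclSL γ)) z :=
  (denom_inclSL γ z).symm

theorem autJ_ne_zero (γ : SL(2, ℤ)) (z : ℍ) : autJ γ z ≠ 0 := by
  rw [autJ_eq]
  exact denom_ne_zero _ z

theorem toGLR_inclSL_smul (γ : SL(2, ℤ)) (z : ℍ) : toGLR (inclSL γ) • z = γ • z := by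
  rw [toGLR_inclSL]
  rfl

theorem autJ_mul (γ δ : SL(2, ℤ)) (z : ℍ) : autJ (γ * δ) z = autJ γ (δ • z) * autJ δ z := by
  rw [autJ_eq, autJ_eq, autJ_eq, map_mul, denom_toGLR_mul, toGLR_inclSL_smul]

theorem SL_slash_apply' (f : ℍ → ℂ) (k : ℤ) (γ : SL(2, ℤ)) (z : ℍ) :
    (f ∣[k] γ) z = autJ γ z ^ (-k) * f (γ • z) := by
  rw [ModularForm.SL_slash_apply, ModularGroup.denom_apply, mul_comm, autJ]

theorem lowerRatio_inclSL' (γ : SL(2, ℤ)) (z : ℍ) :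
    lowerRatio (inclSL γ) z = ((γ 1 0 : ℤ) : ℂ) / autJ γ z := lowerRatio_inclSL γ z

/-- The cocycle relation solved for its first term. It turns an expansion in c/(cz+d) at δz into one
at z by an affine change of variable. -/
theorem lowerRatio_smul (γ δ : SL(2, ℤ)) (z : ℍ) :
    lowerRatio (inclSL γ) (δ • z) =
      autJ δ z ^ 2 * (lowerRatio (inclSL (γ * δ)) z - lowerRatio (inclSL δ) z) := by
  have h := congrFun (lowerRatio_mul (inclSL γ) (inclSL δ)) z
  rw [slash_inclSL, ← map_mul, Pi.add_apply, SL_slash_apply'] at h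
  have := autJ_ne_zero δ z
  rw [h, add_sub_cancel_right, ← mul_assoc, show (-((2 : ℕ) : ℤ)) = -2 by norm_num, zpow_neg,
    show (2 : ℤ) = ((2 : ℕ) : ℤ) by norm_num, zpow_natCast, mul_inv_cancel₀ (pow_ne_zero _ this),
    one_mul]

theorem IsModular.apply_smul {N : ℕ} {m : ℕ} {f : ℍ → ℂ} (hf : IsModular N m f) {γ : SL(2, ℤ)}
    (hγ : γ ∈ CongruenceSubgroup.Gamma N) (z : ℍ) : f (γ • z) = autJ γ z ^ m * f z := by
  have h := congrFun (hf.slash_eq γ hγ) z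
  rw [SL_slash_apply', zpow_neg, zpow_natCast] at h
  rw [← h, mul_inv_cancel_left₀ (pow_ne_zero _ (autJ_ne_zero γ z))]

/-- The form is polynomial in J = cz + d and c, so that J and c can later be treated as independent
variables. -/
theorem G2_smul (γ : SL(2, ℤ)) (z : ℍ) :
    G2 (γ • z) = autJ γ z * (autJ γ z * G2 z + kappa * ((γ 1 0 : ℤ) : ℂ)) := by
  have h := congrFun (G2_slash γ) z
  have hJ := autJ_ne_zero γ z
  rw [SL_slash_apply', zpow_neg, show (2 : ℤ) = ((2 : ℕ) : ℤ) by norm_num, zpow_natCast,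
    Pi.add_apply, Pi.smul_apply, smul_eq_mul, lowerRatio_inclSL'] at h
  rw [inv_mul_eq_iff_eq_mul₀ (pow_ne_zero _ hJ)] at h
  rw [h]
  field_simp

/-- The element `(1, nN; kN, 1 + kN·nN)` of `Γ(N)`. -/
def lowerElt (N k n : ℕ) : SL(2, ℤ) :=
  ⟨!![1, (n * N : ℤ); (k * N : ℤ), 1 + (k * N : ℤ) * (n * N)], by
    rw [Matrix.det_fin_two_of]; ring⟩

theorem lowerElt_mem (N k n : ℕ) : lowerElt N k n ∈ CongruenceSubgroup.Gamma N := by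
  rw [CongruenceSubgroup.Gamma_mem]
  simp [lowerElt]

theorem lowerElt_lower (N k n : ℕ) : ((lowerElt N k n 1 0 : ℤ) : ℂ) = k * N := by
  simp [lowerElt]

theorem autJ_lowerElt (N k n : ℕ) (z : ℍ) :
    autJ (lowerElt N k n) z = k * N * (z + n * N) + 1 := by
  simp only [autJ, lowerElt]
  simp
  ring

theorem polynomial_eq_zero_of_eval {P : Polynomial ℂ} {u : ℕ → ℂ} (hu : Function.Injective u)
    (h : ∀ n, P.eval (u n) = 0) : P = 0 :=
  Polynomial.eq_zero_of_infinite_isRoot P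
    (Set.infinite_of_injective_forall_mem hu fun n => h n)

/-- A family of numbers `a_{m,i}` with `∑ a_{m,i} T^{m+i} U^i = 0` for all `T`, `U` vanishes. -/
theorem coeff_eq_zero_of_forall {s : Finset (ℕ × ℕ)} {a : ℕ × ℕ → ℂ}
    (h : ∀ T U : ℂ, ∑ p ∈ s, a p * T ^ (p.1 + p.2) * U ^ p.2 = 0) : ∀ p ∈ s, a p = 0 := by
  intro q hq
  have h1 : ∀ T : ℂ, ∑ p ∈ s, (if q.2 = p.2 then a p * T ^ (p.1 + p.2) else 0) = 0 := by
    intro T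
    have hP : ∑ p ∈ s, Polynomial.C (a p * T ^ (p.1 + p.2)) * Polynomial.X ^ p.2 = 0 := by
      apply Polynomial.funext
      intro U
      rw [Polynomial.eval_finsetSum]
      simpa using h T U
    have := congrArg (fun P => Polynomial.coeff P q.2) hP
    simp only [Polynomial.finsetSum_coeff, Polynomial.coeff_C_mul, Polynomial.coeff_X_pow,
      Polynomial.coeff_zero, mul_ite, mul_one, mul_zero] at this
    exact this
  have hP : ∑ p ∈ s, Polynomial.C (if q.2 = p.2 then a p else 0) * Polynomial.X ^ (p.1 + p.2)
      = 0 := by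
    apply Polynomial.funext
    intro T
    rw [Polynomial.eval_finsetSum]
    simpa [ite_mul] using h1 T
  have h2 := congrArg (fun P => Polynomial.coeff P (q.1 + q.2)) hP
  simp only [Polynomial.finsetSum_coeff, Polynomial.coeff_C_mul, Polynomial.coeff_X_pow,
    Polynomial.coeff_zero] at h2
  rw [Finset.sum_eq_single q] at h2
  · simpa using h2
  · intro p _ hpq
    by_cases e : q.2 = p.2
    -- The exponents i and m + i together determine (m, i), so no other term of the family
    -- contributes.
    · have : q.1 + q.2 ≠ p.1 + p.2 := fun e' =>
        hpq (Prod.ext (add_right_cancel (e ▸ e')).symm e.symm)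
      rw [if_neg this, mul_zero]
    · rw [if_neg e, zero_mul]
  · exact fun h => absurd hq h

/-- The algebraic independence of `G₂` over the modular tower, and the linear independence of
modular forms of different weights. -/
theorem eq_zero_of_sum_mul_G2_pow {s : Finset (ℕ × ℕ)} {a : ℕ × ℕ → ℍ → ℂ} {N : ℕ} (hN : 1 ≤ N)
    (ha : ∀ p ∈ s, IsModular N p.1 (a p)) (h : ∑ p ∈ s, a p * G2 ^ p.2 = 0) :
    ∀ p ∈ s, a p = 0 := by
  have hN' : (N : ℂ) ≠ 0 := by exact_mod_cast (by omega : N ≠ 0)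
  have key : ∀ z : ℍ, ∀ p ∈ s, a p z = 0 := by
    intro z
    -- The relation is evaluated at γz for γ in Γ(N) with z fixed. It becomes a polynomial relation
    -- in J = cz + d and c whose coefficients are the numbers a_p(z).
    have h1 : ∀ k n : ℕ, ∑ p ∈ s, a p z * autJ (lowerElt N k n) z ^ (p.1 + p.2) *
        (autJ (lowerElt N k n) z * G2 z + kappa * (k * N)) ^ p.2 = 0 := by
      intro k n
      have := congrFun h (lowerElt N k n • z)
      rw [Finset.sum_apply] at this
      rw [← this.trans (Pi.zero_apply _)]
      apply Finset.sum_congr rfl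
      intro p hp
      rw [Pi.mul_apply, Pi.pow_apply, (ha p hp).apply_smul (lowerElt_mem N k n), G2_smul,
        lowerElt_lower, mul_pow, pow_add]
      ring
    -- With c fixed, J takes infinitely many values as n varies, so J may be replaced by a free
    -- variable T. The shift to k + 1 ensures c ≠ 0, without which J would be constant.
    have h2 : ∀ (k : ℕ) (T : ℂ), ∑ p ∈ s, a p z * T ^ (p.1 + p.2) *
        (G2 z * T + kappa * ((k + 1 : ℕ) * N)) ^ p.2 = 0 := by
      intro k T
      have hP : ∑ p ∈ s, Polynomial.C (a p z) * Polynomial.X ^ (p.1 + p.2) *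
          (Polynomial.C (G2 z) * Polynomial.X +
            Polynomial.C (kappa * ((k + 1 : ℕ) * N))) ^ p.2 = 0 := by
        apply polynomial_eq_zero_of_eval (u := fun n => autJ (lowerElt N (k + 1) n) z)
        · intro n n' e
          simp only [autJ_lowerElt] at e
          have hk : ((k + 1 : ℕ) : ℂ) ≠ 0 := by exact_mod_cast k.succ_ne_zero
          have e' := mul_left_cancel₀ (mul_ne_zero hk hN') (add_right_cancel e)
          have e'' := mul_right_cancel₀ hN' (add_left_cancel e')
          exact_mod_cast e''
        · intro n
          rw [Polynomial.eval_finsetSum]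
          simpa [mul_comm (G2 z)] using h1 (k + 1) n
      have := congrArg (Polynomial.eval T) hP
      rw [Polynomial.eval_finsetSum] at this
      simpa using this
    apply coeff_eq_zero_of_forall
    intro T U
    have hP : ∑ p ∈ s, Polynomial.C (a p z * T ^ (p.1 + p.2)) *
        (Polynomial.C (G2 z * T) + Polynomial.C kappa * Polynomial.X) ^ p.2 = 0 := by
      apply polynomial_eq_zero_of_eval (u := fun k : ℕ => ((k + 1 : ℕ) : ℂ) * N)
      · intro k k' e
        have e' := mul_right_cancel₀ hN' e
        have : k + 1 = k' + 1 := by exact_mod_cast e'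
        omega
      · intro k
        rw [Polynomial.eval_finsetSum]
        simpa using h2 k T
    -- Now c has become a free variable too. This value makes G₂(z)T + κc equal to U, which
    -- decouples the two variables.
    have := congrArg (Polynomial.eval ((U - G2 z * T) / kappa)) hP
    rw [Polynomial.eval_finsetSum] at this
    have hκ := kappa_ne_zero
    simpa [mul_div_cancel₀ _ hκ] using this
  intro p hp
  ext z
  exact key z p hp

/-! ### Uniqueness of the coefficients -/

theorem applyCoeffs_of (T : ∀ m : ℕ, modTower m →ₗ[ℂ] (ℍ → ℂ)) (p : ℕ × ℕ) (a : modTower p.1) :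
    applyCoeffs T (DirectSum.lof ℂ (ℕ × ℕ) (fun p => modTower p.1) p a) = T p.1 a * G2 ^ p.2 := by
  rw [applyCoeffs, DirectSum.toModule_lof]
  rfl

theorem expand_of (p : ℕ × ℕ) (a : modTower p.1) :
    expand (DirectSum.lof ℂ (ℕ × ℕ) (fun p => modTower p.1) p a) = (a : ℍ → ℂ) * G2 ^ p.2 :=
  applyCoeffs_of _ p a

theorem exists_common_level {s : Finset (ℕ × ℕ)} {a : ℕ × ℕ → ℍ → ℂ}
    (ha : ∀ p ∈ s, a p ∈ modTower p.1) : ∃ N, 1 ≤ N ∧ ∀ p ∈ s, IsModular N p.1 (a p) := by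
  classical
  induction s using Finset.induction_on with
  | empty => exact ⟨1, le_rfl, by simp⟩
  | insert q s _ ih =>
    obtain ⟨M, hM, h⟩ := ih fun p hp => ha p (Finset.mem_insert_of_mem hp)
    obtain ⟨N, hN, h'⟩ := mem_modTower_iff.1 (ha q (Finset.mem_insert_self _ _))
    refine ⟨M * N, Nat.mul_pos hM hN, fun p hp => ?_⟩
    rcases Finset.mem_insert.1 hp with rfl | hp
    · exact h'.of_dvd (dvd_mul_left _ _)
    · exact (h p hp).of_dvd (dvd_mul_right _ _)

theorem expand_eq_zero {x : Coeffs} (hx : expand x = 0) : x = 0 := by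
  classical
  have e := DirectSum.sum_support_of x
  rw [← e, map_sum] at hx
  have hx' : ∑ p ∈ DFinsupp.support x, ((x p : modTower p.1) : ℍ → ℂ) * G2 ^ p.2 = 0 := by
    rw [← hx]
    exact Finset.sum_congr rfl fun p _ => (expand_of p (x p)).symm
  obtain ⟨N, hN, h⟩ := exists_common_level (s := DFinsupp.support x)
    (a := fun p => ((x p : modTower p.1) : ℍ → ℂ)) fun p _ => (x p).2
  have h0 := eq_zero_of_sum_mul_G2_pow hN h hx'
  apply DFinsupp.ext
  intro p
  by_cases hp : p ∈ DFinsupp.support x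
  · exact Subtype.ext (h0 p hp)
  · simpa using hp

theorem coeffs_expand (x : Coeffs) : coeffs (expand x) = x := by
  refine LinearMap.leftInverse_apply_of_inj (K := ℂ) (V := Coeffs) (V' := ℍ → ℂ) (f := expand)
    ?_ x
  exact (Submodule.eq_bot_iff _).2 fun x hx => expand_eq_zero hx

/-- The components of a quasimodular form of weight `k` and depth at most `s`. -/
structure IsComponents (N k s : ℕ) (f : ℍ → ℂ) (F : ℕ → ℍ → ℂ) : Prop where
  holo : ∀ j ≤ s, MDiff (F j)
  bdd : ∀ j ≤ s, ∀ γ : SL(2, ℤ), IsBoundedAtImInfty (F j ∣[(k : ℤ) - 2 * j] γ)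
  apply_smul : ∀ γ ∈ CongruenceSubgroup.Gamma N, ∀ z : ℍ, autJ γ z ^ (-(k : ℤ)) * f (γ • z) =
    ∑ j ∈ Finset.range (s + 1), F j z * lowerRatio (inclSL γ) z ^ j

/-- For γ and δ in Γ(N), f(γz) can be expanded at z, or at δz using γδ⁻¹. As γ varies, x = c/(cz+d)
takes infinitely many values, so this is an identity of polynomials in x. The second expansion is
one in (cz+d)_δ²·(x - x_δ), and comparing coefficients of x^s gives weight k - 2s for f_s. -/
theorem IsComponents.isModular_top {N k s : ℕ} (hN : 1 ≤ N) {f : ℍ → ℂ} {F : ℕ → ℍ → ℂ}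
    (h : IsComponents N k s f F) : IsModular N ((k : ℤ) - 2 * s) (F s) := by
  refine ⟨h.holo s le_rfl, fun δ hδ => ?_, h.bdd s le_rfl⟩
  ext z
  have hN' : (N : ℂ) ≠ 0 := by exact_mod_cast (by omega : N ≠ 0)
  have hJ := autJ_ne_zero δ z
  have hP : ∑ j ∈ Finset.range (s + 1), Polynomial.C (F j z) * Polynomial.X ^ j
      - ∑ j ∈ Finset.range (s + 1), Polynomial.C (autJ δ z ^ (-(k : ℤ)) * F j (δ • z) *
          (autJ δ z ^ 2) ^ j) * (Polynomial.X - Polynomial.C (lowerRatio (inclSL δ) z)) ^ j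
      = 0 := by
    apply polynomial_eq_zero_of_eval (u := fun n => lowerRatio (inclSL (lowerElt N 1 n)) z)
    · intro n n' e
      simp only [lowerRatio_inclSL', lowerElt_lower] at e
      have h1 := autJ_ne_zero (lowerElt N 1 n) z
      have h2 := autJ_ne_zero (lowerElt N 1 n') z
      have hk : ((1 : ℕ) : ℂ) ≠ 0 := by norm_num
      rw [div_eq_div_iff h1 h2] at e
      have e := mul_left_cancel₀ (mul_ne_zero hk hN') e
      simp only [autJ_lowerElt] at e
      have e' := mul_left_cancel₀ (mul_ne_zero hk hN') (add_right_cancel e)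
      have e'' := mul_right_cancel₀ hN' (add_left_cancel e')
      exact_mod_cast e''.symm
    · intro n
      have h1 := h.apply_smul (lowerElt N 1 n) (lowerElt_mem N 1 n) z
      have h2 := h.apply_smul (lowerElt N 1 n * δ⁻¹)
        (mul_mem (lowerElt_mem N 1 n) (inv_mem hδ)) (δ • z)
      rw [smul_smul, inv_mul_cancel_right] at h2
      have hm := autJ_mul (lowerElt N 1 n * δ⁻¹) δ z
      rw [inv_mul_cancel_right] at hm
      rw [hm, mul_zpow, mul_comm (autJ _ _ ^ (-(k : ℤ))), mul_assoc, h2, Finset.mul_sum] at h1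
      simp only [Polynomial.eval_sub, Polynomial.eval_finsetSum, Polynomial.eval_mul,
        Polynomial.eval_pow, Polynomial.eval_C, Polynomial.eval_X]
      rw [← h1, sub_eq_zero]
      apply Finset.sum_congr rfl
      intro j _
      rw [lowerRatio_smul, inv_mul_cancel_right, mul_pow]
      ring
  have hc := congrArg (fun P => Polynomial.coeff P s) hP
  simp only [Polynomial.coeff_sub, Polynomial.finsetSum_coeff, Polynomial.coeff_C_mul,
    Polynomial.coeff_zero, Polynomial.coeff_X_pow] at hc
  rw [Finset.sum_eq_single s, Finset.sum_eq_single s] at hc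
  · have hmon : (((Polynomial.X : Polynomial ℂ)
        - Polynomial.C (lowerRatio (inclSL δ) z)) ^ s).coeff s = 1 := by
      have h1 := (Polynomial.monic_X_sub_C (lowerRatio (inclSL δ) z)).pow s
      have h2 : (((Polynomial.X : Polynomial ℂ)
        - Polynomial.C (lowerRatio (inclSL δ) z)) ^ s).natDegree = s := by simp
      rw [Polynomial.Monic, Polynomial.leadingCoeff, h2] at h1
      exact h1
    rw [hmon, if_pos rfl, mul_one, mul_one, sub_eq_zero] at hc
    rw [SL_slash_apply', hc, neg_sub, sub_eq_add_neg, zpow_add₀ hJ, ← pow_mul]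
    rw [show (2 * (s : ℤ)) = ((2 * s : ℕ) : ℤ) by push_cast; ring, zpow_natCast]
    ring
  · intro j hj hjs
    rw [Polynomial.coeff_eq_zero_of_natDegree_lt, mul_zero]
    rw [Polynomial.natDegree_pow, Polynomial.natDegree_X_sub_C, mul_one]
    have := Finset.mem_range.1 hj
    omega
  · simp
  · intro j _ hjs
    rw [if_neg (Ne.symm hjs), mul_zero]
  · simp

/-- The components are the terms of the binomial expansion of (G₂ + κ·c/(cz+d))^i. -/
theorem isComponents_mul_G2_pow {N m : ℕ} {a : ℍ → ℂ} (ha : IsModular N m a) (i : ℕ) :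
    IsComponents N (m + 2 * i) i (a * G2 ^ i)
      (fun j => ((i.choose j : ℂ) * kappa ^ j) • (a * G2 ^ (i - j))) := by
  refine ⟨fun j _ => ((ha.holo.mul (G2_mdifferentiable.pow _))).const_smul _,
    fun j hj γ => ?_, fun γ hγ z => ?_⟩
  · have e : (((m + 2 * i : ℕ) : ℤ) - 2 * j) = (m : ℤ) + 2 * ((i - j : ℕ) : ℤ) := by
      push_cast [Nat.cast_sub hj]
      ring
    rw [ModularForm.SL_smul_slash, e, mul_pow_slash, G2_slash]
    refine Filter.BoundedAtFilter.smul _ ((ha.bdd γ).mul ?_)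
    have hb : IsBoundedAtImInfty (G2 + kappa • lowerRatio (inclSL γ)) :=
      G2_isBoundedAtImInfty.add ((lowerRatio_isBoundedAtImInfty _).smul _)
    induction i - j with
    | zero => rw [pow_zero]; exact Filter.const_boundedAtFilter _ 1
    | succ n ih => rw [pow_succ]; exact ih.mul hb
  · have hJ := autJ_ne_zero γ z
    rw [Pi.mul_apply, Pi.pow_apply, ha.apply_smul hγ, G2_smul]
    have e : autJ γ z * (autJ γ z * G2 z + kappa * ((γ 1 0 : ℤ) : ℂ))
        = autJ γ z ^ 2 * (kappa * lowerRatio (inclSL γ) z + G2 z) := by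
      rw [lowerRatio_inclSL']
      field_simp
      ring
    rw [e, mul_pow, add_pow, ← pow_mul, zpow_neg, zpow_natCast, pow_add]
    rw [show (autJ γ z ^ m * autJ γ z ^ (2 * i))⁻¹ * (autJ γ z ^ m * a z * (autJ γ z ^ (2 * i) *
      ∑ j ∈ Finset.range (i + 1), (kappa * lowerRatio (inclSL γ) z) ^ j * G2 z ^ (i - j) *
        (i.choose j : ℂ))) = a z * ∑ j ∈ Finset.range (i + 1),
        (kappa * lowerRatio (inclSL γ) z) ^ j * G2 z ^ (i - j) * (i.choose j : ℂ) by field_simp,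
      Finset.mul_sum]
    apply Finset.sum_congr rfl
    intro j _
    simp only [Pi.smul_apply, Pi.mul_apply, Pi.pow_apply, smul_eq_mul, mul_pow]
    ring

/-- The products `a G₂^i` of a modular form of weight `m` and a power of `G₂`. -/
def monomials : Set (ℍ → ℂ) := {f | ∃ m i : ℕ, ∃ a ∈ modTower m, f = a * G2 ^ i}

/-- Descent on the depth: f_s is modular, and subtracting κ^{-s}·f_s·G₂^s removes it. `IsComponents`
allows a vanishing top component, so the remainder is again of the required kind. In depth 0, the
transformation law at γ = 1 gives f = f₀. -/
theorem IsComponents.mem_span {N k s : ℕ} (hN : 1 ≤ N) {f : ℍ → ℂ} {F : ℕ → ℍ → ℂ}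
    (h : IsComponents N k s f F) : f ∈ Submodule.span ℂ monomials := by
  induction s generalizing f F with
  | zero =>
    have h1 := h.isModular_top hN
    have e : f = F 0 := by
      ext z
      have := h.apply_smul 1 (one_mem _) z
      simpa [autJ] using this
    rw [e]
    apply Submodule.subset_span
    refine ⟨k, 0, F 0, mem_modTower_iff.2 ⟨N, hN, ?_⟩, by simp⟩
    simpa using h1
  | succ s ih =>
    have h1 := h.isModular_top hN
    by_cases hk : (k : ℤ) - 2 * (s + 1 : ℕ) < 0
    · have h0 := isModular_eq_zero_of_neg hN hk h1
      refine ih ⟨fun j hj => h.holo j (by omega), fun j hj => h.bdd j (by omega),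
        fun γ hγ z => ?_⟩
      rw [h.apply_smul γ hγ z, Finset.sum_range_succ, h0]
      simp
    · obtain ⟨m, rfl⟩ : ∃ m, k = m + 2 * (s + 1) := ⟨k - 2 * (s + 1), by omega⟩
      have h2 : IsModular N m ((kappa ^ (s + 1))⁻¹ • F (s + 1)) := by
        have e : (((m + 2 * (s + 1) : ℕ) : ℤ) - 2 * (s + 1 : ℕ)) = (m : ℤ) := by
          push_cast
          ring
        rw [e] at h1
        exact h1.smul _
      set a := (kappa ^ (s + 1))⁻¹ • F (s + 1) with ha
      have h3 := isComponents_mul_G2_pow h2 (s + 1)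
      have h4 : f - a * G2 ^ (s + 1) ∈ Submodule.span ℂ monomials := by
        refine ih (F := fun j => F j - (((s + 1).choose j : ℂ) * kappa ^ j) •
          (a * G2 ^ (s + 1 - j))) ⟨fun j hj => (h.holo j (by omega)).sub (h3.holo j (by omega)),
          fun j hj γ => ?_, fun γ hγ z => ?_⟩
        · rw [sub_eq_add_neg (F j), SlashAction.add_slash, SlashAction.neg_slash]
          exact (h.bdd j (by omega) γ).add (h3.bdd j (by omega) γ).neg
        · have e1 := h.apply_smul γ hγ z
          have e2 := h3.apply_smul γ hγ z
          rw [Finset.sum_range_succ] at e1 e2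
          -- The power of κ in the definition of a is chosen so that the top component of a·G₂^{s+1}
          -- is that of f.
          have e3 : (((s + 1).choose (s + 1) : ℂ) * kappa ^ (s + 1)) •
              (a * G2 ^ (s + 1 - (s + 1))) = F (s + 1) := by
            rw [ha, Nat.choose_self, Nat.cast_one, one_mul, Nat.sub_self, pow_zero, mul_one,
              smul_smul, mul_inv_cancel₀ (pow_ne_zero _ kappa_ne_zero), one_smul]
          rw [e3] at e2
          rw [Pi.sub_apply, mul_sub, e1, e2, add_sub_add_right_eq_sub, ← Finset.sum_sub_distrib]
          apply Finset.sum_congr rfl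
          intro j _
          rw [Pi.sub_apply, sub_mul]
      have := Submodule.add_mem _ h4 (Submodule.subset_span
        (show a * G2 ^ (s + 1) ∈ monomials from
          ⟨m, s + 1, a, mem_modTower_iff.2 ⟨N, hN, h2⟩, rfl⟩))
      rwa [sub_add_cancel] at this

/-- The structure theorem: `𝒬ℳ` is spanned by the products `a G₂^i` with `a` modular. -/
theorem QM_eq_span : QM = Submodule.span ℂ monomials := by
  apply le_antisymm
  · rw [QM, Submodule.span_le]
    rintro f ⟨N, k, s, hN, ⟨rfl, -⟩ | ⟨-, F, hF, -, h⟩⟩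
    · exact zero_mem _
    · exact IsComponents.mem_span hN (F := F) (s := s) (k := k)
        ⟨fun j hj => (hF j hj).1, fun j hj => (hF j hj).2, fun γ hγ z => by
          simp only [lowerRatio_inclSL]
          exact h γ hγ z⟩
  · rw [Submodule.span_le]
    rintro _ ⟨m, i, a, ha, rfl⟩
    obtain ⟨N, hN, ha⟩ := mem_modTower_iff.1 ha
    apply Submodule.subset_span
    -- The top component κ^i·a must be nonzero, so the zero function needs the separate clause of
    -- `IsQuasimodular`.
    by_cases h0 : a = 0
    · exact ⟨N, 0, 0, hN, Or.inl ⟨by rw [h0, zero_mul], rfl⟩⟩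
    · have h := isComponents_mul_G2_pow ha i
      refine ⟨N, m + 2 * i, i, hN, Or.inr ⟨ha.holo.mul (G2_mdifferentiable.pow _), _,
        fun j hj => ⟨h.holo j hj, h.bdd j hj⟩, ?_, fun γ hγ z => ?_⟩⟩
      · rw [Nat.choose_self, Nat.sub_self, pow_zero, mul_one, Nat.cast_one, one_mul]
        exact smul_ne_zero (pow_ne_zero _ kappa_ne_zero) h0
      · have := h.apply_smul γ hγ z
        simp only [lowerRatio_inclSL] at this
        exact this

end QMHecke
end

noncomputable section

namespace QMHecke

open UpperHalfPlane Derivative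

/-! ### The operators on `𝒬ℳ` -/

theorem monomial_mem_QM {m : ℕ} {a : ℍ → ℂ} (ha : a ∈ modTower m) (i : ℕ) :
    a * G2 ^ i ∈ QM := by
  rw [QM_eq_span]
  exact Submodule.subset_span ⟨m, i, a, ha, rfl⟩

theorem modTower_le_QM (m : ℕ) : modTower m ≤ QM := fun a ha => by
  simpa using monomial_mem_QM ha 0

/-- Linear maps on `𝒬ℳ` are determined by their values on the products `a G₂^i`. -/
theorem QM_ext {S T : (ℍ → ℂ) →ₗ[ℂ] (ℍ → ℂ)}
    (h : ∀ (m i : ℕ) (a : ℍ → ℂ), a ∈ modTower m → S (a * G2 ^ i) = T (a * G2 ^ i))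
    {f : ℍ → ℂ} (hf : f ∈ QM) : S f = T f := by
  rw [QM_eq_span] at hf
  refine LinearMap.eqOn_span (s := monomials) ?_ hf
  rintro _ ⟨m, i, a, ha, rfl⟩
  exact h m i a ha

theorem QM_map_mem {T : (ℍ → ℂ) →ₗ[ℂ] (ℍ → ℂ)}
    (h : ∀ (m i : ℕ) (a : ℍ → ℂ), a ∈ modTower m → T (a * G2 ^ i) ∈ QM)
    {f : ℍ → ℂ} (hf : f ∈ QM) : T f ∈ QM := by
  have : QM ≤ QM.comap T := by
    conv_lhs => rw [QM_eq_span]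
    rw [Submodule.span_le]
    rintro _ ⟨m, i, a, ha, rfl⟩
    exact h m i a ha
  exact this hf

theorem monomial_mul (a b : ℍ → ℂ) (i j : ℕ) :
    (a * G2 ^ i) * (b * G2 ^ j) = (a * b) * G2 ^ (i + j) := by
  rw [pow_add]
  ring

theorem QM_mul {f g : ℍ → ℂ} (hf : f ∈ QM) (hg : g ∈ QM) : f * g ∈ QM := by
  refine QM_map_mem (T := LinearMap.mulRight ℂ g) (fun m i a ha => ?_) hf
  refine QM_map_mem (T := LinearMap.mulLeft ℂ (a * G2 ^ i)) (fun n j b hb => ?_) hg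
  rw [LinearMap.mulLeft_apply, monomial_mul]
  exact monomial_mem_QM (modTower_mul ha hb) _

theorem one_mem_QM : (1 : ℍ → ℂ) ∈ QM := modTower_le_QM 0 one_mem_modTower

/-- Uniqueness of coefficients enters here: `coeffs` recovers the single coefficient a in position
(m, i). All later computations with X, Y and ‖α rest on this. -/
theorem applyCoeffs_coeffs_monomial (T : ∀ m : ℕ, modTower m →ₗ[ℂ] (ℍ → ℂ)) {m : ℕ} (i : ℕ)
    {a : ℍ → ℂ} (ha : a ∈ modTower m) :
    applyCoeffs T (coeffs (a * G2 ^ i)) = T m ⟨a, ha⟩ * G2 ^ i := by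
  have h := expand_of (m, i) ⟨a, ha⟩
  have h' := applyCoeffs_of T (m, i) ⟨a, ha⟩
  rw [← h', ← coeffs_expand (DirectSum.lof ℂ (ℕ × ℕ) (fun p => modTower p.1) (m, i) ⟨a, ha⟩), h]

section monomials

variable {m : ℕ} (i : ℕ) {a : ℍ → ℂ} (ha : a ∈ modTower m)
include ha

theorem opX_monomial : opX (a * G2 ^ i) = serreDerivative m a * G2 ^ i := by
  rw [opX, LinearMap.comp_apply, applyCoeffs_coeffs_monomial modX i ha, modX_eq]

theorem opY_monomial : opY (a * G2 ^ i) = ((m : ℂ) / 2) • (a * G2 ^ i) := by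
  rw [opY, LinearMap.comp_apply, applyCoeffs_coeffs_monomial modY i ha, ← smul_mul_assoc]
  rfl

theorem qslash_monomial (α : Matrix.GLPos (Fin 2) ℚ) :
    qslash α (a * G2 ^ i) = slash m α a * G2 ^ i := by
  rw [qslash, LinearMap.comp_apply, applyCoeffs_coeffs_monomial _ i ha]
  rfl

theorem serreDerivative_mem : serreDerivative m a ∈ modTower (m + 2) := by
  rw [← modX_eq m ⟨a, ha⟩]
  exact modX_mem m ⟨a, ha⟩

theorem opY_of_mem : opY a = ((m : ℂ) / 2) • a := by
  simpa using opY_monomial 0 ha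

theorem qslash_of_mem (α : Matrix.GLPos (Fin 2) ℚ) : qslash α a = slash m α a := by
  simpa using qslash_monomial 0 ha α

end monomials

variable {f g : ℍ → ℂ}

theorem opX_mem (hf : f ∈ QM) : opX f ∈ QM :=
  QM_map_mem (fun m i a ha => by
    rw [opX_monomial i ha]
    exact monomial_mem_QM (serreDerivative_mem ha) i) hf

theorem opY_mem (hf : f ∈ QM) : opY f ∈ QM :=
  QM_map_mem (fun m i a ha => by
    rw [opY_monomial i ha]
    exact QM.smul_mem _ (monomial_mem_QM ha i)) hf

theorem qslash_mem (α : Matrix.GLPos (Fin 2) ℚ) (hf : f ∈ QM) : qslash α f ∈ QM :=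
  QM_map_mem (fun m i a ha => by
    rw [qslash_monomial i ha]
    exact monomial_mem_QM (slash_mem_modTower α ha) i) hf

theorem qslash_mul (α : Matrix.GLPos (Fin 2) ℚ) (hf : f ∈ QM) (hg : g ∈ QM) :
    qslash α (f * g) = qslash α f * qslash α g := by
  refine QM_ext (S := qslash α ∘ₗ LinearMap.mulRight ℂ g)
    (T := LinearMap.mulRight ℂ (qslash α g) ∘ₗ qslash α) (fun m i a ha => ?_) hf
  refine QM_ext (S := qslash α ∘ₗ LinearMap.mulLeft ℂ (a * G2 ^ i))
    (T := LinearMap.mulLeft ℂ (qslash α (a * G2 ^ i)) ∘ₗ qslash α) (fun n j b hb => ?_) hg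
  simp only [LinearMap.comp_apply, LinearMap.mulLeft_apply]
  rw [monomial_mul, qslash_monomial _ (modTower_mul ha hb), qslash_monomial _ ha,
    qslash_monomial _ hb, slash_mul, monomial_mul]

theorem qslash_qslash (α β : Matrix.GLPos (Fin 2) ℚ) (hf : f ∈ QM) :
    qslash β (qslash α f) = qslash (α * β) f := by
  refine QM_ext (S := qslash β ∘ₗ qslash α) (fun m i a ha => ?_) hf
  rw [LinearMap.comp_apply, qslash_monomial _ ha, qslash_monomial _ ha,
    qslash_monomial _ (slash_mem_modTower α ha), slash_slash]

theorem qslash_one (hf : f ∈ QM) : qslash 1 f = f := by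
  refine QM_ext (T := LinearMap.id) (fun m i a ha => ?_) hf
  rw [qslash_monomial _ ha, slash_one, LinearMap.id_apply]

theorem qslash_apply_one (α : Matrix.GLPos (Fin 2) ℚ) : qslash α 1 = 1 := by
  rw [qslash_of_mem one_mem_modTower]
  ext z
  simp [slash_apply]

/-- The Serre derivatives of weights m, n and m + n satisfy a common Leibniz rule, and powers of G₂
pass through as constants. -/
theorem opX_mul (hf : f ∈ QM) (hg : g ∈ QM) : opX (f * g) = opX f * g + f * opX g := by
  refine QM_ext (S := opX ∘ₗ LinearMap.mulRight ℂ g)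
    (T := LinearMap.mulRight ℂ g ∘ₗ opX + LinearMap.mulRight ℂ (opX g)) (fun m i a ha => ?_) hf
  refine QM_ext (S := opX ∘ₗ LinearMap.mulLeft ℂ (a * G2 ^ i))
    (T := LinearMap.mulLeft ℂ (opX (a * G2 ^ i)) + LinearMap.mulLeft ℂ (a * G2 ^ i) ∘ₗ opX)
    (fun n j b hb => ?_) hg
  simp only [LinearMap.comp_apply, LinearMap.add_apply, LinearMap.mulLeft_apply]
  rw [monomial_mul, opX_monomial _ (modTower_mul ha hb), opX_monomial _ ha, opX_monomial _ hb,
    Nat.cast_add, serreDerivative_mul _ _ _ _ (modTower_mdifferentiable ha)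
      (modTower_mdifferentiable hb), monomial_mul, monomial_mul, add_mul]

theorem opY_mul (hf : f ∈ QM) (hg : g ∈ QM) : opY (f * g) = opY f * g + f * opY g := by
  refine QM_ext (S := opY ∘ₗ LinearMap.mulRight ℂ g)
    (T := LinearMap.mulRight ℂ g ∘ₗ opY + LinearMap.mulRight ℂ (opY g)) (fun m i a ha => ?_) hf
  refine QM_ext (S := opY ∘ₗ LinearMap.mulLeft ℂ (a * G2 ^ i))
    (T := LinearMap.mulLeft ℂ (opY (a * G2 ^ i)) + LinearMap.mulLeft ℂ (a * G2 ^ i) ∘ₗ opY)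
    (fun n j b hb => ?_) hg
  simp only [LinearMap.comp_apply, LinearMap.add_apply, LinearMap.mulLeft_apply]
  rw [monomial_mul, opY_monomial _ (modTower_mul ha hb), opY_monomial _ ha, opY_monomial _ hb,
    smul_mul_assoc, mul_smul_comm, monomial_mul, ← add_smul, Nat.cast_add, add_div]

theorem opY_opX (hf : f ∈ QM) : opY (opX f) = opX (opY f) + opX f := by
  refine QM_ext (S := opY ∘ₗ opX) (T := opX ∘ₗ opY + opX) (fun m i a ha => ?_) hf
  simp only [LinearMap.comp_apply, LinearMap.add_apply]
  rw [opX_monomial _ ha, opY_monomial _ ha, opY_monomial _ (serreDerivative_mem ha), map_smul,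
    opX_monomial _ ha, Nat.cast_add, add_div, add_smul]
  norm_num

theorem opY_qslash (α : Matrix.GLPos (Fin 2) ℚ) (hf : f ∈ QM) :
    opY (qslash α f) = qslash α (opY f) := by
  refine QM_ext (S := opY ∘ₗ qslash α) (T := qslash α ∘ₗ opY) (fun m i a ha => ?_) hf
  simp only [LinearMap.comp_apply]
  rw [qslash_monomial _ ha, opY_monomial _ ha, opY_monomial _ (slash_mem_modTower α ha), map_smul,
    qslash_monomial _ ha]

/-- The source of the term δ₁ ⊗ Y in the coproduct of X. -/
theorem opX_qslash (α : Matrix.GLPos (Fin 2) ℚ) (hf : f ∈ QM) :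
    opX (qslash α f) = qslash α (opX f) + mu α * qslash α (opY f) := by
  refine QM_ext (S := opX ∘ₗ qslash α)
    (T := qslash α ∘ₗ opX + LinearMap.mulLeft ℂ (mu α) ∘ₗ qslash α ∘ₗ opY)
    (fun m i a ha => ?_) hf
  simp only [LinearMap.comp_apply, LinearMap.add_apply, LinearMap.mulLeft_apply]
  rw [qslash_monomial _ ha, opX_monomial _ ha, opX_monomial _ (slash_mem_modTower α ha),
    opY_monomial _ ha, map_smul, qslash_monomial _ ha,
    qslash_monomial _ (serreDerivative_mem ha),
    serreDerivative_slash _ _ (modTower_mdifferentiable ha), add_mul, mul_smul_comm,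
    smul_mul_assoc, mul_assoc]

theorem opX_qslash_inclSL (γ : SL(2, ℤ)) (hf : f ∈ QM) :
    opX (qslash (inclSL γ) f) = qslash (inclSL γ) (opX f) := by
  rw [opX_qslash _ hf, mu_inclSL, zero_mul, add_zero]

theorem opX_one : opX 1 = 0 := by
  have h := opX_mul one_mem_QM one_mem_QM
  rw [mul_one, one_mul, mul_one] at h
  exact left_eq_add.1 h

theorem opY_one : opY 1 = 0 := by
  rw [opY_of_mem one_mem_modTower]
  simp

/-! ### The multipliers X^n(μ_α) -/

theorem mu_mem_QM (α : Matrix.GLPos (Fin 2) ℚ) : mu α ∈ QM :=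
  modTower_le_QM 2 (mu_mem_modTower α)

theorem qslash_mu (α β : Matrix.GLPos (Fin 2) ℚ) : mu (α * β) = qslash β (mu α) + mu β := by
  rw [mu_mul, qslash_of_mem (mu_mem_modTower α)]

/-- The functions `X^n(μ_α)`. -/
def muIter (n : ℕ) (α : Matrix.GLPos (Fin 2) ℚ) : ℍ → ℂ := (opX ^ n) (mu α)

theorem muIter_zero (α : Matrix.GLPos (Fin 2) ℚ) : muIter 0 α = mu α := rfl

theorem muIter_succ (n : ℕ) (α : Matrix.GLPos (Fin 2) ℚ) : muIter (n + 1) α = opX (muIter n α) := by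
  rw [muIter, pow_succ']
  rfl

theorem muIter_mem (n : ℕ) (α : Matrix.GLPos (Fin 2) ℚ) : muIter n α ∈ QM := by
  induction n with
  | zero => exact mu_mem_QM α
  | succ n ih => rw [muIter_succ]; exact opX_mem ih

theorem muIter_inclSL_mul (n : ℕ) (γ : SL(2, ℤ)) (α : Matrix.GLPos (Fin 2) ℚ) :
    muIter n (inclSL γ * α) = muIter n α := by
  rw [muIter, muIter, mu_mul, mu_inclSL, map_zero, zero_add]

theorem muIter_mul_inclSL (n : ℕ) (α : Matrix.GLPos (Fin 2) ℚ) (γ : SL(2, ℤ)) :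
    muIter n (α * inclSL γ) = qslash (inclSL γ) (muIter n α) := by
  induction n with
  | zero => rw [muIter_zero, muIter_zero, qslash_mu, mu_inclSL, add_zero]
  | succ n ih => rw [muIter_succ, muIter_succ, ih, opX_qslash_inclSL _ (muIter_mem n α)]

/-- X^n(μ_α) has weight 2n + 2, and Y is half the weight. -/
theorem opY_muIter (n : ℕ) (α : Matrix.GLPos (Fin 2) ℚ) :
    opY (muIter n α) = ((n + 1 : ℕ) : ℂ) • muIter n α := by
  induction n with
  | zero => rw [muIter_zero, opY_of_mem (mu_mem_modTower α)]; norm_num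
  | succ n ih =>
    rw [muIter_succ, opY_opX (muIter_mem n α), ih, map_smul, Nat.cast_succ (n + 1), add_smul,
      one_smul]

end QMHecke
end

noncomputable section

namespace QMHecke

open UpperHalfPlane Derivative

/-! ### Sums over right cosets -/

section CosetSum

variable {H : Type} [Group H] {Γ : Subgroup H}

theorem apply_out_mk {M : Type} {φ : H → M} (hφ : ∀ γ ∈ Γ, ∀ h, φ (γ * h) = φ h) (h : H) :
    φ (Quotient.mk (QuotientGroup.rightRel Γ) h).out = φ h := by
  have h1 : (QuotientGroup.rightRel Γ) (Quotient.mk (QuotientGroup.rightRel Γ) h).out h :=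
    Quotient.mk_out h
  rw [QuotientGroup.rightRel_apply] at h1
  have := hφ _ h1 (Quotient.mk (QuotientGroup.rightRel Γ) h).out
  rw [inv_mul_cancel_right] at this
  exact this.symm

/-- Right multiplication on `Γ \ H`. -/
def cosetMulRight (Γ : Subgroup H) (h : H) :
    Quotient (QuotientGroup.rightRel Γ) ≃ Quotient (QuotientGroup.rightRel Γ) :=
  Quotient.congr (Equiv.mulRight h) fun a b => by
    change (QuotientGroup.rightRel Γ) a b ↔ (QuotientGroup.rightRel Γ) (a * h) (b * h)
    rw [QuotientGroup.rightRel_apply, QuotientGroup.rightRel_apply]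
    simp [mul_assoc]

theorem apply_out_cosetMulRight {M : Type} {φ : H → M} (hφ : ∀ γ ∈ Γ, ∀ h, φ (γ * h) = φ h)
    (h : H) (q : Quotient (QuotientGroup.rightRel Γ)) :
    φ (cosetMulRight Γ h q).out = φ (q.out * h) := by
  have : cosetMulRight Γ h q = Quotient.mk (QuotientGroup.rightRel Γ) (q.out * h) := by
    conv_lhs => rw [← Quotient.out_eq q]
    rfl
  rw [this, apply_out_mk hφ]

/-- Right translation permutes Γ\H, and left invariance of φ makes the chosen representatives
irrelevant. -/
theorem finsum_out_mul_right {M : Type} [AddCommMonoid M] {φ : H → M}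
    (hφ : ∀ γ ∈ Γ, ∀ h, φ (γ * h) = φ h) (h : H) :
    ∑ᶠ q : Quotient (QuotientGroup.rightRel Γ), φ (q.out * h)
      = ∑ᶠ q : Quotient (QuotientGroup.rightRel Γ), φ q.out := by
  rw [← finsum_comp_equiv (cosetMulRight Γ h) (f := fun q => φ q.out)]
  exact finsum_congr fun q => (apply_out_cosetMulRight hφ h q).symm

theorem finite_support_out_of_mul_right {M : Type} [Zero M] {φ : H → M}
    (hφ : ∀ γ ∈ Γ, ∀ h, φ (γ * h) = φ h) (h : H)
    (hf : (Function.support fun q : Quotient (QuotientGroup.rightRel Γ) => φ (q.out * h)).Finite) :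
    (Function.support fun q : Quotient (QuotientGroup.rightRel Γ) => φ q.out).Finite := by
  apply (hf.image (cosetMulRight Γ h)).subset
  intro q hq
  refine ⟨(cosetMulRight Γ h).symm q, ?_, Equiv.apply_symm_apply _ q⟩
  rw [Function.mem_support, ← apply_out_cosetMulRight hφ, Equiv.apply_symm_apply]
  exact hq

end CosetSum

/-! ### Products of quasimodular Hecke operators -/

theorem exists_inclSL_of_mem {N : ℕ} {γ : Matrix.GLPos (Fin 2) ℚ} (h : γ ∈ GammaQ N) :
    ∃ δ, γ = inclSL δ := by
  obtain ⟨δ, -, rfl⟩ := h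
  exact ⟨δ, rfl⟩

theorem inclSL_injective : Function.Injective inclSL := by
  intro γ δ h
  ext i j
  have := congrArg (fun α : Matrix.GLPos (Fin 2) ℚ => (α : GL (Fin 2) ℚ) i j) h
  simpa [inclSL] using this

/-- `ι : H → GL₂⁺(ℚ)` is injective and maps `Γ ≤ H` onto `Γ(N)`. -/
structure IsLevel (N : ℕ) {H : Type} [Group H] (ι : H →* Matrix.GLPos (Fin 2) ℚ)
    (Γ : Subgroup H) : Prop where
  injective : Function.Injective ι
  map_eq : Γ.map ι = GammaQ N

/-- The identity of GL₂⁺(ℚ) yields the product ∗, and the inclusion of SL₂(ℤ) yields ∗ʳ. Both are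
treated at once through a general ι. -/
theorem isLevel_id (N : ℕ) : IsLevel N (MonoidHom.id _) (GammaQ N) :=
  ⟨Function.injective_id, Subgroup.map_id _⟩

theorem isLevel_inclSL (N : ℕ) : IsLevel N inclSL (CongruenceSubgroup.Gamma N) :=
  ⟨inclSL_injective, rfl⟩

section Product

variable {N : ℕ} {H : Type} [Group H] {ι : H →* Matrix.GLPos (Fin 2) ℚ} {Γ : Subgroup H}

/-- The summand `F_β (G_{αβ⁻¹}‖β)` of the Hecke product. -/
def heckeTerm (ι : H →* Matrix.GLPos (Fin 2) ℚ) (F G : Matrix.GLPos (Fin 2) ℚ → ℍ → ℂ)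
    (α : Matrix.GLPos (Fin 2) ℚ) (h : H) : ℍ → ℂ :=
  F (ι h) * qslash (ι h) (G (α * (ι h)⁻¹))

/-- The product `∑_{β ∈ Γ \ H} F_β (G_{αβ⁻¹}‖β)`. -/
def cosetMul (ι : H →* Matrix.GLPos (Fin 2) ℚ) (Γ : Subgroup H)
    (F G : Matrix.GLPos (Fin 2) ℚ → ℍ → ℂ) (α : Matrix.GLPos (Fin 2) ℚ) : ℍ → ℂ :=
  ∑ᶠ β : Quotient (QuotientGroup.rightRel Γ), heckeTerm ι F G α β.out

theorem IsLevel.mem (hι : IsLevel N ι Γ) {γ : H} (hγ : γ ∈ Γ) : ι γ ∈ GammaQ N := by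
  rw [← hι.map_eq]
  exact ⟨γ, hγ, rfl⟩

/-- Replacing β by γβ turns G_{αβ⁻¹} into G_{αβ⁻¹}‖γ⁻¹, which ‖γβ undoes. Hence the Hecke sum does
not depend on representatives. -/
theorem heckeTerm_mul_left (hι : IsLevel N ι Γ) (F G : QHecke N) (α : Matrix.GLPos (Fin 2) ℚ) :
    ∀ γ ∈ Γ, ∀ h, heckeTerm ι F.1 G.1 α (γ * h) = heckeTerm ι F.1 G.1 α h := by
  intro γ hγ h
  have hm := hι.mem hγ
  rw [heckeTerm, heckeTerm, map_mul, F.2.2.1 _ hm, mul_inv_rev, ← mul_assoc,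
    G.2.2.2.2 _ (inv_mem hm), qslash_qslash _ _ (G.2.1 _), ← mul_assoc, inv_mul_cancel, one_mul]

theorem heckeTerm_mem (F G : QHecke N) (α : Matrix.GLPos (Fin 2) ℚ) (h : H) :
    heckeTerm ι F.1 G.1 α h ∈ QM :=
  QM_mul (F.2.1 _) (qslash_mem _ (G.2.1 _))

theorem heckeTerm_eq_zero_left {F : Matrix.GLPos (Fin 2) ℚ → ℍ → ℂ} {h : H} (hF : F (ι h) = 0)
    (G : Matrix.GLPos (Fin 2) ℚ → ℍ → ℂ) (α : Matrix.GLPos (Fin 2) ℚ) :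
    heckeTerm ι F G α h = 0 := by
  rw [heckeTerm, hF, zero_mul]

theorem heckeTerm_eq_zero_right (F : Matrix.GLPos (Fin 2) ℚ → ℍ → ℂ) {h : H}
    {G : Matrix.GLPos (Fin 2) ℚ → ℍ → ℂ} {α : Matrix.GLPos (Fin 2) ℚ}
    (hG : G (α * (ι h)⁻¹) = 0) : heckeTerm ι F G α h = 0 := by
  rw [heckeTerm, hG, map_zero, mul_zero]

/-- Since ι is injective and carries Γ onto Γ(N), it embeds Γ\H into Γ(N)\GL₂⁺(ℚ), where F has
finite support. -/
theorem finite_support_out (hι : IsLevel N ι Γ) (F : QHecke N) :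
    {q : Quotient (QuotientGroup.rightRel Γ) | F.1 (ι q.out) ≠ 0}.Finite := by
  apply Set.Finite.of_finite_image (f := fun q => (Quotient.mk _ (ι q.out) : Cosets N))
  · apply F.2.2.2.1.subset
    rintro _ ⟨q, hq, rfl⟩
    exact ⟨ι q.out, hq, rfl⟩
  · intro q _ q' _ h
    have h1 : (QuotientGroup.rightRel (GammaQ N)) (ι q.out) (ι q'.out) := Quotient.exact h
    rw [QuotientGroup.rightRel_apply, ← hι.map_eq, ← map_inv, ← map_mul] at h1
    obtain ⟨γ, hγ, e⟩ := h1
    rw [hι.injective e] at hγ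
    rw [← Quotient.out_eq q, ← Quotient.out_eq q']
    exact Quotient.sound ((QuotientGroup.rightRel_apply).2 hγ)

/-- The support of `F` in `Γ \ H`. -/
def supportFinset (hι : IsLevel N ι Γ) (F : QHecke N) :
    Finset (Quotient (QuotientGroup.rightRel Γ)) := (finite_support_out hι F).toFinset

theorem apply_eq_zero_of_notMem (hι : IsLevel N ι Γ) (F : QHecke N)
    {q : Quotient (QuotientGroup.rightRel Γ)} (hq : q ∉ supportFinset hι F) :
    F.1 (ι q.out) = 0 := by
  by_contra h
  exact hq ((Set.Finite.mem_toFinset _).2 h)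

theorem cosetMul_eq_sum {T : Finset (Quotient (QuotientGroup.rightRel Γ))}
    {F : Matrix.GLPos (Fin 2) ℚ → ℍ → ℂ} (hT : ∀ q ∉ T, F (ι q.out) = 0)
    (G : Matrix.GLPos (Fin 2) ℚ → ℍ → ℂ) (α : Matrix.GLPos (Fin 2) ℚ) :
    cosetMul ι Γ F G α = ∑ q ∈ T, heckeTerm ι F G α q.out := by
  apply finsum_eq_sum_of_support_subset
  intro q hq
  by_contra h
  exact hq (heckeTerm_eq_zero_left (hT q h) _ _)

theorem cosetMul_mem (hι : IsLevel N ι Γ) (F G : QHecke N) :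
    cosetMul ι Γ F.1 G.1 ∈ QHecke N := by
  have hs := fun α => cosetMul_eq_sum (ι := ι) (Γ := Γ) (T := supportFinset hι F) (F := F.1)
    (fun q hq => apply_eq_zero_of_notMem hι F hq) G.1 α
  refine ⟨fun α => ?_, fun γ hγ α => ?_, ?_, fun γ hγ α => ?_⟩
  · rw [hs]
    exact QM.sum_mem fun q _ => heckeTerm_mem F G α _
  · rw [hs, hs]
    refine Finset.sum_congr rfl fun q _ => ?_
    rw [heckeTerm, heckeTerm, mul_assoc, G.2.2.1 γ hγ]
  -- A nonzero value at α forces G_{αβ⁻¹} ≠ 0 for some β in the support of F. So the coset of α lies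
  -- in one of finitely many right translates of the support of G.
  · apply ((supportFinset hι F).finite_toSet.biUnion fun q _ =>
      (G.2.2.2.1).image (cosetMulRight (GammaQ N) (ι q.out))).subset
    rintro _ ⟨α, hα, rfl⟩
    have hα : cosetMul ι Γ F.1 G.1 α ≠ 0 := hα
    rw [hs] at hα
    obtain ⟨q, hq, hne⟩ := Finset.exists_ne_zero_of_sum_ne_zero hα
    refine Set.mem_biUnion (Finset.mem_coe.2 hq) ⟨Quotient.mk _ (α * (ι q.out)⁻¹),
      ⟨_, fun h => hne (heckeTerm_eq_zero_right _ h), rfl⟩, ?_⟩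
    change (Quotient.mk _ (α * (ι q.out)⁻¹ * ι q.out) : Cosets N) = _
    rw [inv_mul_cancel_right]
  · have hγ' := hγ
    rw [← hι.map_eq] at hγ'
    obtain ⟨δ, hδ, rfl⟩ := hγ'
    rw [cosetMul, ← finsum_out_mul_right (heckeTerm_mul_left hι F G _) δ, hs, map_sum]
    -- After the substitution β ↦ βδ, each summand at αδ is the ‖δ-image of the summand at α.
    have e : ∀ h, heckeTerm ι F.1 G.1 (α * ι δ) (h * δ)
        = qslash (ι δ) (heckeTerm ι F.1 G.1 α h) := by
      intro h
      rw [heckeTerm, heckeTerm, qslash_mul _ (F.2.1 _) (qslash_mem _ (G.2.1 _)),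
        qslash_qslash _ _ (G.2.1 _), map_mul, F.2.2.2.2 _ hγ, mul_inv_rev]
      congr 3
      group
    simp only [e]
    apply finsum_eq_sum_of_support_subset
    intro q hq
    by_contra h
    apply hq
    have : heckeTerm ι F.1 G.1 α q.out = 0 :=
      heckeTerm_eq_zero_left (apply_eq_zero_of_notMem hι F h) _ _
    simp only [this, map_zero]

/-! ### Bilinearity and associativity of the Hecke products -/

theorem heckeTerm_add_right (F : Matrix.GLPos (Fin 2) ℚ → ℍ → ℂ)
    (G K : Matrix.GLPos (Fin 2) ℚ → ℍ → ℂ) (α : Matrix.GLPos (Fin 2) ℚ) (h : H) :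
    heckeTerm ι F (G + K) α h = heckeTerm ι F G α h + heckeTerm ι F K α h := by
  simp only [heckeTerm, Pi.add_apply, map_add, mul_add]

theorem heckeTerm_smul_right (c : ℂ) (F G : Matrix.GLPos (Fin 2) ℚ → ℍ → ℂ)
    (α : Matrix.GLPos (Fin 2) ℚ) (h : H) :
    heckeTerm ι F (c • G) α h = c • heckeTerm ι F G α h := by
  simp only [heckeTerm, Pi.smul_apply, map_smul, mul_smul_comm]

/-- The Hecke product over `Γ \ H` as a bilinear map. -/
def cosetMulHom (hι : IsLevel N ι Γ) : QHecke N →ₗ[ℂ] QHecke N →ₗ[ℂ] QHecke N :=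
  LinearMap.mk₂ ℂ (fun F G => ⟨cosetMul ι Γ F.1 G.1, cosetMul_mem hι F G⟩)
    (fun F F' G => by
      classical
      apply Subtype.ext
      funext α
      have hF : ∀ q ∉ supportFinset hι F ∪ supportFinset hι F', F.1 (ι q.out) = 0 :=
        fun q hq => apply_eq_zero_of_notMem hι F fun h => hq (Finset.mem_union_left _ h)
      have hF' : ∀ q ∉ supportFinset hι F ∪ supportFinset hι F', F'.1 (ι q.out) = 0 :=
        fun q hq => apply_eq_zero_of_notMem hι F' fun h => hq (Finset.mem_union_right _ h)
      have hFF : ∀ q ∉ supportFinset hι F ∪ supportFinset hι F', (F + F').1 (ι q.out) = 0 :=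
        fun q hq => by
          change F.1 (ι q.out) + F'.1 (ι q.out) = 0
          rw [hF q hq, hF' q hq, add_zero]
      change cosetMul ι Γ (F + F').1 G.1 α = cosetMul ι Γ F.1 G.1 α + cosetMul ι Γ F'.1 G.1 α
      rw [cosetMul_eq_sum hF, cosetMul_eq_sum hF', cosetMul_eq_sum hFF, ← Finset.sum_add_distrib]
      exact Finset.sum_congr rfl fun q _ => add_mul _ _ _)
    (fun c F G => by
      apply Subtype.ext
      funext α
      have hF : ∀ q ∉ supportFinset hι F, F.1 (ι q.out) = 0 :=
        fun q hq => apply_eq_zero_of_notMem hι F hq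
      have hF' : ∀ q ∉ supportFinset hι F, (c • F).1 (ι q.out) = 0 := fun q hq => by
        change c • F.1 (ι q.out) = 0
        rw [hF q hq, smul_zero]
      change cosetMul ι Γ (c • F).1 G.1 α = c • cosetMul ι Γ F.1 G.1 α
      rw [cosetMul_eq_sum hF, cosetMul_eq_sum hF', Finset.smul_sum]
      exact Finset.sum_congr rfl fun q _ => smul_mul_assoc c (F.1 (ι q.out)) _)
    (fun F G G' => by
      apply Subtype.ext
      funext α
      have hF : ∀ q ∉ supportFinset hι F, F.1 (ι q.out) = 0 :=
        fun q hq => apply_eq_zero_of_notMem hι F hq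
      change cosetMul ι Γ F.1 (G.1 + G'.1) α = cosetMul ι Γ F.1 G.1 α + cosetMul ι Γ F.1 G'.1 α
      rw [cosetMul_eq_sum hF, cosetMul_eq_sum hF, cosetMul_eq_sum hF, ← Finset.sum_add_distrib]
      exact Finset.sum_congr rfl fun q _ => heckeTerm_add_right _ _ _ _ _)
    (fun c F G => by
      apply Subtype.ext
      funext α
      have hF : ∀ q ∉ supportFinset hι F, F.1 (ι q.out) = 0 :=
        fun q hq => apply_eq_zero_of_notMem hι F hq
      change cosetMul ι Γ F.1 (c • G.1) α = c • cosetMul ι Γ F.1 G.1 α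
      rw [cosetMul_eq_sum hF, cosetMul_eq_sum hF, Finset.smul_sum]
      exact Finset.sum_congr rfl fun q _ => heckeTerm_smul_right _ _ _ _ _)

theorem cosetMulHom_apply (hι : IsLevel N ι Γ) (F G : QHecke N) :
    (cosetMulHom hι F G).1 = cosetMul ι Γ F.1 G.1 := rfl

theorem cosetMulHom_assoc (hι : IsLevel N ι Γ) (F G K : QHecke N) :
    cosetMulHom hι (cosetMulHom hι F G) K = cosetMulHom hι F (cosetMulHom hι G K) := by
  apply Subtype.ext
  funext α
  have hF : ∀ q ∉ supportFinset hι F, F.1 (ι q.out) = 0 :=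
    fun q hq => apply_eq_zero_of_notMem hι F hq
  have hG : ∀ q ∉ supportFinset hι G, G.1 (ι q.out) = 0 :=
    fun q hq => apply_eq_zero_of_notMem hι G hq
  rw [cosetMulHom_apply hι (cosetMulHom hι F G), cosetMulHom_apply hι F (cosetMulHom hι G K),
    cosetMul_eq_sum hF]
  -- Summed over h, ψ b h gives (G ∗ K)_{αb⁻¹}‖b after the substitution h ↦ hb. Multiplied by F_b
  -- and summed over b, it gives (F ∗ G)_h·(K_{αh⁻¹}‖h). Associativity is then an exchange of
  -- summations.
  let ψ : H → H → ℍ → ℂ := fun b h =>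
    qslash (ι b) (G.1 (ι h * (ι b)⁻¹)) * qslash (ι h) (K.1 (α * (ι h)⁻¹))
  have hψ : ∀ b, ∀ γ ∈ Γ, ∀ h, ψ b (γ * h) = ψ b h := by
    intro b γ hγ h
    have hm := hι.mem hγ
    simp only [ψ]
    rw [map_mul, mul_assoc, G.2.2.1 _ hm, mul_inv_rev, ← mul_assoc α, K.2.2.2.2 _ (inv_mem hm),
      qslash_qslash _ _ (K.2.1 _), ← mul_assoc, inv_mul_cancel, one_mul]
  have hψ' : ∀ b h, ψ b (h * b) = qslash (ι b) (heckeTerm ι G.1 K.1 (α * (ι b)⁻¹) h) := by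
    intro b h
    simp only [ψ]
    rw [heckeTerm, qslash_mul _ (G.2.1 _) (qslash_mem _ (K.2.1 _)), qslash_qslash _ _ (K.2.1 _),
      map_mul, mul_inv_cancel_right, mul_inv_rev, mul_assoc]
  have hz : ∀ b, ∀ q ∉ supportFinset hι G, ψ b (q.out * b) = 0 := by
    intro b q hq
    rw [hψ', heckeTerm_eq_zero_left (hG q hq), map_zero]
  have hr : ∀ b, qslash (ι b) ((cosetMulHom hι G K).1 (α * (ι b)⁻¹))
      = ∑ᶠ q : Quotient (QuotientGroup.rightRel Γ), ψ b q.out := by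
    intro b
    rw [← finsum_out_mul_right (hψ b) b, cosetMulHom_apply, cosetMul_eq_sum hG, map_sum]
    rw [finsum_eq_sum_of_support_subset (s := supportFinset hι G)]
    · exact Finset.sum_congr rfl fun q _ => (hψ' b _).symm
    · intro q hq
      by_contra h
      exact hq (hz b q h)
  have hfin : ∀ b, (Function.support fun q : Quotient (QuotientGroup.rightRel Γ) =>
      ψ b q.out).Finite := by
    intro b
    apply finite_support_out_of_mul_right (hψ b) b
    apply (supportFinset hι G).finite_toSet.subset
    intro q hq
    by_contra h
    exact hq (hz b q h)
  have hR : ∑ q ∈ supportFinset hι F, heckeTerm ι F.1 (cosetMulHom hι G K).1 α q.out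
      = ∑ q ∈ supportFinset hι F, ∑ᶠ p : Quotient (QuotientGroup.rightRel Γ),
        F.1 (ι q.out) * ψ q.out p.out := by
    refine Finset.sum_congr rfl fun q _ => ?_
    rw [heckeTerm, hr]
    exact (AddMonoidHom.mulLeft (F.1 (ι q.out))).map_finsum (hfin q.out)
  rw [hR, ← finsum_sum_comm]
  · refine finsum_congr fun p => ?_
    rw [heckeTerm, cosetMulHom_apply, cosetMul_eq_sum hF, Finset.sum_mul]
    exact Finset.sum_congr rfl fun q _ => mul_assoc _ _ _
  · intro q _
    apply (hfin q.out).subset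
    intro p hp h
    exact hp (by simp only [h, mul_zero])

end Product

/-- The unit of the Hecke algebra. -/
def heckeOne (N : ℕ) : QHecke N := by
  classical
  refine ⟨fun α => if α ∈ GammaQ N then 1 else 0, fun α => ?_, fun γ hγ α => ?_, ?_,
    fun γ hγ α => ?_⟩
  · dsimp only
    split_ifs
    · exact one_mem_QM
    · exact QM.zero_mem
  · simp only [Subgroup.mul_mem_cancel_left _ hγ]
  · apply (Set.finite_singleton (Quotient.mk _ 1 : Cosets N)).subset
    rintro _ ⟨α, hα, rfl⟩
    have hα : α ∈ GammaQ N := by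
      by_contra h
      exact hα (if_neg h)
    refine Quotient.sound ((QuotientGroup.rightRel_apply).2 ?_)
    rw [one_mul]
    exact inv_mem hα
  · simp only [Subgroup.mul_mem_cancel_right _ hγ]
    split_ifs
    · rw [qslash_apply_one]
    · rw [map_zero]

theorem heckeOne_of_mem {N : ℕ} {α : Matrix.GLPos (Fin 2) ℚ} (h : α ∈ GammaQ N) :
    (heckeOne N).1 α = 1 := if_pos h

theorem heckeOne_of_notMem {N : ℕ} {α : Matrix.GLPos (Fin 2) ℚ} (h : α ∉ GammaQ N) :
    (heckeOne N).1 α = 0 := if_neg h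

theorem heckeOne_mul {N : ℕ} (F : QHecke N) : cosetMulHom (isLevel_id N) (heckeOne N) F = F := by
  apply Subtype.ext
  funext α
  rw [cosetMulHom_apply, cosetMul, finsum_eq_single _ (Quotient.mk _ 1)]
  · rw [apply_out_mk (heckeTerm_mul_left (isLevel_id N) (heckeOne N) F α)]
    rw [heckeTerm, map_one, heckeOne_of_mem (one_mem _), one_mul, inv_one, mul_one,
      qslash_one (F.2.1 α)]
  · intro q hq
    apply heckeTerm_eq_zero_left
    apply heckeOne_of_notMem
    intro h
    apply hq
    rw [← Quotient.out_eq q]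
    refine Quotient.sound ((QuotientGroup.rightRel_apply).2 ?_)
    rw [one_mul]
    exact inv_mem h

theorem mul_heckeOne {N : ℕ} (F : QHecke N) : cosetMulHom (isLevel_id N) F (heckeOne N) = F := by
  apply Subtype.ext
  funext α
  rw [cosetMulHom_apply, cosetMul, finsum_eq_single _ (Quotient.mk _ α)]
  · rw [apply_out_mk (heckeTerm_mul_left (isLevel_id N) F (heckeOne N) α)]
    rw [heckeTerm, MonoidHom.id_apply, mul_inv_cancel, heckeOne_of_mem (one_mem _),
      qslash_apply_one, mul_one]
  · intro q hq
    apply heckeTerm_eq_zero_right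
    apply heckeOne_of_notMem
    intro h
    apply hq
    rw [← Quotient.out_eq q]
    exact Quotient.sound ((QuotientGroup.rightRel_apply).2 h)

end QMHecke
end

noncomputable section

namespace QMHecke

open UpperHalfPlane Derivative

/-! ### Hopf actions are determined on generators -/

section HopfAction

variable {H A : Type} [Ring H] [HopfAlgebra ℂ H] [AddCommGroup A] [Module ℂ A]

/-- The action `u = ∑ h ⊗ k ↦ ∑ h(a) k(b)`. -/
def tensorAct (mul : A →ₗ[ℂ] A →ₗ[ℂ] A) (ρ : H →ₐ[ℂ] Module.End ℂ A) (a b : A) :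
    H ⊗[ℂ] H →ₗ[ℂ] A :=
  TensorProduct.lift (mul.compl₁₂ (ρ.toLinearMap.flip a) (ρ.toLinearMap.flip b))

theorem tensorAct_tmul (mul : A →ₗ[ℂ] A →ₗ[ℂ] A) (ρ : H →ₐ[ℂ] Module.End ℂ A) (a b : A)
    (h k : H) : tensorAct mul ρ a b (h ⊗ₜ[ℂ] k) = mul (ρ h a) (ρ k b) := rfl

theorem tensorAct_primitive (mul : A →ₗ[ℂ] A →ₗ[ℂ] A) (ρ : H →ₐ[ℂ] Module.End ℂ A) (a b : A)
    (h : H) : tensorAct mul ρ a b (h ⊗ₜ[ℂ] 1 + 1 ⊗ₜ[ℂ] h) = mul (ρ h a) b + mul a (ρ h b) := by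
  rw [map_add, tensorAct_tmul, tensorAct_tmul, map_one, Module.End.one_apply, Module.End.one_apply]

theorem tensorAct_mul_tmul (mul : A →ₗ[ℂ] A →ₗ[ℂ] A) (ρ : H →ₐ[ℂ] Module.End ℂ A) (a b : A)
    (u : H ⊗[ℂ] H) (h k : H) :
    tensorAct mul ρ a b (u * (h ⊗ₜ[ℂ] k)) = tensorAct mul ρ (ρ h a) (ρ k b) u := by
  induction u using TensorProduct.induction_on with
  | zero => rw [zero_mul, map_zero, map_zero]
  | add u v hu hv => rw [add_mul, map_add, map_add, hu, hv]
  | tmul p q =>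
    rw [Algebra.TensorProduct.tmul_mul_tmul, tensorAct_tmul, tensorAct_tmul, map_mul, map_mul]
    rfl

/-- If the elements of a generating set of `H` act compatibly with the coproduct, so does `H`. -/
theorem isHopfAction_of_adjoin (mul : A →ₗ[ℂ] A →ₗ[ℂ] A) (ρ : H →ₐ[ℂ] Module.End ℂ A) (s : Set H)
    (hs : Algebra.adjoin ℂ s = ⊤)
    (h : ∀ x ∈ s, ∀ a b, ρ x (mul a b) = tensorAct mul ρ a b (Coalgebra.comul (R := ℂ) x)) :
    IsHopfAction mul ρ := by
  suffices H0 : ∀ x a b, ρ x (mul a b) = tensorAct mul ρ a b (Coalgebra.comul (R := ℂ) x) from H0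
  intro x
  have hx : x ∈ Algebra.adjoin ℂ s := hs ▸ Algebra.mem_top
  induction hx using Algebra.adjoin_induction with
  | mem x hx => exact h x hx
  | algebraMap r =>
    intro a b
    rw [AlgHom.commutes, Bialgebra.comul_algebraMap, Algebra.algebraMap_eq_smul_one,
      Algebra.algebraMap_eq_smul_one, map_smul, Algebra.TensorProduct.one_def, tensorAct_tmul,
      map_one]
    rfl
  | add x y _ _ hx hy =>
    intro a b
    rw [map_add, map_add, map_add, LinearMap.add_apply, hx, hy]
  | mul x y _ _ hx hy =>
    intro a b
    rw [map_mul, Module.End.mul_apply, hy, Bialgebra.comul_mul]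
    -- By linearity Δ(y) may be taken to be p ⊗ q, and the hypothesis for x is applied to the
    -- vectors p(a) and q(b).
    generalize Coalgebra.comul (R := ℂ) y = v
    induction v using TensorProduct.induction_on with
    | zero => simp only [mul_zero, map_zero]
    | add u v hu hv => rw [mul_add, map_add, map_add, map_add, hu, hv]
    | tmul p q => rw [tensorAct_tmul, hx, tensorAct_mul_tmul]

end HopfAction

/-! ### The operators on quasimodular Hecke operators -/

/-- A family of operators on `𝒬ℳ` compatible with the action of `Γ(N)` acts on `𝒬(Γ(N))`. -/
structure IsEquivariant (N : ℕ) (T : Matrix.GLPos (Fin 2) ℚ → (ℍ → ℂ) →ₗ[ℂ] (ℍ → ℂ)) : Prop where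
  mem : ∀ α, ∀ f ∈ QM, T α f ∈ QM
  mul_left : ∀ γ ∈ GammaQ N, ∀ α, T (γ * α) = T α
  mul_right : ∀ γ ∈ GammaQ N, ∀ α, ∀ f ∈ QM, T (α * γ) (qslash γ f) = qslash γ (T α f)

/-- The operator `F ↦ (α ↦ T_α(F_α))`. -/
def pointwiseEnd {N : ℕ} {T : Matrix.GLPos (Fin 2) ℚ → (ℍ → ℂ) →ₗ[ℂ] (ℍ → ℂ)}
    (hT : IsEquivariant N T) : Module.End ℂ (QHecke N) where
  toFun F := ⟨fun α => T α (F.1 α), fun α => hT.mem α _ (F.2.1 α), fun γ hγ α => by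
      dsimp only
      rw [hT.mul_left γ hγ, F.2.2.1 γ hγ],
    F.2.2.2.1.subset (Set.image_mono fun α hα h => hα (by simp only [h, map_zero])),
    fun γ hγ α => by
      dsimp only
      rw [F.2.2.2.2 γ hγ, hT.mul_right γ hγ α _ (F.2.1 α)]⟩
  map_add' F G := Subtype.ext (funext fun α => map_add (T α) _ _)
  map_smul' c F := Subtype.ext (funext fun α => map_smul (T α) c _)

theorem pointwiseEnd_apply {N : ℕ} {T : Matrix.GLPos (Fin 2) ℚ → (ℍ → ℂ) →ₗ[ℂ] (ℍ → ℂ)}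
    (hT : IsEquivariant N T) (F : QHecke N) (α : Matrix.GLPos (Fin 2) ℚ) :
    (pointwiseEnd hT F).1 α = T α (F.1 α) := rfl

theorem isEquivariant_opX (N : ℕ) : IsEquivariant N fun _ => opX :=
  ⟨fun _ _ hf => opX_mem hf, fun _ _ _ => rfl, fun γ hγ _ f hf => by
    obtain ⟨δ, rfl⟩ := exists_inclSL_of_mem hγ
    exact opX_qslash_inclSL δ hf⟩

theorem isEquivariant_opY (N : ℕ) : IsEquivariant N fun _ => opY :=
  ⟨fun _ _ hf => opY_mem hf, fun _ _ _ => rfl, fun γ _ _ _ hf => opY_qslash γ hf⟩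

theorem isEquivariant_muIter (N n : ℕ) :
    IsEquivariant N fun α => LinearMap.mulLeft ℂ (muIter n α) :=
  ⟨fun α _ hf => QM_mul (muIter_mem n α) hf, fun γ hγ α => by
    obtain ⟨δ, rfl⟩ := exists_inclSL_of_mem hγ
    rw [muIter_inclSL_mul], fun γ hγ α f hf => by
    obtain ⟨δ, rfl⟩ := exists_inclSL_of_mem hγ
    rw [muIter_mul_inclSL, LinearMap.mulLeft_apply, LinearMap.mulLeft_apply,
      qslash_mul _ (muIter_mem n α) hf]⟩

/-- The operator `X` on `𝒬(Γ(N))`. -/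
def heckeX (N : ℕ) : Module.End ℂ (QHecke N) := pointwiseEnd (isEquivariant_opX N)

/-- The operator `Y` on `𝒬(Γ(N))`. -/
def heckeY (N : ℕ) : Module.End ℂ (QHecke N) := pointwiseEnd (isEquivariant_opY N)

/-- The operator `δ_{n+1}` on `𝒬(Γ(N))`. -/
def heckeδ (N n : ℕ) : Module.End ℂ (QHecke N) := pointwiseEnd (isEquivariant_muIter N n)

variable {N : ℕ}

theorem heckeX_apply (F : QHecke N) (α : Matrix.GLPos (Fin 2) ℚ) :
    (heckeX N F).1 α = opX (F.1 α) := rfl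

theorem heckeY_apply (F : QHecke N) (α : Matrix.GLPos (Fin 2) ℚ) :
    (heckeY N F).1 α = opY (F.1 α) := rfl

theorem heckeδ_apply (n : ℕ) (F : QHecke N) (α : Matrix.GLPos (Fin 2) ℚ) :
    (heckeδ N n F).1 α = muIter n α * F.1 α := rfl

theorem heckeY_heckeX : heckeY N * heckeX N - heckeX N * heckeY N = heckeX N := by
  refine LinearMap.ext fun F => Subtype.ext (funext fun α => ?_)
  change opY (opX (F.1 α)) - opX (opY (F.1 α)) = opX (F.1 α)
  rw [opY_opX (F.2.1 α), add_sub_cancel_left]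

theorem heckeX_heckeδ (n : ℕ) :
    heckeX N * heckeδ N n - heckeδ N n * heckeX N = heckeδ N (n + 1) := by
  refine LinearMap.ext fun F => Subtype.ext (funext fun α => ?_)
  change opX (muIter n α * F.1 α) - muIter n α * opX (F.1 α) = muIter (n + 1) α * F.1 α
  rw [opX_mul (muIter_mem n α) (F.2.1 α), add_sub_cancel_right, muIter_succ]

theorem heckeY_heckeδ_zero :
    heckeY N * heckeδ N 0 - heckeδ N 0 * heckeY N = heckeδ N 0 := by
  refine LinearMap.ext fun F => Subtype.ext (funext fun α => ?_)
  change opY (muIter 0 α * F.1 α) - muIter 0 α * opY (F.1 α) = muIter 0 α * F.1 α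
  rw [opY_mul (muIter_mem 0 α) (F.2.1 α), add_sub_cancel_right, opY_muIter]
  simp

theorem heckeδ_commute (k l : ℕ) : Commute (heckeδ N k) (heckeδ N l) :=
  LinearMap.ext fun F => Subtype.ext (funext fun α => by
    change muIter k α * (muIter l α * F.1 α) = muIter l α * (muIter k α * F.1 α)
    ring)

/-! ### Compatibility with the Hecke products -/

section Leibniz

variable {H : Type} [Group H] {ι : H →* Matrix.GLPos (Fin 2) ℚ} {Γ : Subgroup H}
  (hι : IsLevel N ι Γ) (F G : QHecke N)

include hι in
theorem pointwiseEnd_apply_eq_zero {T : Matrix.GLPos (Fin 2) ℚ → (ℍ → ℂ) →ₗ[ℂ] (ℍ → ℂ)}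
    (hT : IsEquivariant N T) :
    ∀ q ∉ supportFinset hι F, (pointwiseEnd hT F).1 (ι (Quotient.out q)) = 0 := by
  intro q hq
  rw [pointwiseEnd_apply, apply_eq_zero_of_notMem hι F hq, map_zero]

/-- Termwise, the Leibniz rule and `opX_qslash` produce the extra factor μ_β. It depends only on β
and so joins F_β to form δ₁(F)_β. -/
theorem heckeX_mul :
    heckeX N (cosetMulHom hι F G) = cosetMulHom hι (heckeX N F) G + cosetMulHom hι F (heckeX N G)
      + cosetMulHom hι (heckeδ N 0 F) (heckeY N G) := by
  refine Subtype.ext (funext fun α => ?_)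
  have hF : ∀ q ∉ supportFinset hι F, F.1 (ι q.out) = 0 :=
    fun q hq => apply_eq_zero_of_notMem hι F hq
  have hX : ∀ q ∉ supportFinset hι F, (heckeX N F).1 (ι q.out) = 0 :=
    pointwiseEnd_apply_eq_zero hι F (isEquivariant_opX N)
  have hδ : ∀ q ∉ supportFinset hι F, (heckeδ N 0 F).1 (ι q.out) = 0 :=
    pointwiseEnd_apply_eq_zero hι F (isEquivariant_muIter N 0)
  change opX (cosetMul ι Γ F.1 G.1 α) = cosetMul ι Γ (heckeX N F).1 G.1 α
    + cosetMul ι Γ F.1 (heckeX N G).1 α + cosetMul ι Γ (heckeδ N 0 F).1 (heckeY N G).1 α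
  rw [cosetMul_eq_sum hF,
    cosetMul_eq_sum hX,
    cosetMul_eq_sum hF,
    cosetMul_eq_sum hδ, map_sum,
    ← Finset.sum_add_distrib, ← Finset.sum_add_distrib]
  refine Finset.sum_congr rfl fun q _ => ?_
  simp only [heckeTerm, heckeX_apply, heckeY_apply, heckeδ_apply, muIter_zero]
  rw [opX_mul (F.2.1 _) (qslash_mem _ (G.2.1 _)), opX_qslash _ (G.2.1 _)]
  ring

theorem heckeY_mul :
    heckeY N (cosetMulHom hι F G) =
      cosetMulHom hι (heckeY N F) G + cosetMulHom hι F (heckeY N G) := by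
  refine Subtype.ext (funext fun α => ?_)
  have hF : ∀ q ∉ supportFinset hι F, F.1 (ι q.out) = 0 :=
    fun q hq => apply_eq_zero_of_notMem hι F hq
  have hY : ∀ q ∉ supportFinset hι F, (heckeY N F).1 (ι q.out) = 0 :=
    pointwiseEnd_apply_eq_zero hι F (isEquivariant_opY N)
  change opY (cosetMul ι Γ F.1 G.1 α) = cosetMul ι Γ (heckeY N F).1 G.1 α
    + cosetMul ι Γ F.1 (heckeY N G).1 α
  rw [cosetMul_eq_sum hF,
    cosetMul_eq_sum hY,
    cosetMul_eq_sum hF, map_sum,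
    ← Finset.sum_add_distrib]
  refine Finset.sum_congr rfl fun q _ => ?_
  simp only [heckeTerm, heckeY_apply]
  rw [opY_mul (F.2.1 _) (qslash_mem _ (G.2.1 _)), opY_qslash _ (G.2.1 _)]

theorem heckeδ_mul :
    heckeδ N 0 (cosetMulHom hι F G) =
      cosetMulHom hι (heckeδ N 0 F) G + cosetMulHom hι F (heckeδ N 0 G) := by
  refine Subtype.ext (funext fun α => ?_)
  have hF : ∀ q ∉ supportFinset hι F, F.1 (ι q.out) = 0 :=
    fun q hq => apply_eq_zero_of_notMem hι F hq
  have hδ : ∀ q ∉ supportFinset hι F, (heckeδ N 0 F).1 (ι q.out) = 0 :=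
    pointwiseEnd_apply_eq_zero hι F (isEquivariant_muIter N 0)
  change muIter 0 α * cosetMul ι Γ F.1 G.1 α = cosetMul ι Γ (heckeδ N 0 F).1 G.1 α
    + cosetMul ι Γ F.1 (heckeδ N 0 G).1 α
  rw [cosetMul_eq_sum hF,
    cosetMul_eq_sum hδ,
    cosetMul_eq_sum hF, Finset.mul_sum,
    ← Finset.sum_add_distrib]
  refine Finset.sum_congr rfl fun q _ => ?_
  simp only [heckeTerm, heckeδ_apply, muIter_zero]
  -- The cocycle relation for α = (αβ⁻¹)β splits μ_α into a part acting on G_{αβ⁻¹} under ‖β and a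
  -- part acting on F_β.
  have h := qslash_mu (α * (ι q.out)⁻¹) (ι q.out)
  rw [inv_mul_cancel_right] at h
  rw [qslash_mul _ (mu_mem_QM _) (G.2.1 _), h]
  ring

end Leibniz

/-- For the product over `Γ(N) \ SL₂(ℤ)`, the twist by `δ₁` disappears. -/
theorem cosetMulHom_heckeδ_left (F G : QHecke N) :
    cosetMulHom (isLevel_inclSL N) (heckeδ N 0 F) G = 0 := by
  refine Subtype.ext (funext fun α => ?_)
  rw [cosetMulHom_apply]
  refine finsum_eq_zero_of_forall_eq_zero fun q => heckeTerm_eq_zero_left ?_ _ _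
  rw [heckeδ_apply, muIter_zero, mu_inclSL, zero_mul]

/-! ### The action on the unit -/

theorem heckeX_heckeOne : heckeX N (heckeOne N) = 0 := by
  refine Subtype.ext (funext fun α => ?_)
  rw [heckeX_apply]
  by_cases h : α ∈ GammaQ N
  · rw [heckeOne_of_mem h, opX_one]; rfl
  · rw [heckeOne_of_notMem h, map_zero]; rfl

theorem heckeY_heckeOne : heckeY N (heckeOne N) = 0 := by
  refine Subtype.ext (funext fun α => ?_)
  rw [heckeY_apply]
  by_cases h : α ∈ GammaQ N
  · rw [heckeOne_of_mem h, opY_one]; rfl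
  · rw [heckeOne_of_notMem h, map_zero]; rfl

theorem heckeδ_heckeOne : heckeδ N 0 (heckeOne N) = 0 := by
  refine Subtype.ext (funext fun α => ?_)
  rw [heckeδ_apply]
  by_cases h : α ∈ GammaQ N
  · obtain ⟨δ, rfl⟩ := exists_inclSL_of_mem h
    rw [muIter_zero, mu_inclSL, zero_mul]; rfl
  · rw [heckeOne_of_notMem h, mul_zero]; rfl

/-! ### The Hopf actions -/

attribute [local instance 100] LieRing.ofAssociativeRing

/-- By `H1.genMap_rel`, only the relations among X, Y and δ₁ need checking, once the multiplications
by X^n(μ_α) are known to commute and to generate an algebra stable under bracketing with X. -/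
theorem hecke_rel (N : ℕ) :
    ∀ r ∈ relL1, FreeLieAlgebra.lift ℂ (H1.genMap (heckeX N) (heckeY N) (heckeδ N 0)) r = 0 := by
  refine H1.genMap_rel _ _ _ (Set.range (heckeδ N)) heckeY_heckeX heckeY_heckeδ_zero
    (Algebra.subset_adjoin ⟨0, rfl⟩) ?_ ?_
  · rintro _ ⟨k, rfl⟩ _ ⟨l, rfl⟩
    exact heckeδ_commute k l
  · rintro _ ⟨n, rfl⟩
    exact Algebra.subset_adjoin ⟨n + 1, (heckeX_heckeδ n).symm⟩

/-- The action of `ℋ₁` on `𝒬(Γ(N))`. -/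
def actH1 (N : ℕ) : H1 →ₐ[ℂ] Module.End ℂ (QHecke N) :=
  H1.lift (heckeX N) (heckeY N) (heckeδ N 0) (hecke_rel N)

theorem actH1_X : actH1 N H1.X = heckeX N := H1.lift_X _ _ _ _

theorem actH1_Y : actH1 N H1.Y = heckeY N := H1.lift_Y _ _ _ _

/-- The action prescribes δ₁ alone, and the other δ_n follow from [X, δ_n] = δ_{n+1}. The operators
`heckeδ` are indexed from 0, hence the shift. -/
theorem actH1_δ (n : ℕ+) : actH1 N (H1.δ n) = heckeδ N ((n : ℕ) - 1) := by
  induction n using PNat.recOn with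
  | one => exact H1.lift_δ _ _ _ _
  | succ n ih =>
    have e : ((n + 1 : ℕ+) : ℕ) - 1 = ((n : ℕ) - 1) + 1 := by
      have := n.pos
      rw [PNat.add_coe, PNat.one_coe]
      omega
    rw [← H1.Xδ, map_sub, map_mul, map_mul, ih, actH1_X, heckeX_heckeδ, e]

theorem actH1_δ_one : actH1 N (H1.δ 1) = heckeδ N 0 := H1.lift_δ _ _ _ _

theorem isHopfAction_actH1 : IsHopfAction (cosetMulHom (isLevel_id N)) (actH1 N) := by
  refine isHopfAction_of_adjoin _ _ _ H1.adjoin_eq_top ?_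
  rintro _ (rfl | rfl | rfl) F G
  · rw [H1.comul_eq, H1.comulHom_X, map_add, tensorAct_primitive, tensorAct_tmul, actH1_X,
      actH1_Y, actH1_δ_one, heckeX_mul]
  · rw [H1.comul_eq, H1.comulHom_Y, tensorAct_primitive, actH1_Y, heckeY_mul]
  · rw [H1.comul_eq, H1.comulHom_δ, tensorAct_primitive, actH1_δ_one, heckeδ_mul]

theorem actH1_heckeOne (h : H1) :
    actH1 N h (heckeOne N) = Coalgebra.counit (R := ℂ) h • heckeOne N := by
  have hh : h ∈ Algebra.adjoin ℂ ({H1.X, H1.Y, H1.δ 1} : Set H1) :=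
    H1.adjoin_eq_top ▸ Algebra.mem_top
  rw [H1.counit_eq]
  induction hh using Algebra.adjoin_induction with
  | mem x hx =>
    rcases hx with rfl | rfl | rfl
    · rw [actH1_X, H1.counitHom_X, heckeX_heckeOne, zero_smul]
    · rw [actH1_Y, H1.counitHom_Y, heckeY_heckeOne, zero_smul]
    · rw [actH1_δ_one, H1.counitHom_δ, heckeδ_heckeOne, zero_smul]
  | algebraMap r => rw [AlgHom.commutes, AlgHom.commutes]; rfl
  | add x y _ _ hx hy => rw [map_add, map_add, LinearMap.add_apply, hx, hy, add_smul]
  | mul x y _ _ hx hy =>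
    rw [map_mul, map_mul, Module.End.mul_apply, hy, map_smul, hx, smul_smul, mul_comm]

/-- The action of `𝔥₁` on `𝒬(Γ(N))`. -/
def actSmallH1 (N : ℕ) : SmallH1 →ₐ[ℂ] Module.End ℂ (QHecke N) :=
  SmallH1.lift (heckeX N) (heckeY N) heckeY_heckeX

theorem actSmallH1_X : actSmallH1 N SmallH1.X = heckeX N := SmallH1.lift_X _ _ _

theorem actSmallH1_Y : actSmallH1 N SmallH1.Y = heckeY N := SmallH1.lift_Y _ _ _

theorem isHopfAction_actSmallH1 :
    IsHopfAction (cosetMulHom (isLevel_inclSL N)) (actSmallH1 N) := by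
  refine isHopfAction_of_adjoin _ _ _ SmallH1.adjoin_eq_top ?_
  rintro _ (rfl | rfl) F G
  · rw [SmallH1.comul_eq, SmallH1.comulHom_X, tensorAct_primitive, actSmallH1_X, heckeX_mul,
      cosetMulHom_heckeδ_left, add_zero]
  · rw [SmallH1.comul_eq, SmallH1.comulHom_Y, tensorAct_primitive, actSmallH1_Y, heckeY_mul]

end QMHecke
end

/-- The Hopf action of the Connes–Moscovici Hopf algebra `ℋ₁` on `(𝒬(Γ(N)), ∗)` and of `𝔥₁` on
`(𝒬(Γ(N)), ∗ʳ)`. -/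
theorem mainTheorem1 (N : ℕ) (hN : 1 ≤ N) :
    (∃ (mul : QMHecke.QHecke N →ₗ[ℂ] QMHecke.QHecke N →ₗ[ℂ] QMHecke.QHecke N)
        (one : QMHecke.QHecke N)
        (ρ : QMHecke.H1 →ₐ[ℂ] Module.End ℂ (QMHecke.QHecke N)),
      (∀ F G α, (mul F G).1 α = QMHecke.heckeMul N F.1 G.1 α) ∧
      (∀ F G K, mul (mul F G) K = mul F (mul G K)) ∧
      (∀ F, mul one F = F ∧ mul F one = F) ∧
      (∀ F α, (ρ QMHecke.H1.X F).1 α = QMHecke.opX (F.1 α)) ∧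
      (∀ F α, (ρ QMHecke.H1.Y F).1 α = QMHecke.opY (F.1 α)) ∧
      (∀ (n : ℕ+) F α, (ρ (QMHecke.H1.δ n) F).1 α =
        (QMHecke.opX ^ ((n : ℕ) - 1)) (QMHecke.mu α) * F.1 α) ∧
      QMHecke.IsHopfAction mul ρ ∧
      (∀ h, ρ h one = Coalgebra.counit (R := ℂ) h • one)) ∧
    (∃ (mulR : QMHecke.QHecke N →ₗ[ℂ] QMHecke.QHecke N →ₗ[ℂ] QMHecke.QHecke N)
        (ρ : QMHecke.SmallH1 →ₐ[ℂ] Module.End ℂ (QMHecke.QHecke N)),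
      (∀ F G α, (mulR F G).1 α = QMHecke.heckeMulR N F.1 G.1 α) ∧
      (∀ F G K, mulR (mulR F G) K = mulR F (mulR G K)) ∧
      (∀ F α, (ρ QMHecke.SmallH1.X F).1 α = QMHecke.opX (F.1 α)) ∧
      (∀ F α, (ρ QMHecke.SmallH1.Y F).1 α = QMHecke.opY (F.1 α)) ∧
      QMHecke.IsHopfAction mulR ρ) := by
  refine ⟨⟨QMHecke.cosetMulHom (QMHecke.isLevel_id N), QMHecke.heckeOne N, QMHecke.actH1 N,
    fun _ _ _ => rfl, QMHecke.cosetMulHom_assoc _,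
    fun F => ⟨QMHecke.heckeOne_mul F, QMHecke.mul_heckeOne F⟩,
    fun F α => by rw [QMHecke.actH1_X]; rfl, fun F α => by rw [QMHecke.actH1_Y]; rfl,
    fun n F α => by rw [QMHecke.actH1_δ]; rfl, QMHecke.isHopfAction_actH1,
    QMHecke.actH1_heckeOne⟩,
    ⟨QMHecke.cosetMulHom (QMHecke.isLevel_inclSL N), QMHecke.actSmallH1 N,
    fun _ _ _ => rfl, QMHecke.cosetMulHom_assoc _,
    fun F α => by rw [QMHecke.actSmallH1_X]; rfl, fun F α => by rw [QMHecke.actSmallH1_Y]; rfl,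
    QMHecke.isHopfAction_actSmallH1⟩⟩
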